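/- For $d\ge 1$ let $U_d$ be the law of $RS$, where $R$ is uniform on $[0,1)$, $S$ is uniform on the unit sphere of $\mathbb R^d$, and $R,S$ are independent. For a measure $\mu=U_d$ put $$d_\mu(x,x')=\|x-x'\|-\int\|x-y\|\,d\mu(y)-\int\|y-x'\|\,d\mu(y)+\iint\|y-y'\|\,d\mu(y)\,d\mu(y').$$ Let $p,q\ge 1$, let $U\sim U_p$ and $V\sim U_q$ be independent, and consider the non-zero eigenvalues, counted with multiplicity, of the integral equation $$E\bigl(d_{U_p}(u,U)\,d_{U_q}(v,V)\,\phi(U,V)\bigr)=\lambda\,\phi(u,v),\qquad \phi\in L^2(U_p\otimes U_q).$$ For $d\in\{p,q\}$ with $d\ge 2$ choose, for every $S\ge 1$, distinct unit vectors $r_1^{(S)},\dots,r_S^{(S)}\in\mathbb R^d$ such that the uniform discrete distribution on them converges weakly, as $S\to\infty$, to the uniform distribution on the unit sphere (the choices for $p$ and for $q$ are made separately). For $M_R,M_S\ge1$ put $M=M_RM_S$ and let $\mathcal G^d_{0,M_R,M_S}$ be the grid of the $M$ points $u_1,\dots,u_M$ of the form $\frac{j}{M_R+1}r_k^{(M_S)}$,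 $1\le j\le M_R$, $1\le k\le M_S$. Let $D=(\|u_i-u_j\|)_{i,j}$, let $I$ be the identity matrix and $J$ the all-ones matrix of size $M$, and take as marginal eigenvalues of dimension $d$ the $M-1$ non-zero eigenvalues, with multiplicity, of $(I-J/M)D(I-J/M)/M$. For $d=1$ take instead the numbers $-4/(\pi^2j^2)$, $1\le j\le M-1$. Let $\lambda^{(M)}_1\ge\lambda^{(M)}_2\ge\dots\ge\lambda^{(M)}_{(M-1)^2}$ be all the products of a marginal eigenvalue of dimension $p$ and one of dimension $q$, in decreasing order. Let $\xi_1,\xi_2,\dots$ be independent standard Gaussian random variables. Then the non-zero eigenvalues of the integral equation above can be listed, with multiplicity, as an infinite sequence $(\lambda_k)_{k\ge1}$; and for every such listing the series $\sum_{k=1}^\infty\lambda_k(\xi_k^2-1)$ is almost surely (absolutely) convergent and, for every $\alpha\in(0,1)$, $$Q^{(M)}_{1-\alpha}\longrightarrow Q_{1-\alpha}\qquad\text{as } M_R\to\infty\text{ and }M_S\to\infty,$$ where $Q^{(M)}_{1-\alpha}$ and $Q_{1-\alpha}$ are the $(1-\alpha)$-quantiles of $\sum_{k=1}^{(M-1)^2}\lambda^{(M)}_k(\xi_k^2-1)$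 and of $\sum_{k=1}^\infty\lambda_k(\xi_k^2-1)$. Here the $u$-quantile of a real random variable $Z$ is $\inf\{x\in\mathbb R:P(Z\le x)\ge u\}$. -/

import Mathlib

open MeasureTheory ProbabilityTheory Filter Topology
open scoped BoundedContinuousFunction

namespace CenterOutward

noncomputable section

/-- `ℝ^d` with its Euclidean norm. -/
abbrev E (d : ℕ) : Type := EuclideanSpace ℝ (Fin d)

/-- The uniform probability measure on the unit sphere of `ℝ^d`: normalized surface measure. -/
def sphereUniform (d : ℕ) : Measure (Metric.sphere (0 : E d) 1) :=
  ((volume : Measure (E d)).toSphere Set.univ)⁻¹ • (volume : Measure (E d)).toSphere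

/-- The law `U_d` of `R • S`, where `R` is uniform on `[0, 1)`, `S` is uniform on the unit sphere
of `ℝ^d`, and `R` and `S` are independent. -/
def ballUniform (d : ℕ) : Measure (E d) :=
  Measure.map (fun x : ℝ × Metric.sphere (0 : E d) 1 => x.1 • (x.2 : E d))
    (((volume : Measure ℝ).restrict (Set.Ico 0 1)).prod (sphereUniform d))

/-- The doubly centered distance kernel `d_μ(x, x')` of a measure `μ`. -/
def centeredDist {d : ℕ} (μ : Measure (E d)) (x x' : E d) : ℝ :=
  ‖x - x'‖ - (∫ y, ‖x - y‖ ∂μ) - (∫ y, ‖y - x'‖ ∂μ) + ∫ y, ∫ y', ‖y - y'‖ ∂μ ∂μ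

/-! ### Eigenvalues of integral equations -/

/-- The space of `φ ∈ L²(μ)` that solve the integral equation `∫ K(x, y) φ(y) dμ(y) = c φ(x)`
(for almost every `x`). -/
def kernelEigenspace {X : Type} [MeasurableSpace X] (μ : Measure X) (K : X → X → ℝ) (c : ℝ) :
    Submodule ℝ (Lp ℝ 2 μ) where
  carrier := {φ | ∀ᵐ x ∂μ, Integrable (fun y => K x y * φ y) μ ∧ ∫ y, K x y * φ y ∂μ = c * φ x}
  zero_mem' := by
    have h0 := Lp.coeFn_zero ℝ 2 μ
    have hx : ∀ x, (fun y => K x y * (0 : Lp ℝ 2 μ) y) =ᵐ[μ] fun _ => 0 := fun x => by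
      filter_upwards [h0] with y hy
      rw [hy, Pi.zero_apply, mul_zero]
    change ∀ᵐ x ∂μ, Integrable (fun y => K x y * (0 : Lp ℝ 2 μ) y) μ ∧
      ∫ y, K x y * (0 : Lp ℝ 2 μ) y ∂μ = c * (0 : Lp ℝ 2 μ) x
    filter_upwards [h0] with x hx0
    refine ⟨(integrable_congr (hx x)).2 (integrable_zero _ _ _), ?_⟩
    rw [integral_congr_ae (hx x), hx0]
    simp
  add_mem' := by
    intro φ ψ hφ hψ
    have h0 := Lp.coeFn_add φ ψ
    have hx : ∀ x, (fun y => K x y * (φ + ψ : Lp ℝ 2 μ) y) =ᵐ[μ]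
        fun y => K x y * φ y + K x y * ψ y := fun x => by
      filter_upwards [h0] with y hy
      rw [hy, Pi.add_apply, mul_add]
    change ∀ᵐ x ∂μ, Integrable (fun y => K x y * (φ + ψ : Lp ℝ 2 μ) y) μ ∧
      ∫ y, K x y * (φ + ψ : Lp ℝ 2 μ) y ∂μ = c * (φ + ψ : Lp ℝ 2 μ) x
    filter_upwards [h0, hφ, hψ] with x hx0 h1 h2
    refine ⟨(integrable_congr (hx x)).2 (h1.1.add h2.1), ?_⟩
    rw [integral_congr_ae (hx x), integral_add h1.1 h2.1, h1.2, h2.2, hx0]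
    simp [mul_add]
  smul_mem' := by
    intro a φ hφ
    have h0 := Lp.coeFn_smul a φ
    have hx : ∀ x, (fun y => K x y * (a • φ : Lp ℝ 2 μ) y) =ᵐ[μ]
        fun y => a * (K x y * φ y) := fun x => by
      filter_upwards [h0] with y hy
      rw [hy, Pi.smul_apply, smul_eq_mul]
      ring
    change ∀ᵐ x ∂μ, Integrable (fun y => K x y * (a • φ : Lp ℝ 2 μ) y) μ ∧
      ∫ y, K x y * (a • φ : Lp ℝ 2 μ) y ∂μ = c * (a • φ : Lp ℝ 2 μ) x
    filter_upwards [h0, hφ] with x hx0 h1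
    refine ⟨(integrable_congr (hx x)).2 (h1.1.const_mul a), ?_⟩
    rw [integral_congr_ae (hx x), integral_const_mul, h1.2, hx0]
    simp only [Pi.smul_apply, smul_eq_mul]
    ring

/-- The sequence `ev` lists the non-zero eigenvalues of the integral equation with kernel `K`,
each as often as its multiplicity (the dimension of its eigenspace). -/
def IsNonzeroEigenvalueSequence {X : Type} [MeasurableSpace X] (μ : Measure X) (K : X → X → ℝ)
    (ev : ℕ → ℝ) : Prop :=
  (∀ k, ev k ≠ 0) ∧
    ∀ c : ℝ, c ≠ 0 → Cardinal.mk {k : ℕ // ev k = c} = Module.rank ℝ (kernelEigenspace μ K c)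

/-- The sequence `ev` lists, with multiplicity, the non-zero eigenvalues of
`E (d_U(u, U) d_V(v, V) φ(U, V)) = c φ(u, v)`, with `U ∼ U_p` and `V ∼ U_q` independent. -/
def IsNullEigenvalueSequence (p q : ℕ) (ev : ℕ → ℝ) : Prop :=
  IsNonzeroEigenvalueSequence ((ballUniform p).prod (ballUniform q))
    (fun w w' => centeredDist (ballUniform p) w.1 w'.1 * centeredDist (ballUniform q) w.2 w'.2) ev

/-! ### Grids and their eigenvalues -/

/-- For each `S`, `r S` consists of `S` distinct unit vectors in `ℝ^d`, and the uniform discrete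
distribution on them converges weakly, as `S → ∞`, to the uniform distribution on the sphere. -/
structure IsDirectionArray (d : ℕ) (r : (S : ℕ) → Fin S → E d) : Prop where
  norm_eq_one : ∀ S k, ‖r S k‖ = 1
  distinct : ∀ S, Function.Injective (r S)
  tendsto_uniform : ∀ f : E d →ᵇ ℝ,
    Tendsto (fun S : ℕ => (∑ k, f (r S k)) / (S : ℝ)) atTop
      (𝓝 (∫ x, f (x : E d) ∂(sphereUniform d)))

/-- The points `j / (M_R + 1) • r_k`, `1 ≤ j ≤ M_R`, `1 ≤ k ≤ M_S`, of the grid. -/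
def gridPoint {d : ℕ} (r : (S : ℕ) → Fin S → E d) (MR MS : ℕ) (i : Fin MR × Fin MS) : E d :=
  (((i.1 : ℕ) + 1 : ℝ) / ((MR : ℝ) + 1)) • r MS i.2

/-- The matrix of pairwise distances of the grid points. -/
def distMatrix {d : ℕ} (r : (S : ℕ) → Fin S → E d) (MR MS : ℕ) :
    Matrix (Fin MR × Fin MS) (Fin MR × Fin MS) ℝ :=
  Matrix.of fun i j => ‖gridPoint r MR MS i - gridPoint r MR MS j‖

/-- The centering matrix `I - J / M`, where `J` is the all-ones matrix and `M = M_R M_S`. -/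
def centeringMatrix (MR MS : ℕ) : Matrix (Fin MR × Fin MS) (Fin MR × Fin MS) ℝ :=
  1 - ((MR * MS : ℕ) : ℝ)⁻¹ • Matrix.of fun _ _ => (1 : ℝ)

/-- The doubly centered distance matrix `(I - J / M) D (I - J / M) / M` of the grid. -/
def centeredMatrix {d : ℕ} (r : (S : ℕ) → Fin S → E d) (MR MS : ℕ) :
    Matrix (Fin MR × Fin MS) (Fin MR × Fin MS) ℝ :=
  ((MR * MS : ℕ) : ℝ)⁻¹ •
    (centeringMatrix MR MS * distMatrix r MR MS * centeringMatrix MR MS)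

/-- The marginal approximate eigenvalues: in dimension `d ≥ 2` the non-zero eigenvalues of the
doubly centered distance matrix (with multiplicity); in dimension `d = 1` the numbers
`-4 / (π² j²)`, `1 ≤ j ≤ M - 1`. -/
def gridEigenvalues {d : ℕ} (r : (S : ℕ) → Fin S → E d) (MR MS : ℕ) : Multiset ℝ :=
  if d = 1 then
    (Multiset.range (MR * MS - 1)).map fun j => -4 / (Real.pi ^ 2 * ((j : ℝ) + 1) ^ 2)
  else (centeredMatrix r MR MS).charpoly.roots.filter fun x => x ≠ 0

/-- All products of a marginal eigenvalue for `p` and one for `q`, in decreasing order. -/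
def sortedProducts {p q : ℕ} (r : (S : ℕ) → Fin S → E p) (s : (S : ℕ) → Fin S → E q)
    (MR MS : ℕ) : List ℝ :=
  ((gridEigenvalues r MR MS ×ˢ gridEigenvalues s MR MS).map fun x => x.1 * x.2).sort (· ≥ ·)

/-- The weight `λ_k^(M)`, with `k` counted from `0`. -/
def gridWeight {p q : ℕ} (r : (S : ℕ) → Fin S → E p) (s : (S : ℕ) → Fin S → E q)
    (MR MS : ℕ) (k : ℕ) : ℝ :=
  (sortedProducts r s MR MS).getD k 0

/-- The quadratic form `∑_{k = 1}^{(M - 1)²} λ_k^(M) (ξ_k² - 1)`, with `M = M_R M_S`. -/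
def gridForm {p q : ℕ} (r : (S : ℕ) → Fin S → E p) (s : (S : ℕ) → Fin S → E q)
    {Ω : Type*} (ξ : ℕ → Ω → ℝ) (MR MS : ℕ) (ω : Ω) : ℝ :=
  ∑ k ∈ Finset.range ((MR * MS - 1) ^ 2), gridWeight r s MR MS k * (ξ k ω ^ 2 - 1)

/-- The quadratic form `∑_{k = 1}^∞ λ_k (ξ_k² - 1)`. -/
def limitForm (ev : ℕ → ℝ) {Ω : Type*} (ξ : ℕ → Ω → ℝ) (ω : Ω) : ℝ :=
  ∑' k, ev k * (ξ k ω ^ 2 - 1)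

/-- The quantile of level `u` of a real random variable: `inf {x | P (Z ≤ x) ≥ u}`. -/
def quantile {Ω : Type*} [MeasurableSpace Ω] (P : Measure Ω) (Z : Ω → ℝ) (u : ℝ) : ℝ :=
  sInf {x : ℝ | u ≤ P.real {ω | Z ω ≤ x}}

end

end CenterOutward

namespace CenterOutward

/-! ### Sequences with convergent power sums -/

theorem summable_pow_succ {a : ℕ → ℝ} (ha : Antitone a) (h0 : ∀ k, 0 ≤ a k) (hs : Summable a)
    (m : ℕ) : Summable fun k => a k ^ (m + 1) := by
  refine Summable.of_nonneg_of_le (fun k => pow_nonneg (h0 k) _) (fun k => ?_)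
    (hs.mul_left (a 0 ^ m))
  rw [pow_succ]
  exact mul_le_mul_of_nonneg_right (pow_le_pow_left₀ (h0 k) (ha (Nat.zero_le k)) m) (h0 k)

theorem tsum_pow_succ_le {a : ℕ → ℝ} (ha : Antitone a) (h0 : ∀ k, 0 ≤ a k) (hs : Summable a)
    (m : ℕ) : ∑' k, a k ^ (m + 1) ≤ a 0 ^ m * ∑' k, a k := by
  rw [← tsum_mul_left]
  refine (summable_pow_succ ha h0 hs m).tsum_le_tsum (fun k => ?_) (hs.mul_left _)
  rw [pow_succ]
  exact mul_le_mul_of_nonneg_right (pow_le_pow_left₀ (h0 k) (ha (Nat.zero_le k)) m) (h0 k)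

theorem head_pow_le_tsum {a : ℕ → ℝ} (ha : Antitone a) (h0 : ∀ k, 0 ≤ a k) (hs : Summable a)
    (m : ℕ) : a 0 ^ (m + 1) ≤ ∑' k, a k ^ (m + 1) :=
  (summable_pow_succ ha h0 hs m).le_tsum 0 fun k _ => pow_nonneg (h0 k) _

theorem exists_mul_pow_lt_pow {b c S : ℝ} (hb : 0 ≤ b) (hbc : b < c) :
    ∃ m : ℕ, b ^ m * S < c ^ (m + 1) := by
  have hc : 0 < c := hb.trans_lt hbc
  have h1 : Tendsto (fun m : ℕ => (b / c) ^ m * S) atTop (𝓝 (0 * S)) :=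
    (tendsto_pow_atTop_nhds_zero_of_lt_one (div_nonneg hb hc.le) ((div_lt_one hc).2 hbc)).mul_const S
  rw [zero_mul] at h1
  obtain ⟨m, hm⟩ := (h1.eventually (gt_mem_nhds hc)).exists
  refine ⟨m, ?_⟩
  rw [div_pow, div_mul_eq_mul_div, div_lt_iff₀ (pow_pos hc m)] at hm
  rwa [pow_succ, mul_comm (c ^ m)]

variable {ι : Type*} {l : Filter ι}

theorem tendsto_head_of_tendsto_powerSum {w : ι → ℕ → ℝ} {a : ℕ → ℝ}
    (hw : ∀ n, Antitone (w n)) (hw0 : ∀ n k, 0 ≤ w n k) (hws : ∀ n, Summable (w n))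
    (ha : Antitone a) (ha0 : ∀ k, 0 ≤ a k) (has : Summable a)
    (h : ∀ m : ℕ, Tendsto (fun n => ∑' k, w n k ^ (m + 1)) l (𝓝 (∑' k, a k ^ (m + 1)))) :
    Tendsto (fun n => w n 0) l (𝓝 (a 0)) := by
  have h1 : Tendsto (fun n => ∑' k, w n k) l (𝓝 (∑' k, a k)) := by simpa using h 0
  rw [tendsto_order]
  constructor
  · intro c hc
    rcases lt_or_ge c 0 with hc0 | hc0
    · exact Eventually.of_forall fun n => hc0.trans_le (hw0 n 0)
    obtain ⟨m, hm⟩ := exists_mul_pow_lt_pow (S := ∑' k, a k + 1) hc0 hc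
    have h2 := h1.eventually (gt_mem_nhds (lt_add_one (∑' k, a k)))
    have h3 := (h m).eventually (lt_mem_nhds (hm.trans_le (head_pow_le_tsum ha ha0 has m)))
    filter_upwards [h2, h3] with n hn2 hn3
    by_contra hle
    rw [not_lt] at hle
    refine absurd (hn3.trans_le (tsum_pow_succ_le (hw n) (hw0 n) (hws n) m)) (not_lt.2 ?_)
    exact mul_le_mul (pow_le_pow_left₀ (hw0 n 0) hle m) hn2.le (tsum_nonneg (hw0 n))
      (pow_nonneg hc0 m)
  · intro c hc
    obtain ⟨m, hm⟩ := exists_mul_pow_lt_pow (S := ∑' k, a k) (ha0 0) hc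
    have h3 := (h m).eventually (gt_mem_nhds ((tsum_pow_succ_le ha ha0 has m).trans_lt hm))
    filter_upwards [h3] with n hn
    exact lt_of_pow_lt_pow_left₀ (m + 1) ((ha0 0).trans hc.le)
      ((head_pow_le_tsum (hw n) (hw0 n) (hws n) m).trans_lt hn)

theorem tendsto_of_tendsto_powerSum (k : ℕ) : ∀ {w : ι → ℕ → ℝ} {a : ℕ → ℝ}
    (_ : ∀ n, Antitone (w n)) (_ : ∀ n k, 0 ≤ w n k) (_ : ∀ n, Summable (w n))
    (_ : Antitone a) (_ : ∀ k, 0 ≤ a k) (_ : Summable a)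
    (_ : ∀ m : ℕ, Tendsto (fun n => ∑' k, w n k ^ (m + 1)) l (𝓝 (∑' k, a k ^ (m + 1)))),
    Tendsto (fun n => w n k) l (𝓝 (a k)) := by
  induction k with
  | zero => exact tendsto_head_of_tendsto_powerSum
  | succ k ih =>
    intro w a hw hw0 hws ha ha0 has h
    have hh := tendsto_head_of_tendsto_powerSum hw hw0 hws ha ha0 has h
    refine ih (w := fun n k => w n (k + 1)) (a := fun k => a (k + 1))
      (fun n i j hij => hw n (Nat.succ_le_succ hij)) (fun n k => hw0 n _)
      (fun n => (summable_nat_add_iff 1).2 (hws n)) (fun i j hij => ha (Nat.succ_le_succ hij))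
      (fun k => ha0 _) ((summable_nat_add_iff 1).2 has) fun m => ?_
    have e1 : ∀ n, ∑' k, w n (k + 1) ^ (m + 1) = ∑' k, w n k ^ (m + 1) - w n 0 ^ (m + 1) :=
      fun n => by rw [(summable_pow_succ (hw n) (hw0 n) (hws n) m).tsum_eq_zero_add]; ring
    have e2 : ∑' k, a (k + 1) ^ (m + 1) = ∑' k, a k ^ (m + 1) - a 0 ^ (m + 1) := by
      rw [(summable_pow_succ ha ha0 has m).tsum_eq_zero_add]; ring
    simp only [e1, e2]
    exact (h m).sub (hh.pow (m + 1))

/-- Decreasing summable nonnegative sequences whose power sums converge, converge in `ℓ¹`. -/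
theorem tendsto_tsum_abs_sub_of_tendsto_powerSum {w : ι → ℕ → ℝ} {a : ℕ → ℝ}
    (hw : ∀ n, Antitone (w n)) (hw0 : ∀ n k, 0 ≤ w n k) (hws : ∀ n, Summable (w n))
    (ha : Antitone a) (ha0 : ∀ k, 0 ≤ a k) (has : Summable a)
    (h : ∀ m : ℕ, Tendsto (fun n => ∑' k, w n k ^ (m + 1)) l (𝓝 (∑' k, a k ^ (m + 1)))) :
    Tendsto (fun n => ∑' k, |w n k - a k|) l (𝓝 0) := by
  have h1 : Tendsto (fun n => ∑' k, w n k) l (𝓝 (∑' k, a k)) := by simpa using h 0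
  have hpos : ∀ n k, max (a k - w n k) 0 ≤ a k := fun n k =>
    max_le (by linarith [hw0 n k]) (ha0 k)
  have hps : ∀ n, Summable fun k => max (a k - w n k) 0 := fun n =>
    Summable.of_nonneg_of_le (fun k => le_max_right _ _) (hpos n) has
  have h2 : Tendsto (fun n => ∑' k, max (a k - w n k) 0) l (𝓝 (∑' _ : ℕ, (0 : ℝ))) := by
    refine tendsto_tsum_of_dominated_convergence (bound := a) has (fun k => ?_)
      (Eventually.of_forall fun n k => ?_)
    · have := (tendsto_const_nhds (x := a k)).sub
        (tendsto_of_tendsto_powerSum k hw hw0 hws ha ha0 has h)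
      simpa using this.max (tendsto_const_nhds (x := (0 : ℝ)))
    · rw [Real.norm_of_nonneg (le_max_right _ _)]
      exact hpos n k
  have e : ∀ n, ∑' k, |w n k - a k|
      = ∑' k, w n k - ∑' k, a k + 2 * ∑' k, max (a k - w n k) 0 := by
    intro n
    rw [← tsum_mul_left, ← (hws n).tsum_sub has, ← ((hws n).sub has).tsum_add ((hps n).mul_left 2)]
    refine tsum_congr fun k => ?_
    rcases le_total (a k) (w n k) with hk | hk
    · rw [abs_of_nonneg (sub_nonneg.2 hk), max_eq_right (sub_nonpos.2 hk)]; ring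
    · rw [abs_of_nonpos (sub_nonpos.2 hk), max_eq_left (sub_nonneg.2 hk)]; ring
  simp only [e]
  have := (h1.sub_const (∑' k, a k)).add (h2.const_mul 2)
  simpa using this

/-- A summable positive sequence can be rearranged in decreasing order. -/
theorem exists_equiv_antitone {a : ℕ → ℝ} (ha : ∀ k, 0 < a k) (hs : Summable a) :
    ∃ σ : ℕ ≃ ℕ, Antitone (a ∘ σ) := by
  let prec : ℕ → ℕ → Prop := fun i j => a j < a i ∨ (a i = a j ∧ i < j)
  have hfin : ∀ k, {j | prec j k}.Finite := by
    intro k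
    have h1 : {j | a k ≤ a j}.Finite := by
      have := hs.tendsto_cofinite_zero.eventually (gt_mem_nhds (ha k))
      simpa [Filter.eventually_cofinite] using this
    refine h1.subset fun j hj => ?_
    rcases hj with hj | hj
    · exact hj.le
    · exact hj.1.ge
  have hirr : ∀ i, ¬ prec i i := fun i hi => by
    rcases hi with hi | hi
    · exact lt_irrefl _ hi
    · exact lt_irrefl _ hi.2
  have htrans : ∀ {i j k}, prec i j → prec j k → prec i k := by
    intro i j k hij hjk
    rcases hij with hij | ⟨hij, hij'⟩ <;> rcases hjk with hjk | ⟨hjk, hjk'⟩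
    · exact Or.inl (hjk.trans hij)
    · exact Or.inl (hjk ▸ hij)
    · exact Or.inl (hij ▸ hjk)
    · exact Or.inr ⟨hij.trans hjk, hij'.trans hjk'⟩
  have htri : ∀ i j, i ≠ j → prec i j ∨ prec j i := by
    intro i j hij
    rcases lt_trichotomy (a i) (a j) with h | h | h
    · exact Or.inr (Or.inl h)
    · rcases lt_or_gt_of_ne hij with h' | h'
      · exact Or.inl (Or.inr ⟨h, h'⟩)
      · exact Or.inr (Or.inr ⟨h.symm, h'⟩)
    · exact Or.inl (Or.inl h)
  let rk : ℕ → ℕ := fun k => {j | prec j k}.ncard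
  have hmono : ∀ {i j}, prec i j → rk i < rk j := fun {i j} hij =>
    Set.ncard_lt_ncard ⟨fun x hx => htrans hx hij, fun hsub => hirr i (hsub hij)⟩ (hfin j)
  have hinj : Function.Injective rk := by
    intro i j hij
    by_contra hne
    rcases htri i j hne with h | h
    · exact (hmono h).ne hij
    · exact (hmono h).ne' hij
  have hlow : ∀ n k, rk k = n → ∀ m ≤ n, ∃ j, rk j = m := by
    intro n
    induction n with
    | zero => intro k hk m hm; exact ⟨k, by omega⟩
    | succ n ih =>
      intro k hk m hm
      rcases hm.eq_or_lt with rfl | hm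
      · exact ⟨k, hk⟩
      have hne : {j | prec j k}.Nonempty := by
        rw [← Set.ncard_pos (hfin k)]
        change 0 < rk k
        omega
      obtain ⟨j, hj, hjmax⟩ := Set.exists_max_image {j | prec j k} rk (hfin k) hne
      refine ih j ?_ m (by omega)
      have h1 : {i | prec i k} = insert j {i | prec i j} := by
        ext i
        refine ⟨fun hi => ?_, fun hi => ?_⟩
        · by_cases hij : i = j
          · exact Or.inl hij
          · rcases htri i j hij with h | h
            · exact Or.inr h
            · exact absurd (hmono h) (not_lt.2 (hjmax i hi))
        · rcases hi with rfl | hi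
          · exact hj
          · exact htrans hi hj
      have h2 : rk k = rk j + 1 := by
        change {i | prec i k}.ncard = _
        rw [h1, Set.ncard_insert_of_notMem (s := {i | prec i j}) (hirr j) (hfin j)]
      omega
  have hsurj : Function.Surjective rk := by
    intro n
    obtain ⟨m, ⟨k, rfl⟩, hm⟩ := (Set.infinite_range_of_injective hinj).exists_gt n
    exact hlow _ k rfl n hm.le
  let e := Equiv.ofBijective rk ⟨hinj, hsurj⟩
  refine ⟨e.symm, fun m n hmn => ?_⟩
  rcases hmn.eq_or_lt with rfl | hmn
  · exact le_rfl
  by_contra hlt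
  rw [not_le] at hlt
  have h1 := hmono (i := e.symm n) (j := e.symm m) (Or.inl hlt)
  have h2 : ∀ n, rk (e.symm n) = n := e.apply_symm_apply
  rw [h2, h2] at h1
  omega

/-! ### Compact self-adjoint operators -/

section Hilbert

universe u

variable {H : Type u} [NormedAddCommGroup H] [InnerProductSpace ℝ H]
  {H' : Type*} [NormedAddCommGroup H'] [InnerProductSpace ℝ H'] [CompleteSpace H']

/-- Hilbert–Schmidt operators are compact. -/
theorem isCompactOperator_of_summable_sq_norm {ι : Type*} (c : HilbertBasis ι ℝ H)
    (A : H →L[ℝ] H') (hs : Summable fun i => ‖A (c i)‖ ^ 2) : IsCompactOperator A := by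
  classical
  let G : Finset ι → H →L[ℝ] H' := fun s => ∑ i ∈ s, (innerSL ℝ (c i)).smulRight (A (c i))
  have hG : ∀ s x, G s x = ∑ i ∈ s, inner ℝ (c i) x • A (c i) := fun s x => by
    simp [G]
  have hlim : Tendsto G atTop (𝓝 A) := by
    rw [Metric.tendsto_atTop]
    intro ε hε
    obtain ⟨s, hs⟩ := summable_iff_vanishing_norm.1 hs ((ε / 2) ^ 2) (by positivity)
    refine ⟨s, fun t hst => ?_⟩
    rw [dist_comm, dist_eq_norm]
    refine lt_of_le_of_lt (ContinuousLinearMap.opNorm_le_bound _ (half_pos hε).le fun x => ?_)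
      (half_lt_self hε)
    have h1 : Tendsto (fun r : Finset ι => (∑ i ∈ r, inner ℝ (c i) x • A (c i)) - G t x) atTop
        (𝓝 ((A - G t) x)) := by
      have h2 : HasSum (fun i => inner ℝ (c i) x • A (c i)) (A x) := by
        have := (c.hasSum_repr x).mapL A
        simpa [HilbertBasis.repr_apply_apply] using this
      exact h2.sub_const _
    refine le_of_tendsto h1.norm ?_
    filter_upwards [eventually_ge_atTop t] with r hr
    have hr' : t ⊆ r := hr
    have hdis : Disjoint (r \ t) s := (Finset.sdiff_disjoint).mono_right hst
    have h3 := (le_abs_self _).trans (hs _ hdis).le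
    rw [hG, ← Finset.sum_sdiff hr', add_sub_cancel_right]
    calc ‖∑ i ∈ r \ t, inner ℝ (c i) x • A (c i)‖
        ≤ ∑ i ∈ r \ t, |inner ℝ (c i) x| * ‖A (c i)‖ := by
          refine (norm_sum_le _ _).trans (Finset.sum_le_sum fun i _ => ?_)
          rw [norm_smul, Real.norm_eq_abs]
      _ ≤ √((∑ i ∈ r \ t, |inner ℝ (c i) x| ^ 2) * ∑ i ∈ r \ t, ‖A (c i)‖ ^ 2) :=
          Real.le_sqrt_of_sq_le (Finset.sum_mul_sq_le_sq_mul_sq _ _ _)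
      _ ≤ √(‖x‖ ^ 2 * (ε / 2) ^ 2) := by
          refine Real.sqrt_le_sqrt (mul_le_mul ?_ h3 (by positivity) (by positivity))
          have := c.orthonormal.sum_inner_products_le x (s := r \ t)
          simpa using this
      _ = ε / 2 * ‖x‖ := by
          rw [← mul_pow, Real.sqrt_sq (by positivity), mul_comm]
  refine isCompactOperator_of_tendsto hlim (Eventually.of_forall fun s => ?_)
  refine Submodule.sum_mem (compactOperator (RingHom.id ℝ) H H') fun i _ => ?_
  change IsCompactOperator _
  have : (⇑((innerSL ℝ (c i)).smulRight (A (c i))) : H → H')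
      = (ContinuousLinearMap.toSpanSingleton ℝ (A (c i))) ∘ innerSL ℝ (c i) := by
    ext x; simp
  rw [this]
  exact (isCompactOperator_of_locallyCompactSpace_rng
    (ContinuousLinearMap.toSpanSingleton ℝ (A (c i)))
      |>.comp_clm (innerSL ℝ (c i)))

theorem exists_hilbertBasis_eigenvectors [CompleteSpace H] (T : H →L[ℝ] H) (hT : IsCompactOperator T)
    (hsymm : T.IsSymmetric) :
    ∃ (ι : Type u) (b : HilbertBasis ι ℝ H) (t : ι → ℝ), ∀ i, T (b i) = t i • b i := by
  let V : ℝ → Submodule ℝ H := fun c => Module.End.eigenspace (T : Module.End ℝ H) c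
  have hV : OrthogonalFamily ℝ (fun c => V c) fun c => (V c).subtypeₗᵢ :=
    LinearMap.IsSymmetric.orthogonalFamily_eigenspaces hsymm
  have hcl : ∀ c, CompleteSpace (V c) := fun c => by
    have h1 : IsClosed {x : H | T x = c • x} := isClosed_eq T.continuous (continuous_const_smul c)
    have h2 : ((V c : Submodule ℝ H) : Set H) = {x : H | T x = c • x} := by
      ext x; simp [V]
    exact IsClosed.completeSpace_coe (hs := h2 ▸ h1)
  choose w bw hbw using fun c => exists_hilbertBasis ℝ (V c)
  let v : (Σ c, w c) → H := fun a => (bw a.1 a.2 : H)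
  have hv : Orthonormal ℝ v :=
    hV.orthonormal_sigma_orthonormal (v_family := fun c => ⇑(bw c)) fun c => (bw c).orthonormal
  have hbot : (Submodule.span ℝ (Set.range v))ᗮ = ⊥ := by
    rw [eq_bot_iff, ← T.orthogonalComplement_iSup_eigenspaces_eq_bot hT hsymm]
    rw [← Submodule.orthogonal_closure (Submodule.span ℝ (Set.range v))]
    refine Submodule.orthogonal_le (iSup_le fun c => fun x hx => ?_)
    have h1 := (bw c).hasSum_repr ⟨x, hx⟩
    have h2 := h1.mapL (V c).subtypeL
    refine mem_closure_of_tendsto h2 (Eventually.of_forall fun s => ?_)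
    refine Submodule.sum_mem _ fun i _ => ?_
    simp only [map_smul]
    exact Submodule.smul_mem _ _ (Submodule.subset_span ⟨⟨c, i⟩, rfl⟩)
  refine ⟨Σ c, w c, HilbertBasis.mkOfOrthogonalEqBot hv hbot, fun a => a.1, fun a => ?_⟩
  rw [HilbertBasis.coe_mkOfOrthogonalEqBot]
  exact Module.End.mem_eigenspace_iff.1 (bw a.1 a.2).2

variable {ι : Type u} (b : HilbertBasis ι ℝ H) {T : H →L[ℝ] H} {t : ι → ℝ}

theorem inner_pow_apply_of_eigenvectors (hT : ∀ x y, inner ℝ (T x) y = inner ℝ x (T y))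
    (hb : ∀ i, T (b i) = t i • b i) (m : ℕ) (i : ι) (x : H) :
    inner ℝ (b i) ((T ^ m) x) = t i ^ m * inner ℝ (b i) x := by
  induction m with
  | zero => simp
  | succ m ih =>
    rw [pow_succ', mul_apply_eq_comp, ← hT, hb, inner_smul_left, ih, pow_succ']
    simp [mul_assoc]

theorem hasSum_pow_mul_inner_sq (hT : ∀ x y, inner ℝ (T x) y = inner ℝ x (T y))
    (hb : ∀ i, T (b i) = t i • b i) (m : ℕ) (x : H) :
    HasSum (fun i => t i ^ m * inner ℝ x (b i) ^ 2) (inner ℝ x ((T ^ m) x)) := by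
  have h := b.hasSum_inner_mul_inner x ((T ^ m) x)
  refine h.congr_fun fun i => ?_
  rw [inner_pow_apply_of_eigenvectors b hT hb, real_inner_comm x (b i)]
  ring

theorem rank_eigenspace_eq (hT : ∀ x y, inner ℝ (T x) y = inner ℝ x (T y))
    (hb : ∀ i, T (b i) = t i • b i) {c : ℝ} (hfin : {i | t i = c}.Finite) (V : Submodule ℝ H)
    (hV : ∀ x, x ∈ V ↔ T x = c • x) :
    Module.rank ℝ V = Cardinal.mk {i // t i = c} := by
  have hfi : Finite {i // t i = c} := hfin
  let v : {i // t i = c} → V := fun i => ⟨b i, (hV _).2 (by rw [hb, i.2])⟩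
  have hli : LinearIndependent ℝ v := by
    have h1 : LinearIndependent ℝ fun i : {i // t i = c} => b i :=
      (b.orthonormal.comp _ Subtype.val_injective).linearIndependent
    exact LinearIndependent.of_comp V.subtype h1
  have hsp : ⊤ ≤ Submodule.span ℝ (Set.range v) := by
    rintro ⟨x, hx⟩ -
    have := Fintype.ofFinite {i // t i = c}
    have hx' := (hV x).1 hx
    have hz : ∀ i, t i ≠ c → inner ℝ (b i) x = 0 := fun i hi => by
      have h1 := hT (b i) x
      rw [hb, hx', inner_smul_left, inner_smul_right] at h1
      simp only [conj_trivial] at h1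
      have h2 : (t i - c) * inner ℝ (b i) x = 0 := by linarith
      exact (mul_eq_zero.1 h2).resolve_left (sub_ne_zero.2 hi)
    have h3 : HasSum (fun i => inner ℝ (b i) x • b i) x := by
      simpa [HilbertBasis.repr_apply_apply] using b.hasSum_repr x
    have h4 : HasSum (fun i : {i // t i = c} => inner ℝ (b i) x • b i) x := by
      refine (hasSum_subtype_iff_of_support_subset (s := {i | t i = c}) fun i hi => ?_).2 h3
      by_contra hne
      exact hi (by simp [hz i hne])
    have h5 : x = ∑ i : {i // t i = c}, inner ℝ (b i) x • b (i : ι) :=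
      h4.unique (hasSum_fintype _)
    have h6 : (⟨x, hx⟩ : V) = ∑ i, inner ℝ (b (i : {i // t i = c})) x • v i := by
      ext1
      simp only [Submodule.coe_sum, Submodule.coe_smul, v]
      exact h5
    rw [h6]
    exact Submodule.sum_mem _ fun i _ => Submodule.smul_mem _ _ (Submodule.subset_span ⟨i, rfl⟩)
  rw [← (Module.Basis.mk hli hsp).mk_eq_rank'']

theorem countable_of_hilbertBasis [SecondCountableTopology H] (b : HilbertBasis ι ℝ H) :
    Countable ι := by
  have h1 : (Set.univ : Set ι).Countable := by
    refine Set.PairwiseDisjoint.countable_of_isOpen (s := fun i => Metric.ball (b i) (1 / 2))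
      (fun i _ j _ hij => ?_) (fun i _ => Metric.isOpen_ball)
      (fun i _ => ⟨b i, Metric.mem_ball_self (by norm_num)⟩)
    refine Metric.ball_disjoint_ball ?_
    have h2 : ‖b i - b j‖ ^ 2 = 2 := by
      rw [norm_sub_sq_real, b.orthonormal.2 hij, b.orthonormal.1, b.orthonormal.1]
      norm_num
    rw [dist_eq_norm]
    nlinarith [norm_nonneg (b i - b j)]
  exact Set.countable_univ_iff.1 h1

end Hilbert

/-! ### Bounded kernels and their integral operators -/

section Kernel

variable {X Y Z W : Type} [MeasurableSpace X] [MeasurableSpace Y] [MeasurableSpace Z]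
  [MeasurableSpace W] {μ : Measure X} {ν : Measure Y} {ρ : Measure Z}

/-- Jointly measurable bounded kernels. -/
def BddKernel (F : X → Y → ℝ) : Prop :=
  Measurable (Function.uncurry F) ∧ ∃ C, ∀ x y, |F x y| ≤ C

/-- The composition of two kernels. -/
noncomputable def kcomp (ν : Measure Y) (F : X → Y → ℝ) (G : Y → Z → ℝ) (x : X) (z : Z) : ℝ :=
  ∫ y, F x y * G y z ∂ν

/-- The iterates `K, K ∘ K, K ∘ K ∘ K, …` of a kernel. -/
noncomputable def iterKernel (μ : Measure X) (K : X → X → ℝ) : ℕ → X → X → ℝ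
  | 0 => K
  | m + 1 => kcomp μ K (iterKernel μ K m)

/-- The trace of the `(m + 1)`-st power of a kernel. -/
noncomputable def kernelTrace (μ : Measure X) (K : X → X → ℝ) (m : ℕ) : ℝ :=
  ∫ x, iterKernel μ K m x x ∂μ

namespace BddKernel

variable {F : X → Y → ℝ} {G : Y → Z → ℝ} {L : Z → W → ℝ}

theorem swap (hF : BddKernel F) : BddKernel fun y x => F x y :=
  ⟨hF.1.comp measurable_swap, hF.2.imp fun _ h y x => h x y⟩

theorem measurable_left (hF : BddKernel F) (y : Y) : Measurable fun x => F x y :=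
  hF.1.comp (measurable_id.prodMk measurable_const)

theorem measurable_right (hF : BddKernel F) (x : X) : Measurable (F x) :=
  hF.1.comp (measurable_const.prodMk measurable_id)

theorem memLp_left [IsFiniteMeasure μ] (hF : BddKernel F) (y : Y) :
    MemLp (fun x => F x y) 2 μ := by
  obtain ⟨C, hC⟩ := hF.2
  exact MemLp.of_bound (hF.measurable_left y).aestronglyMeasurable C
    (Eventually.of_forall fun x => hC x y)

theorem memLp_right [IsFiniteMeasure ν] (hF : BddKernel F) (x : X) : MemLp (F x) 2 ν :=
  hF.swap.memLp_left x

theorem integrable_mul [IsFiniteMeasure ν] (hF : BddKernel F) (hG : BddKernel G) (x : X) (z : Z) :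
    Integrable (fun y => F x y * G y z) ν :=
  (hF.memLp_right x).integrable_mul (hG.memLp_left (μ := ν) z)

theorem kcomp [IsFiniteMeasure ν] (hF : BddKernel F) (hG : BddKernel G) :
    BddKernel (kcomp ν F G) := by
  constructor
  · have h1 : Measurable fun p : (X × Z) × Y => F p.1.1 p.2 * G p.2 p.1.2 :=
      (hF.1.comp (measurable_fst.fst.prodMk measurable_snd)).mul
        (hG.1.comp (measurable_snd.prodMk measurable_fst.snd))
    exact (h1.stronglyMeasurable.integral_prod_right' (ν := ν)).measurable
  · obtain ⟨C, hC⟩ := hF.2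
    obtain ⟨D, hD⟩ := hG.2
    refine ⟨|C| * |D| * ν.real Set.univ, fun x z => ?_⟩
    rw [← Real.norm_eq_abs]
    refine norm_integral_le_of_norm_le_const (Eventually.of_forall fun y => ?_)
    rw [norm_mul]
    exact mul_le_mul ((hC x y).trans (le_abs_self _)) ((hD y z).trans (le_abs_self _))
      (norm_nonneg _) (abs_nonneg _)

theorem mul {X' Y' : Type} [MeasurableSpace X'] [MeasurableSpace Y'] {F' : X' → Y' → ℝ}
    (hF : BddKernel F) (hF' : BddKernel F') :
    BddKernel fun (x : X × X') (y : Y × Y') => F x.1 y.1 * F' x.2 y.2 := by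
  constructor
  · exact (hF.1.comp (measurable_fst.fst.prodMk measurable_snd.fst)).mul
      (hF'.1.comp (measurable_fst.snd.prodMk measurable_snd.snd))
  · obtain ⟨C, hC⟩ := hF.2
    obtain ⟨D, hD⟩ := hF'.2
    refine ⟨|C| * |D|, fun x y => ?_⟩
    rw [abs_mul]
    exact mul_le_mul ((hC _ _).trans (le_abs_self _)) ((hD _ _).trans (le_abs_self _))
      (abs_nonneg _) (abs_nonneg _)

end BddKernel

theorem kcomp_assoc [IsFiniteMeasure ν] [IsFiniteMeasure ρ] {F : X → Y → ℝ} {G : Y → Z → ℝ}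
    {L : Z → W → ℝ} (hF : BddKernel F) (hG : BddKernel G) (hL : BddKernel L) :
    kcomp ν F (kcomp ρ G L) = kcomp ρ (kcomp ν F G) L := by
  ext x w
  have h1 : Integrable (Function.uncurry fun y z => F x y * (G y z * L z w)) (ν.prod ρ) := by
    obtain ⟨C, hC⟩ := hF.2
    obtain ⟨D, hD⟩ := hG.2
    obtain ⟨E, hE⟩ := hL.2
    refine Integrable.of_bound (C := |C| * (|D| * |E|)) ?_ (Eventually.of_forall fun p => ?_)
    · exact (((hF.measurable_right x).comp measurable_fst).mul
        (hG.1.mul ((hL.measurable_left w).comp measurable_snd))).aestronglyMeasurable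
    · simp only [Function.uncurry, norm_mul]
      exact mul_le_mul ((hC _ _).trans (le_abs_self _)) (mul_le_mul ((hD _ _).trans (le_abs_self _))
        ((hE _ _).trans (le_abs_self _)) (norm_nonneg _) (abs_nonneg _))
        (by positivity) (abs_nonneg _)
  calc ∫ y, F x y * ∫ z, G y z * L z w ∂ρ ∂ν
      = ∫ y, ∫ z, F x y * (G y z * L z w) ∂ρ ∂ν := by simp only [integral_const_mul]
    _ = ∫ z, ∫ y, F x y * (G y z * L z w) ∂ν ∂ρ := integral_integral_swap h1
    _ = ∫ z, (∫ y, F x y * G y z ∂ν) * L z w ∂ρ := by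
        simp only [← mul_assoc, integral_mul_const]

theorem iterKernel_prod {X' : Type} [MeasurableSpace X'] {μ' : Measure X'} [SFinite μ] [SFinite μ']
    (K : X → X → ℝ) (K' : X' → X' → ℝ) (m : ℕ) (x y : X × X') :
    iterKernel (μ.prod μ') (fun x y => K x.1 y.1 * K' x.2 y.2) m x y
      = iterKernel μ K m x.1 y.1 * iterKernel μ' K' m x.2 y.2 := by
  induction m generalizing x y with
  | zero => rfl
  | succ m ih =>
    change ∫ z, K x.1 z.1 * K' x.2 z.2 * iterKernel (μ.prod μ') _ m z y ∂(μ.prod μ') = _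
    simp only [ih]
    rw [show iterKernel μ K (m + 1) x.1 y.1 = ∫ z, K x.1 z * iterKernel μ K m z y.1 ∂μ from rfl,
      show iterKernel μ' K' (m + 1) x.2 y.2 = ∫ z, K' x.2 z * iterKernel μ' K' m z y.2 ∂μ' from rfl,
      ← integral_prod_mul]
    refine integral_congr_ae (Eventually.of_forall fun z => ?_)
    dsimp only
    ring

theorem kernelTrace_prod {X' : Type} [MeasurableSpace X'] {μ' : Measure X'} [SFinite μ] [SFinite μ']
    (K : X → X → ℝ) (K' : X' → X' → ℝ) (m : ℕ) :
    kernelTrace (μ.prod μ') (fun x y => K x.1 y.1 * K' x.2 y.2) m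
      = kernelTrace μ K m * kernelTrace μ' K' m := by
  simp only [kernelTrace, iterKernel_prod]
  exact integral_prod_mul (fun x => iterKernel μ K m x x) fun x => iterKernel μ' K' m x x

theorem iterKernel_congr {K K' : X → X → ℝ} {S : Set X} (hS : ∀ᵐ x ∂μ, x ∈ S)
    (h : ∀ x ∈ S, ∀ y ∈ S, K x y = K' x y) (m : ℕ) :
    ∀ x ∈ S, ∀ y ∈ S, iterKernel μ K m x y = iterKernel μ K' m x y := by
  induction m with
  | zero => exact h
  | succ m ih =>
    intro x hx y hy
    refine integral_congr_ae ?_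
    filter_upwards [hS] with z hz
    rw [h x hx z hz, ih z hz y hy]

theorem kernelTrace_congr {K K' : X → X → ℝ} {S : Set X} (hS : ∀ᵐ x ∂μ, x ∈ S)
    (h : ∀ x ∈ S, ∀ y ∈ S, K x y = K' x y) (m : ℕ) :
    kernelTrace μ K m = kernelTrace μ K' m := by
  refine integral_congr_ae ?_
  filter_upwards [hS] with x hx
  exact iterKernel_congr hS h m x hx x hx

/-! The integral operator of a bounded kernel. -/

variable [IsFiniteMeasure μ] [IsFiniteMeasure ν] {F : X → Y → ℝ}

theorem integral_mul_eq_inner (hF : BddKernel F) (g : Lp ℝ 2 ν) (x : X) :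
    ∫ y, F x y * g y ∂ν = inner ℝ ((hF.memLp_right x).toLp (F x)) g := by
  rw [L2.inner_def]
  refine integral_congr_ae ?_
  filter_upwards [(hF.memLp_right (ν := ν) x).coeFn_toLp] with y hy
  rw [hy]
  simp [mul_comm]

theorem integrable_kernel_mul (hF : BddKernel F) (g : Lp ℝ 2 ν) (x : X) :
    Integrable (fun y => F x y * g y) ν :=
  (hF.memLp_right x).integrable_mul (Lp.memLp g)

theorem exists_norm_toLp_le (hF : BddKernel F) (ν : Measure Y) [IsFiniteMeasure ν] :
    ∃ C, 0 ≤ C ∧ ∀ x : X, ‖(hF.memLp_right (ν := ν) x).toLp (F x)‖ ≤ C := by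
  obtain ⟨C, hC⟩ := hF.2
  refine ⟨(measureUnivNNReal ν : ℝ) ^ ((2 : ENNReal).toReal⁻¹) * |C|, by positivity, fun x => ?_⟩
  refine Lp.norm_le_of_ae_bound (abs_nonneg _) ?_
  filter_upwards [(hF.memLp_right (ν := ν) x).coeFn_toLp] with y hy
  rw [hy]
  exact (hC x y).trans (le_abs_self _)

theorem exists_integral_mul_le (hF : BddKernel F) (ν : Measure Y) [IsFiniteMeasure ν] :
    ∃ C, 0 ≤ C ∧ ∀ (g : Lp ℝ 2 ν) (x : X), ‖∫ y, F x y * g y ∂ν‖ ≤ C * ‖g‖ := by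
  obtain ⟨C, hC0, hC⟩ := exists_norm_toLp_le hF ν
  refine ⟨C, hC0, fun g x => ?_⟩
  rw [integral_mul_eq_inner hF]
  exact (norm_inner_le_norm _ _).trans (mul_le_mul_of_nonneg_right (hC x) (norm_nonneg _))

theorem memLp_integral_mul (hF : BddKernel F) (g : Lp ℝ 2 ν) :
    MemLp (fun x => ∫ y, F x y * g y ∂ν) 2 μ := by
  obtain ⟨C, -, hC⟩ := exists_integral_mul_le hF ν
  have h1 : StronglyMeasurable fun p : X × Y => F p.1 p.2 * g p.2 :=
    hF.1.stronglyMeasurable.mul ((Lp.stronglyMeasurable g).comp_measurable measurable_snd)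
  exact MemLp.of_bound h1.integral_prod_right'.aestronglyMeasurable (C * ‖g‖)
    (Eventually.of_forall fun x => hC g x)

/-- The integral operator `g ↦ ∫ F(·, y) g(y) dν(y)` from `L²(ν)` to `L²(μ)`. -/
noncomputable def intOp (μ : Measure X) (ν : Measure Y) [IsFiniteMeasure μ] [IsFiniteMeasure ν]
    (hF : BddKernel F) : Lp ℝ 2 ν →L[ℝ] Lp ℝ 2 μ :=
  LinearMap.mkContinuousOfExistsBound
    { toFun := fun g => (memLp_integral_mul (μ := μ) hF g).toLp _
      map_add' := fun g h => by
        rw [← MemLp.toLp_add]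
        congr 1
        ext x
        rw [integral_mul_eq_inner hF, inner_add_right, ← integral_mul_eq_inner hF,
          ← integral_mul_eq_inner hF]
        rfl
      map_smul' := fun c g => by
        rw [RingHom.id_apply, ← MemLp.toLp_const_smul]
        congr 1
        ext x
        rw [integral_mul_eq_inner hF, inner_smul_right, ← integral_mul_eq_inner hF]
        rfl } (by
    obtain ⟨C, hC0, hC⟩ := exists_integral_mul_le hF ν
    refine ⟨(measureUnivNNReal μ : ℝ) ^ ((2 : ENNReal).toReal⁻¹) * C, fun g => ?_⟩
    rw [mul_assoc]
    refine Lp.norm_le_of_ae_bound (by positivity) ?_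
    filter_upwards [(memLp_integral_mul (μ := μ) hF g).coeFn_toLp] with x hx
    exact hx ▸ hC g x)

theorem intOp_apply_ae (hF : BddKernel F) (g : Lp ℝ 2 ν) :
    intOp μ ν hF g =ᵐ[μ] fun x => ∫ y, F x y * g y ∂ν :=
  (memLp_integral_mul hF g).coeFn_toLp

theorem inner_intOp (hF : BddKernel F) (f : Lp ℝ 2 μ) (g : Lp ℝ 2 ν) :
    inner ℝ f (intOp μ ν hF g) = ∫ x, f x * ∫ y, F x y * g y ∂ν ∂μ := by
  rw [L2.inner_def]
  refine integral_congr_ae ?_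
  filter_upwards [intOp_apply_ae (μ := μ) hF g] with x hx
  rw [hx]
  simp [mul_comm]

theorem integrable_mul_kernel_mul (hF : BddKernel F) (f : Lp ℝ 2 μ) (g : Lp ℝ 2 ν) :
    Integrable (Function.uncurry fun x y => f x * (F x y * g y)) (μ.prod ν) := by
  obtain ⟨C, hC⟩ := hF.2
  have hf : Integrable f μ := (Lp.memLp f).integrable one_le_two
  have hg : Integrable g ν := (Lp.memLp g).integrable one_le_two
  have h1 := (hf.mul_prod hg).bdd_mul (c := C) hF.1.aestronglyMeasurable
    (Eventually.of_forall fun p => hC p.1 p.2)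
  refine h1.congr (Eventually.of_forall fun p => ?_)
  simp only [Function.uncurry]
  ring

theorem inner_intOp_swap (hF : BddKernel F) (f : Lp ℝ 2 μ) (g : Lp ℝ 2 ν) :
    inner ℝ f (intOp μ ν hF g) = inner ℝ (intOp ν μ hF.swap f) g := by
  rw [← real_inner_comm _ g, inner_intOp, inner_intOp]
  simp only [← integral_const_mul]
  rw [integral_integral_swap (integrable_mul_kernel_mul hF f g)]
  refine integral_congr_ae (Eventually.of_forall fun y => integral_congr_ae
    (Eventually.of_forall fun x => ?_))
  dsimp only
  ring

/-- The composition of two integral operators. -/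
theorem intOp_kcomp [IsFiniteMeasure ρ] {G : Y → Z → ℝ} (hF : BddKernel F) (hG : BddKernel G)
    {K : X → Z → ℝ} (hK : BddKernel K) (h : K = kcomp ν F G) (g : Lp ℝ 2 ρ) :
    intOp μ ρ hK g = intOp μ ν hF (intOp ν ρ hG g) := by
  subst h
  refine Lp.ext ?_
  filter_upwards [intOp_apply_ae (μ := μ) hK g,
    intOp_apply_ae (μ := μ) hF (intOp ν ρ hG g)] with x hx1 hx2
  rw [hx1, hx2, integral_mul_eq_inner hF, inner_intOp]
  have h1 := integrable_mul_kernel_mul hG ((hF.memLp_right (ν := ν) x).toLp (F x)) g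
  simp only [← integral_const_mul]
  rw [integral_integral_swap h1]
  refine integral_congr_ae (Eventually.of_forall fun z => ?_)
  dsimp only [kcomp]
  rw [← integral_mul_const]
  refine integral_congr_ae ?_
  filter_upwards [(hF.memLp_right (ν := ν) x).coeFn_toLp] with y hy
  rw [hy]
  ring

theorem intOp_toLp_ae (hF : BddKernel F) {f : Y → ℝ} (hf : MemLp f 2 ν) :
    intOp μ ν hF (hf.toLp f) =ᵐ[μ] fun x => ∫ y, F x y * f y ∂ν := by
  filter_upwards [intOp_apply_ae (μ := μ) hF (hf.toLp f)] with x hx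
  rw [hx]
  refine integral_congr_ae ?_
  filter_upwards [hf.coeFn_toLp] with y hy
  rw [hy]

/-- Integral operators of bounded kernels are Hilbert–Schmidt. -/
theorem summable_sq_norm_intOp (hF : BddKernel F) {ι : Type*} (b : HilbertBasis ι ℝ (Lp ℝ 2 ν)) :
    Summable fun i => ‖intOp μ ν hF (b i)‖ ^ 2 := by
  obtain ⟨C, hC0, hC⟩ := exists_norm_toLp_le hF ν
  have e : ∀ i, ‖intOp μ ν hF (b i)‖ ^ 2 = ∫ x, (∫ y, F x y * b i y ∂ν) ^ 2 ∂μ := fun i => by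
    rw [← real_inner_self_eq_norm_sq, inner_intOp]
    refine integral_congr_ae ?_
    filter_upwards [intOp_apply_ae (μ := μ) hF (b i)] with x hx
    rw [hx, sq]
  refine summable_of_sum_le (c := C ^ 2 * μ.real Set.univ) (fun i => sq_nonneg _) fun s => ?_
  simp only [e]
  rw [← integral_finsetSum _ fun i _ => (memLp_integral_mul (μ := μ) hF (b i)).integrable_sq]
  refine (le_abs_self _).trans ?_
  rw [← Real.norm_eq_abs]
  refine norm_integral_le_of_norm_le_const (Eventually.of_forall fun x => ?_)
  rw [Real.norm_of_nonneg (Finset.sum_nonneg fun i _ => sq_nonneg _)]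
  have h2 := b.orthonormal.sum_inner_products_le ((hF.memLp_right (ν := ν) x).toLp (F x)) (s := s)
  refine le_trans (Finset.sum_le_sum fun i _ => ?_) (h2.trans (pow_le_pow_left₀ (norm_nonneg _) (hC x) 2))
  rw [integral_mul_eq_inner hF, real_inner_comm, Real.norm_eq_abs, sq_abs]

theorem isCompactOperator_intOp (hF : BddKernel F) : IsCompactOperator (intOp μ ν hF) := by
  obtain ⟨w, b, -⟩ := exists_hilbertBasis ℝ (Lp ℝ 2 ν)
  exact isCompactOperator_of_summable_sq_norm b _ (summable_sq_norm_intOp hF b)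

end Kernel

/-! ### Eigenvalues of positive kernels -/

section Spectral

set_option linter.unusedSectionVars false

variable {X Y : Type} [MeasurableSpace X] [MeasurableSpace Y] {μ : Measure X} {ν : Measure Y}
  [IsFiniteMeasure μ] [IsFiniteMeasure ν] {F : X → Y → ℝ} {K : X → X → ℝ}
  {ι : Type} {b : HilbertBasis ι ℝ (Lp ℝ 2 μ)} {t : ι → ℝ}

theorem intOp_self_adjoint (hK : BddKernel K) (hsymm : ∀ x y, K x y = K y x) (f g : Lp ℝ 2 μ) :
    inner ℝ (intOp μ μ hK f) g = inner ℝ f (intOp μ μ hK g) := by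
  rw [inner_intOp_swap hK]
  congr 2
  have : (fun y x => K x y) = K := by ext x y; exact hsymm y x
  simp only [this]

theorem mem_kernelEigenspace_iff (hK : BddKernel K) (c : ℝ) (f : Lp ℝ 2 μ) :
    f ∈ kernelEigenspace μ K c ↔ intOp μ μ hK f = c • f := by
  change (∀ᵐ x ∂μ, Integrable (fun y => K x y * f y) μ ∧ ∫ y, K x y * f y ∂μ = c * f x) ↔ _
  constructor
  · intro h
    refine Lp.ext ?_
    filter_upwards [h, intOp_apply_ae (μ := μ) hK f, Lp.coeFn_smul c f] with x h1 h2 h3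
    rw [h2, h3, h1.2, Pi.smul_apply, smul_eq_mul]
  · intro h
    filter_upwards [intOp_apply_ae (μ := μ) hK f, Lp.coeFn_smul c f] with x h2 h3
    refine ⟨integrable_kernel_mul hK f x, ?_⟩
    rw [← h2, h, h3, Pi.smul_apply, smul_eq_mul]

theorem symm_of_eq_kcomp (hKF : K = kcomp ν F fun y x => F x y) (x y : X) : K x y = K y x := by
  rw [hKF]
  simp only [kcomp, mul_comm]

theorem eigenvalue_eq_sq_norm (hF : BddKernel F) (hK : BddKernel K)
    (hKF : K = kcomp ν F fun y x => F x y) (hb : ∀ i, intOp μ μ hK (b i) = t i • b i) (i : ι) :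
    t i = ‖intOp ν μ hF.swap (b i)‖ ^ 2 := by
  have h1 : inner ℝ (b i) (intOp μ μ hK (b i)) = t i := by
    rw [hb, inner_smul_right, real_inner_self_eq_norm_sq, b.orthonormal.1]
    simp
  rw [← h1, intOp_kcomp hF hF.swap hK hKF, inner_intOp_swap, real_inner_self_eq_norm_sq]

theorem eigenvalue_nonneg (hF : BddKernel F) (hK : BddKernel K)
    (hKF : K = kcomp ν F fun y x => F x y) (hb : ∀ i, intOp μ μ hK (b i) = t i • b i) (i : ι) : 0 ≤ t i := by
  rw [eigenvalue_eq_sq_norm hF hK hKF hb]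
  positivity

theorem summable_eigenvalue (hF : BddKernel F) (hK : BddKernel K)
    (hKF : K = kcomp ν F fun y x => F x y) (hb : ∀ i, intOp μ μ hK (b i) = t i • b i) : Summable t := by
  rw [funext (eigenvalue_eq_sq_norm hF hK hKF hb)]
  exact summable_sq_norm_intOp hF.swap b

/-- The trace of a power of a positive kernel is the power sum of its eigenvalues. -/
theorem hasSum_eigenvalue_pow [Countable ι] (hF : BddKernel F) (hK : BddKernel K)
    (hKF : K = kcomp ν F fun y x => F x y) (hb : ∀ i, intOp μ μ hK (b i) = t i • b i) (m : ℕ) :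
    HasSum (fun i => t i ^ (m + 1)) (kernelTrace μ K m) := by
  have h0 := eigenvalue_nonneg hF hK hKF hb
  have hs := summable_eigenvalue hF hK hKF hb
  have hsa := intOp_self_adjoint (μ := μ) hK (symm_of_eq_kcomp hKF)
  -- the iterates applied to the sections of the feature kernel
  let G : ℕ → X → Y → ℝ := fun m => Nat.rec F (fun _ g => kcomp μ K g) m
  have hG : ∀ m, BddKernel (G m) := fun m => by
    induction m with
    | zero => exact hF
    | succ m ih => exact hK.kcomp ih
  have hGF : ∀ m, iterKernel μ K m = kcomp ν (G m) fun y x => F x y := fun m => by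
    induction m with
    | zero => exact hKF
    | succ m ih =>
      change kcomp μ K (iterKernel μ K m) = _
      rw [ih, kcomp_assoc hK (hG m) hF.swap]
  let v : Y → Lp ℝ 2 μ := fun y => (hF.memLp_left y).toLp _
  have hpow : ∀ m y, (intOp μ μ hK ^ m) (v y) = ((hG m).memLp_left y).toLp _ := fun m y => by
    induction m with
    | zero => rfl
    | succ m ih =>
      rw [pow_succ', mul_apply_eq_comp, ih]
      refine Lp.ext ?_
      filter_upwards [intOp_toLp_ae (μ := μ) hK ((hG m).memLp_left (μ := μ) y),
        ((hG (m + 1)).memLp_left (μ := μ) y).coeFn_toLp] with x h1 h2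
      rw [h1, h2]
      rfl
  have hinner : ∀ m y, inner ℝ (v y) ((intOp μ μ hK ^ m) (v y)) = ∫ x, F x y * G m x y ∂μ := by
    intro m y
    rw [hpow, L2.inner_def]
    refine integral_congr_ae ?_
    filter_upwards [(hF.memLp_left (μ := μ) y).coeFn_toLp,
      ((hG m).memLp_left (μ := μ) y).coeFn_toLp] with x h1 h2
    rw [h1, h2]
    simp [mul_comm]
  have hcoef : ∀ i y, inner ℝ (v y) (b i) = ∫ x, F x y * b i x ∂μ := fun i y =>
    (integral_mul_eq_inner hF.swap (b i) y).symm
  have ht : ∀ i, ∫ y, inner ℝ (v y) (b i) ^ 2 ∂ν = t i := fun i => by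
    rw [eigenvalue_eq_sq_norm hF hK hKF hb, ← real_inner_self_eq_norm_sq, inner_intOp]
    refine integral_congr_ae ?_
    filter_upwards [intOp_apply_ae (μ := ν) hF.swap (b i)] with y hy
    rw [hy, hcoef, sq]
  have hint : ∀ i, Integrable (fun y => inner ℝ (v y) (b i) ^ 2) ν := fun i => by
    simp only [hcoef]
    exact (memLp_integral_mul (μ := ν) hF.swap (b i)).integrable_sq
  have hterm : ∀ i, ∫ y, t i ^ m * inner ℝ (v y) (b i) ^ 2 ∂ν = t i ^ (m + 1) := fun i => by
    rw [integral_const_mul, ht, pow_succ]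
  have hsum : Summable fun i => t i ^ (m + 1) := by
    refine Summable.of_nonneg_of_le (fun i => pow_nonneg (h0 i) _) (fun i => ?_)
      (hs.mul_left ((∑' i, t i) ^ m))
    rw [pow_succ]
    exact mul_le_mul_of_nonneg_right
      (pow_le_pow_left₀ (h0 i) (hs.le_tsum i fun j _ => h0 j) m) (h0 i)
  have hmain := hasSum_integral_of_summable_integral_norm (μ := ν)
    (F := fun i y => t i ^ m * inner ℝ (v y) (b i) ^ 2) (fun i => (hint i).const_mul _) (by
      refine hsum.congr fun i => ?_
      rw [← hterm i]
      refine integral_congr_ae (Eventually.of_forall fun y => ?_)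
      exact (Real.norm_of_nonneg (mul_nonneg (pow_nonneg (h0 i) _) (sq_nonneg _))).symm)
  simp only [hterm, (hasSum_pow_mul_inner_sq b hsa hb m _).tsum_eq, hinner] at hmain
  suffices h : kernelTrace μ K m = ∫ y, ∫ x, F x y * G m x y ∂μ ∂ν by rwa [h]
  have h3 : Integrable (Function.uncurry fun x y => F x y * G m x y) (μ.prod ν) := by
    obtain ⟨C, hC⟩ := hF.2
    obtain ⟨D, hD⟩ := (hG m).2
    refine Integrable.of_bound (C := |C| * |D|) (hF.1.mul (hG m).1).aestronglyMeasurable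
      (Eventually.of_forall fun p => ?_)
    simp only [Function.uncurry, norm_mul]
    exact mul_le_mul ((hC _ _).trans (le_abs_self _)) ((hD _ _).trans (le_abs_self _))
      (norm_nonneg _) (abs_nonneg _)
  rw [← integral_integral_swap h3]
  simp only [kernelTrace, hGF, kcomp, mul_comm]

theorem finite_eigenvalue_eq (hF : BddKernel F) (hK : BddKernel K)
    (hKF : K = kcomp ν F fun y x => F x y) (hb : ∀ i, intOp μ μ hK (b i) = t i • b i) {c : ℝ} (hc : c ≠ 0) :
    {i | t i = c}.Finite := by
  have h1 := (summable_eigenvalue hF hK hKF hb).tendsto_cofinite_zero.eventually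
    (isOpen_ne.mem_nhds hc.symm)
  simpa [Filter.eventually_cofinite] using h1

theorem rank_kernelEigenspace (hF : BddKernel F) (hK : BddKernel K)
    (hKF : K = kcomp ν F fun y x => F x y) (hb : ∀ i, intOp μ μ hK (b i) = t i • b i) {c : ℝ} (hc : c ≠ 0) :
    Module.rank ℝ (kernelEigenspace μ K c) = Cardinal.mk {i // t i = c} :=
  rank_eigenspace_eq b (intOp_self_adjoint hK (symm_of_eq_kcomp hKF)) hb
    (finite_eigenvalue_eq hF hK hKF hb hc) _ (mem_kernelEigenspace_iff hK c)

theorem exists_equiv_of_forall_fiber_equiv {α β : Type} {f : α → ℝ} {g : β → ℝ}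
    (hf : ∀ a, f a ≠ 0) (h : ∀ c : ℝ, c ≠ 0 → Nonempty ({a // f a = c} ≃ {b // g b = c})) :
    ∃ e : α ≃ {b // g b ≠ 0}, ∀ a, f a = g (e a) := by
  let E := fun c hc => (h c hc).some
  have hg : ∀ a, g (E (f a) (hf a) ⟨a, rfl⟩) = f a := fun a => (E (f a) (hf a) ⟨a, rfl⟩).2
  let e : α → {b // g b ≠ 0} := fun a => ⟨E (f a) (hf a) ⟨a, rfl⟩, by rw [hg]; exact hf a⟩
  have he : ∀ a c (hc : c ≠ 0) (h : f a = c), (e a : β) = E c hc ⟨a, h⟩ := by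
    rintro a c hc rfl
    rfl
  refine ⟨Equiv.ofBijective e ⟨fun a a' haa => ?_, fun b => ?_⟩, fun a => (hg a).symm⟩
  · have h1 : f a' = f a := by rw [← hg a, ← hg a']; exact congrArg (fun b => g b.1) haa.symm
    have h2 := he a (f a) (hf a) rfl
    rw [haa, he a' (f a) (hf a) h1] at h2
    have h3 := (E (f a) (hf a)).injective (Subtype.ext h2)
    exact (congrArg Subtype.val h3).symm
  · obtain ⟨a, ha⟩ := (E (g b) b.2).surjective ⟨b, rfl⟩
    refine ⟨a, Subtype.ext ?_⟩
    rw [he a (g b) b.2 a.2, Subtype.coe_eta, ha]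

/-- Two listings of the non-zero eigenvalues differ by a bijection. -/
theorem exists_equiv_eigenvalue (hF : BddKernel F) (hK : BddKernel K)
    (hKF : K = kcomp ν F fun y x => F x y)
    (hb : ∀ i, intOp μ μ hK (b i) = t i • b i) {ev : ℕ → ℝ}
    (hev : IsNonzeroEigenvalueSequence μ K ev) :
    ∃ e : ℕ ≃ {i // t i ≠ 0}, ∀ k, ev k = t (e k) :=
  exists_equiv_of_forall_fiber_equiv hev.1 fun c hc => by
    rw [← Cardinal.eq, hev.2 c hc, rank_kernelEigenspace hF hK hKF hb hc]

theorem exists_eigenvalueSequence [Countable ι] (hF : BddKernel F) (hK : BddKernel K)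
    (hKF : K = kcomp ν F fun y x => F x y)
    (hb : ∀ i, intOp μ μ hK (b i) = t i • b i) (hinf : {i | t i ≠ 0}.Infinite) :
    ∃ ev, IsNonzeroEigenvalueSequence μ K ev := by
  have := hinf.to_subtype
  obtain ⟨e⟩ : Nonempty (ℕ ≃ {i | t i ≠ 0}) := by
    obtain ⟨h⟩ := nonempty_denumerable {i | t i ≠ 0}
    exact ⟨(Denumerable.eqv _).symm⟩
  refine ⟨fun k => t (e k), fun k => (e k).2, fun c hc => ?_⟩
  rw [rank_kernelEigenspace hF hK hKF hb hc]
  refine Cardinal.mk_congr (Equiv.ofBijective (fun k => ⟨e k.1, k.2⟩) ⟨fun k l hkl => ?_, fun i => ?_⟩)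
  · exact Subtype.ext (e.injective (Subtype.ext (by simpa using hkl)))
  · refine ⟨⟨e.symm ⟨i, by rw [Set.mem_ofPred_eq, i.2]; exact hc⟩, ?_⟩, ?_⟩
    · change t (e (e.symm _)) = c
      rw [e.apply_symm_apply]; exact i.2
    · ext1; simp

/-- Any listing of the non-zero eigenvalues of a positive kernel consists of positive numbers with
the traces as power sums. -/
theorem IsNonzeroEigenvalueSequence.pos_and_hasSum [MeasureTheory.IsSeparable μ] (hF : BddKernel F)
    (hK : BddKernel K) (hKF : K = kcomp ν F fun y x => F x y) {ev : ℕ → ℝ}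
    (hev : IsNonzeroEigenvalueSequence μ K ev) :
    (∀ k, 0 < ev k) ∧ ∀ m, HasSum (fun k => ev k ^ (m + 1)) (kernelTrace μ K m) := by
  obtain ⟨ι, b, t, hb⟩ := exists_hilbertBasis_eigenvectors (intOp μ μ hK)
    (isCompactOperator_intOp hK) (intOp_self_adjoint hK (symm_of_eq_kcomp hKF))
  have : Fact ((2 : ENNReal) ≠ ⊤) := ⟨ENNReal.ofNat_ne_top⟩
  have := countable_of_hilbertBasis b
  obtain ⟨e, he⟩ := exists_equiv_eigenvalue hF hK hKF hb hev
  refine ⟨fun k => lt_of_le_of_ne ?_ (hev.1 k).symm, fun m => ?_⟩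
  · rw [he]; exact eigenvalue_nonneg hF hK hKF hb _
  · simp only [he]
    refine (e.hasSum_iff (f := fun i : {i // t i ≠ 0} => t i ^ (m + 1))).2 ?_
    refine (hasSum_subtype_iff_of_support_subset (s := {i | t i ≠ 0})
      (f := fun i => t i ^ (m + 1)) fun i hi => ?_).2 (hasSum_eigenvalue_pow hF hK hKF hb m)
    intro h0
    exact hi (by simp [h0])

end Spectral

section Infinite

set_option linter.unusedSectionVars false

theorem eq_zero_of_mem_support {X : Type} [TopologicalSpace X] [MeasurableSpace X] {μ : Measure X}
    {f : X → ℝ} (hf : Continuous f) (h : ∀ᵐ x ∂μ, f x = 0) {x : X} (hx : x ∈ μ.support) :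
    f x = 0 := by
  by_contra hne
  have h1 : IsOpen {x | f x ≠ 0} := isOpen_ne_fun hf continuous_const
  exact Measure.subset_compl_support_of_isOpen h1 (ae_iff.1 h) hne hx

variable {X : Type} [PseudoMetricSpace X] [MeasurableSpace X] [BorelSpace X] {μ : Measure X}
  [IsFiniteMeasure μ] {K : X → X → ℝ} {ι : Type} {b : HilbertBasis ι ℝ (Lp ℝ 2 μ)} {t : ι → ℝ}

theorem lipschitz_integral_mul {L : ℝ} (hK : BddKernel K)
    (hL : ∀ x x' z, |K x z - K x' z| ≤ L * dist x x') (g : Lp ℝ 2 μ) (x x' : X) :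
    |∫ z, K x z * g z ∂μ - ∫ z, K x' z * g z ∂μ| ≤ L * (∫ z, |g z| ∂μ) * dist x x' := by
  rw [← integral_sub (integrable_kernel_mul hK g x) (integrable_kernel_mul hK g x'),
    ← Real.norm_eq_abs, mul_right_comm, ← integral_const_mul]
  have hg : Integrable g μ := (Lp.memLp g).integrable one_le_two
  refine norm_integral_le_of_norm_le (hg.abs.const_mul _) (Eventually.of_forall fun z => ?_)
  rw [← sub_mul, norm_mul]
  exact mul_le_mul_of_nonneg_right (hL x x' z) (norm_nonneg _)

theorem continuous_integral_mul {L : ℝ} (hK : BddKernel K)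
    (hL : ∀ x x' z, |K x z - K x' z| ≤ L * dist x x') (g : Lp ℝ 2 μ) :
    Continuous fun x => ∫ z, K x z * g z ∂μ :=
  (LipschitzWith.of_dist_le_mul (K := (L * ∫ z, |g z| ∂μ).toNNReal) fun x x' =>
    (lipschitz_integral_mul hK hL g x x').trans
      (mul_le_mul_of_nonneg_right (Real.le_coe_toNNReal _) dist_nonneg)).continuous

/-- A Lipschitz kernel of finite rank has a smooth diagonal. -/
theorem exists_le_mul_sq_dist_of_finite (hK : BddKernel K) (hsymm : ∀ x y, K x y = K y x) {L : ℝ}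
    (hL : ∀ x x' z, |K x z - K x' z| ≤ L * dist x x')
    (hb : ∀ i, intOp μ μ hK (b i) = t i • b i) (hfin : {i | t i ≠ 0}.Finite) :
    ∃ C, ∀ x ∈ μ.support, ∀ x' ∈ μ.support,
      K x x - 2 * K x x' + K x' x' ≤ C * dist x x' ^ 2 := by
  let c : ι → X → ℝ := fun i x => ∫ z, K x z * b i z ∂μ
  have hc : ∀ i, Continuous (c i) := fun i => continuous_integral_mul hK hL (b i)
  have hcb : ∀ i, ∀ᵐ x ∂μ, c i x = t i * b i x := fun i => by
    have h1 := intOp_apply_ae (μ := μ) hK (b i)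
    rw [hb] at h1
    filter_upwards [h1, Lp.coeFn_smul (t i) (b i)] with x hx hx'
    change ∫ z, K x z * b i z ∂μ = _
    rw [← hx, hx', Pi.smul_apply, smul_eq_mul]
  have hc0 : ∀ i, t i = 0 → ∀ x ∈ μ.support, c i x = 0 := fun i hi x hx => by
    refine eq_zero_of_mem_support (hc i) ?_ hx
    filter_upwards [hcb i] with y hy
    rw [hy, hi, zero_mul]
  let I := hfin.toFinset
  have hk : ∀ x ∈ μ.support, (hK.memLp_right (ν := μ) x).toLp (K x) = ∑ i ∈ I, c i x • b i := by
    intro x hx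
    have h1 := b.hasSum_repr ((hK.memLp_right (ν := μ) x).toLp (K x))
    refine h1.unique ?_
    have h2 : ∀ i, b.repr ((hK.memLp_right (ν := μ) x).toLp (K x)) i = c i x := fun i => by
      rw [HilbertBasis.repr_apply_apply, real_inner_comm, ← integral_mul_eq_inner hK]
    simp only [h2]
    refine hasSum_sum_of_ne_finset_zero fun i hi => ?_
    rw [hc0 i (by simpa [I] using hi) x hx, zero_smul]
  have hexp : ∀ x ∈ μ.support, ∀ z ∈ μ.support, K x z = ∑ i ∈ I, (t i)⁻¹ * (c i x * c i z) := by
    intro x hx z hz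
    have hcont : Continuous fun z => K x z - ∑ i ∈ I, (t i)⁻¹ * (c i x * c i z) := by
      refine Continuous.sub ?_ (continuous_finsetSum _ fun i _ =>
        continuous_const.mul (continuous_const.mul (hc i)))
      refine (LipschitzWith.of_dist_le_mul (K := L.toNNReal) fun z z' => ?_).continuous
      rw [hsymm x z, hsymm x z']
      exact (hL z z' x).trans (mul_le_mul_of_nonneg_right (Real.le_coe_toNNReal _) dist_nonneg)
    refine sub_eq_zero.1 (eq_zero_of_mem_support hcont ?_ hz)
    have h1 : ∀ᵐ z ∂μ, (∑ i ∈ I, c i x • b i : Lp ℝ 2 μ) z = ∑ i ∈ I, c i x * b i z := by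
      have h2 := Lp.coeFn_finsetSum I (fun i => c i x • b i)
      have h3 : ∀ᵐ z ∂μ, ∀ i ∈ I, (c i x • b i : Lp ℝ 2 μ) z = c i x * b i z := by
        rw [Finset.eventually_all]
        intro i _
        filter_upwards [Lp.coeFn_smul (c i x) (b i)] with z hz
        rw [hz, Pi.smul_apply, smul_eq_mul]
      filter_upwards [h2, h3] with z hz2 hz3
      rw [hz2, Finset.sum_apply]
      exact Finset.sum_congr rfl hz3
    have h4 : ∀ᵐ z ∂μ, ∀ i ∈ I, c i z = t i * b i z := by
      rw [Finset.eventually_all]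
      exact fun i _ => hcb i
    have h5 := (hK.memLp_right (ν := μ) x).coeFn_toLp
    rw [hk x hx] at h5
    filter_upwards [h1, h4, h5] with z hz1 hz4 hz5
    rw [← hz5, hz1, sub_eq_zero]
    refine Finset.sum_congr rfl fun i hi => ?_
    rw [hz4 i hi]
    have : t i ≠ 0 := by simpa [I] using hi
    field_simp
  refine ⟨∑ i ∈ I, |(t i)⁻¹| * (L * ∫ z, |b i z| ∂μ) ^ 2, fun x hx x' hx' => ?_⟩
  rw [hexp x hx x hx, hexp x hx x' hx', hexp x' hx' x' hx', Finset.mul_sum,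
    ← Finset.sum_sub_distrib, ← Finset.sum_add_distrib, Finset.sum_mul]
  refine Finset.sum_le_sum fun i _ => ?_
  calc (t i)⁻¹ * (c i x * c i x) - 2 * ((t i)⁻¹ * (c i x * c i x')) + (t i)⁻¹ * (c i x' * c i x')
      = (t i)⁻¹ * (c i x - c i x') ^ 2 := by ring
    _ ≤ |(t i)⁻¹| * |c i x - c i x'| ^ 2 := by
        rw [sq_abs]
        exact mul_le_mul_of_nonneg_right (le_abs_self _) (sq_nonneg _)
    _ ≤ |(t i)⁻¹| * ((L * ∫ z, |b i z| ∂μ) * dist x x') ^ 2 :=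
        mul_le_mul_of_nonneg_left (pow_le_pow_left₀ (abs_nonneg _)
          (lipschitz_integral_mul hK hL (b i) x x') 2) (abs_nonneg _)
    _ = _ := by ring

end Infinite

/-! ### The doubly centered distance kernel -/

section Centering

theorem integrable_fun_sub {α : Type*} [MeasurableSpace α] {μ : Measure α} {f g : α → ℝ}
    (hf : Integrable f μ) (hg : Integrable g μ) : Integrable (fun x => f x - g x) μ :=
  hf.sub hg

variable {X Y : Type} [MeasurableSpace X] [MeasurableSpace Y] {μ : Measure X} {ν : Measure Y}
  [IsProbabilityMeasure μ] [IsFiniteMeasure ν] {H : X → Y → ℝ}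

theorem BddKernel.integral_left (hH : BddKernel H) : BddKernel fun (_ : X) y => ∫ z, H z y ∂μ := by
  obtain ⟨C, hC⟩ := hH.2
  refine ⟨(hH.swap.1.stronglyMeasurable.integral_prod_right' (ν := μ)).measurable.comp
    measurable_snd, C, fun _ y => ?_⟩
  have h1 := norm_integral_le_of_norm_le_const (μ := μ) (f := fun z => H z y)
    (Eventually.of_forall fun z => hC z y)
  simpa using h1

theorem BddKernel.sub {G : X → Y → ℝ} (hH : BddKernel H) (hG : BddKernel G) :
    BddKernel fun x y => H x y - G x y := by
  obtain ⟨C, hC⟩ := hH.2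
  obtain ⟨D, hD⟩ := hG.2
  exact ⟨hH.1.sub hG.1, C + D, fun x y => (abs_sub _ _).trans (add_le_add (hC x y) (hD x y))⟩

theorem BddKernel.const_mul (c : ℝ) (hH : BddKernel H) : BddKernel fun x y => c * H x y := by
  obtain ⟨C, hC⟩ := hH.2
  refine ⟨hH.1.const_mul c, |c| * C, fun x y => ?_⟩
  rw [abs_mul]
  exact mul_le_mul_of_nonneg_left (hC x y) (abs_nonneg _)

/-- Double centering of a squared distance gives the Gram kernel of the centered features. -/
theorem two_mul_kcomp_centered (hH : BddKernel H) {D : X → X → ℝ}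
    (hD : ∀ x x', ∫ y, (H x y - H x' y) ^ 2 ∂ν = D x x') (x x' : X) :
    2 * ∫ y, (H x y - ∫ z, H z y ∂μ) * (H x' y - ∫ z, H z y ∂μ) ∂ν
      = -(D x x' - (∫ z, D x z ∂μ) - (∫ z, D z x' ∂μ) + ∫ z, ∫ w, D z w ∂μ ∂μ) := by
  let k : X → X → ℝ := kcomp ν H fun y x => H x y
  let m : Y → ℝ := fun y => ∫ z, H z y ∂μ
  have hm : BddKernel fun (_ : X) y => m y := hH.integral_left
  have hk : BddKernel k := hH.kcomp hH.swap
  have hsymm : ∀ x x', k x x' = k x' x := fun x x' => by simp only [k, kcomp, mul_comm]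
  have h1 : BddKernel fun (_ : X) (_ : X) => (1 : ℝ) := ⟨measurable_const, 1, by simp⟩
  have hHH : ∀ x x', Integrable (fun y => H x y * H x' y) ν := fun x x' =>
    hH.integrable_mul hH.swap x x'
  have hHm : ∀ x, Integrable (fun y => H x y * m y) ν := fun x => hH.integrable_mul hm.swap x x
  have hmm : Integrable (fun y => m y * m y) ν := hm.integrable_mul hm.swap x x
  have e0 : ∀ x x', D x x' = k x x - 2 * k x x' + k x' x' := fun x x' => by
    rw [← hD]
    simp only [k, kcomp]
    rw [← integral_const_mul, ← integral_sub (hHH x x) ((hHH x x').const_mul 2),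
      ← integral_add (integrable_fun_sub (hHH x x) ((hHH x x').const_mul 2)) (hHH x' x')]
    refine integral_congr_ae (Eventually.of_forall fun y => ?_)
    dsimp only
    ring
  have em : ∀ x, ∫ y, H x y * m y ∂ν = ∫ z, k x z ∂μ := fun x => by
    have := congrFun (congrFun (kcomp_assoc (ν := ν) (ρ := μ) hH hH.swap h1) x) x
    simp only [kcomp, mul_one] at this
    exact this
  have emm : ∫ y, m y * m y ∂ν = ∫ z, ∫ w, k z w ∂μ ∂μ := by
    have := congrFun (congrFun (kcomp_assoc (ν := μ) (ρ := ν) h1 hH hm.swap) x) x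
    simp only [kcomp, one_mul, em] at this
    exact this.symm
  have eL : ∫ y, (H x y - m y) * (H x' y - m y) ∂ν
      = k x x' - (∫ z, k x z ∂μ) - (∫ z, k x' z ∂μ) + ∫ z, ∫ w, k z w ∂μ ∂μ := by
    rw [← em, ← em, ← emm]
    simp only [k, kcomp]
    rw [← integral_sub (hHH x x') (hHm x), ← integral_sub (integrable_fun_sub (hHH x x') (hHm x)) (hHm x'),
      ← integral_add (integrable_fun_sub (integrable_fun_sub (hHH x x') (hHm x)) (hHm x')) hmm]
    refine integral_congr_ae (Eventually.of_forall fun y => ?_)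
    dsimp only
    ring
  have hkint : ∀ x, Integrable (k x) μ := fun x => (hk.memLp_right x).integrable one_le_two
  obtain ⟨C, hC⟩ := hk.2
  have hdiag : Integrable (fun z => k z z) μ :=
    Integrable.of_bound (C := C) (hk.1.comp (measurable_id.prodMk measurable_id)).aestronglyMeasurable
      (Eventually.of_forall fun z => hC z z)
  have hkk : Integrable (fun z => ∫ w, k z w ∂μ) μ := by
    refine Integrable.of_bound (C := C)
      (hk.1.stronglyMeasurable.integral_prod_right' (ν := μ)).aestronglyMeasurable
      (Eventually.of_forall fun z => ?_)
    have := norm_integral_le_of_norm_le_const (μ := μ) (f := k z) (Eventually.of_forall (hC z))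
    simpa using this
  have eD : ∀ x, ∫ z, D x z ∂μ = k x x - 2 * (∫ z, k x z ∂μ) + ∫ z, k z z ∂μ := fun x => by
    simp only [e0]
    rw [integral_add (integrable_fun_sub (integrable_const _) ((hkint x).const_mul 2)) hdiag,
      integral_sub (integrable_const _) ((hkint x).const_mul 2), integral_const_mul]
    simp
  have eD' : ∫ z, D z x' ∂μ = ∫ z, D x' z ∂μ := by
    refine integral_congr_ae (Eventually.of_forall fun z => ?_)
    dsimp only
    rw [e0, e0, hsymm z x']
    ring
  have eDD : ∫ z, ∫ w, D z w ∂μ ∂μ = 2 * (∫ z, k z z ∂μ) - 2 * ∫ z, ∫ w, k z w ∂μ ∂μ := by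
    simp only [eD]
    rw [integral_add (integrable_fun_sub hdiag (hkk.const_mul 2)) (integrable_const _),
      integral_sub hdiag (hkk.const_mul 2), integral_const_mul]
    simp only [integral_const, probReal_univ, smul_eq_mul, one_mul]
    ring
  change 2 * ∫ y, (H x y - m y) * (H x' y - m y) ∂ν = _
  rw [eL, eD', eD, eD, eDD, e0]
  ring

end Centering

/-! The features `1{t < ⟨θ, x⟩}` of the Euclidean distance. -/

section Features

variable {d : ℕ}

/-- The radial retraction onto the closed unit ball. -/
noncomputable def retract (x : E d) : E d := (max 1 ‖x‖)⁻¹ • x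

theorem norm_retract_le (x : E d) : ‖retract x‖ ≤ 1 := by
  have h1 : 0 < max 1 ‖x‖ := lt_max_of_lt_left one_pos
  rw [retract, norm_smul, norm_inv, Real.norm_of_nonneg h1.le, inv_mul_le_iff₀ h1, mul_one]
  exact le_max_right _ _

theorem retract_of_norm_le {x : E d} (hx : ‖x‖ ≤ 1) : retract x = x := by
  rw [retract, max_eq_left hx, inv_one, one_smul]

theorem norm_retract_sub_le (x y : E d) : ‖retract x - retract y‖ ≤ 2 * ‖x - y‖ := by
  have hx : 1 ≤ max 1 ‖x‖ := le_max_left _ _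
  have hy : 1 ≤ max 1 ‖y‖ := le_max_left _ _
  have hab : |max 1 ‖y‖ - max 1 ‖x‖| ≤ ‖x - y‖ := by
    refine (abs_max_sub_max_le_max 1 ‖y‖ 1 ‖x‖).trans ?_
    rw [sub_self, abs_zero, max_eq_right (abs_nonneg _), norm_sub_rev]
    exact abs_norm_sub_norm_le y x
  have e : retract x - retract y
      = (max 1 ‖x‖)⁻¹ • (x - y) + ((max 1 ‖x‖)⁻¹ * (max 1 ‖y‖ - max 1 ‖x‖)) • retract y := by
    have hx' : max 1 ‖x‖ ≠ 0 := (one_pos.trans_le hx).ne'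
    have hy' : max 1 ‖y‖ ≠ 0 := (one_pos.trans_le hy).ne'
    simp only [retract, smul_smul, smul_sub]
    rw [show (max 1 ‖x‖)⁻¹ * (max 1 ‖y‖ - max 1 ‖x‖) * (max 1 ‖y‖)⁻¹
      = (max 1 ‖x‖)⁻¹ - (max 1 ‖y‖)⁻¹ by field_simp, sub_smul]
    abel
  have hinv : ‖(max 1 ‖x‖)⁻¹‖ ≤ 1 := by
    rw [norm_inv, Real.norm_of_nonneg (zero_le_one.trans hx)]
    exact inv_le_one_of_one_le₀ hx
  rw [e, two_mul]
  refine (norm_add_le _ _).trans (add_le_add ?_ ?_)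
  · rw [norm_smul]
    exact mul_le_of_le_one_left (norm_nonneg _) hinv
  · rw [norm_smul, norm_mul, Real.norm_eq_abs (_ - _)]
    calc _ ≤ (1 * ‖x - y‖) * 1 := by
          refine mul_le_mul (mul_le_mul hinv hab (abs_nonneg _) zero_le_one) (norm_retract_le y)
            (norm_nonneg _) (by positivity)
      _ = _ := by ring

theorem continuous_retract : Continuous (retract : E d → E d) :=
  (LipschitzWith.of_dist_le_mul (K := 2) fun x y => by
    simpa [dist_eq_norm] using norm_retract_sub_le x y).continuous

/-- The indicator of the half space `{t < ⟨θ, x⟩}` at the retraction of `x`. -/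
noncomputable def halfSpace (x : E d) (y : E d × ℝ) : ℝ :=
  if y.2 < inner ℝ y.1 (retract x) then 1 else 0

variable (d) in
/-- Lebesgue measure on directions in the unit ball and thresholds in `[-1, 1]`. -/
noncomputable def featureMeasure : Measure (E d × ℝ) :=
  ((volume : Measure (E d)).restrict (Metric.closedBall 0 1)).prod
    ((volume : Measure ℝ).restrict (Set.Icc (-1) 1))

instance : IsFiniteMeasure ((volume : Measure (E d)).restrict (Metric.closedBall 0 1)) :=
  ⟨by simpa using measure_closedBall_lt_top⟩

instance : IsFiniteMeasure (featureMeasure d) := by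
  unfold featureMeasure
  infer_instance

theorem bddKernel_halfSpace : BddKernel (halfSpace (d := d)) := by
  refine ⟨?_, 1, fun x y => ?_⟩
  · refine Measurable.ite ?_ measurable_const measurable_const
    refine measurableSet_lt measurable_snd.snd ?_
    exact (measurable_snd.fst.inner (continuous_retract.measurable.comp measurable_fst))
  · unfold halfSpace
    split_ifs <;> simp

theorem integral_sq_sub_threshold {a b : ℝ} (ha : |a| ≤ 1) (hb : |b| ≤ 1) :
    ∫ t in Set.Icc (-1 : ℝ) 1, ((if t < a then (1 : ℝ) else 0) - if t < b then 1 else 0) ^ 2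
      = |a - b| := by
  have h1 : (fun t : ℝ => ((if t < a then (1 : ℝ) else 0) - if t < b then 1 else 0) ^ 2)
      = (Set.Ico (min a b) (max a b)).indicator fun _ => 1 := by
    ext t
    by_cases h1 : t < a <;> by_cases h2 : t < b <;>
      simp [Set.indicator, h1, h2, not_lt.1]
  have h2 : Set.Ico (min a b) (max a b) ⊆ Set.Icc (-1) 1 := fun t ht =>
    ⟨(le_min (abs_le.1 ha).1 (abs_le.1 hb).1).trans ht.1,
      ht.2.le.trans (max_le (abs_le.1 ha).2 (abs_le.1 hb).2)⟩
  rw [h1, integral_indicator measurableSet_Ico, Measure.restrict_restrict measurableSet_Ico,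
    Set.inter_eq_left.2 h2]
  simp [max_sub_min_eq_abs']

variable (d) in
/-- The constant `c` in `∫ |⟨θ, z⟩| dθ = c ‖z‖`. -/
noncomputable def meanProjection [NeZero d] : ℝ :=
  ∫ θ in Metric.closedBall (0 : E d) 1, |inner ℝ θ (EuclideanSpace.single 0 1 : E d)|

theorem integral_abs_inner [NeZero d] (z : E d) :
    ∫ θ in Metric.closedBall (0 : E d) 1, |inner ℝ θ z| = meanProjection d * ‖z‖ := by
  rcases eq_or_ne z 0 with rfl | hz
  · simp
  let e : E d := EuclideanSpace.single 0 1
  have h1 : ‖‖z‖ • e‖ = ‖z‖ := by simp [norm_smul, e]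
  let R := (ℝ ∙ (‖z‖ • e - z))ᗮ.reflection
  have hR : R (‖z‖ • e) = z := Submodule.reflection_sub h1
  have h2 : ∀ θ, |inner ℝ (R θ) z| = ‖z‖ * |inner ℝ θ e| := fun θ => by
    rw [← hR, R.inner_map_map, inner_smul_right, abs_mul, abs_norm, hR]
  have h3 := (R.measurePreserving.setIntegral_preimage_emb R.toMeasurableEquiv.measurableEmbedding
    (fun θ => |inner ℝ θ z|) (Metric.closedBall 0 1))
  rw [← h3, R.preimage_closedBall]
  simp only [map_zero, h2]
  rw [integral_const_mul, mul_comm]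
  rfl

theorem meanProjection_pos [NeZero d] : 0 < meanProjection d := by
  let e : E d := EuclideanSpace.single 0 1
  have hc : Continuous fun θ : E d => |inner ℝ θ e| := by fun_prop
  have hint : IntegrableOn (fun θ : E d => |inner ℝ θ e|) (Metric.closedBall 0 1) :=
    hc.continuousOn.integrableOn_compact (isCompact_closedBall _ _)
  refine (setIntegral_pos_iff_support_of_nonneg_ae (Eventually.of_forall fun θ => abs_nonneg _)
    hint).2 ?_
  have ho : IsOpen ({θ : E d | inner ℝ θ e ≠ 0} ∩ Metric.ball 0 1) :=
    (isOpen_ne_fun (by fun_prop) continuous_const).inter Metric.isOpen_ball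
  refine (ho.measure_pos volume ⟨(1 / 2 : ℝ) • e, ?_, ?_⟩).trans_le (measure_mono ?_)
  · simp [e, inner_smul_left]
  · simp [e, norm_smul]
    norm_num
  · rintro θ ⟨h1, h2⟩
    exact ⟨by simpa [Function.mem_support] using h1, Metric.ball_subset_closedBall h2⟩

theorem abs_inner_le_one {θ x : E d} (hθ : ‖θ‖ ≤ 1) (hx : ‖x‖ ≤ 1) : |inner ℝ θ x| ≤ 1 :=
  (abs_real_inner_le_norm θ x).trans (mul_le_one₀ hθ (norm_nonneg _) hx)

theorem integral_sq_sub_halfSpace [NeZero d] (x x' : E d) :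
    ∫ y, (halfSpace x y - halfSpace x' y) ^ 2 ∂(featureMeasure d)
      = meanProjection d * ‖retract x - retract x'‖ := by
  have hint : Integrable (fun y => (halfSpace x y - halfSpace x' y) ^ 2) (featureMeasure d) := by
    have h1 := bddKernel_halfSpace.memLp_right (ν := featureMeasure d) x
    exact (h1.sub (bddKernel_halfSpace.memLp_right x')).integrable_sq
  unfold featureMeasure at hint ⊢
  rw [integral_prod _ hint, ← integral_abs_inner]
  refine setIntegral_congr_fun Metric.isClosed_closedBall.measurableSet fun θ hθ => ?_
  rw [mem_closedBall_zero_iff] at hθ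
  simp only [halfSpace]
  rw [integral_sq_sub_threshold (abs_inner_le_one hθ (norm_retract_le x))
    (abs_inner_le_one hθ (norm_retract_le x')), inner_sub_right]

/-- The positive kernel `-d_μ`, extended from the unit ball by the retraction. -/
noncomputable def gramKernel (μ : Measure (E d)) (x x' : E d) : ℝ :=
  -centeredDist μ (retract x) (retract x')

/-- The centered features of the kernel `-d_μ`. -/
noncomputable def feature [NeZero d] (μ : Measure (E d)) (x : E d) (y : E d × ℝ) : ℝ :=
  √(2 / meanProjection d) * (halfSpace x y - ∫ z, halfSpace z y ∂μ)

variable {μ : Measure (E d)} [IsProbabilityMeasure μ]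

theorem bddKernel_feature [NeZero d] : BddKernel (feature μ) :=
  (bddKernel_halfSpace.sub bddKernel_halfSpace.integral_left).const_mul _

theorem gramKernel_eq_kcomp [NeZero d] (hμ : ∀ᵐ x ∂μ, ‖x‖ ≤ 1) :
    gramKernel μ = kcomp (featureMeasure d) (feature μ) fun y x => feature μ x y := by
  ext x x'
  have hc := meanProjection_pos (d := d)
  have h1 := two_mul_kcomp_centered (μ := μ) bddKernel_halfSpace
    (D := fun x x' => meanProjection d * ‖retract x - retract x'‖) integral_sq_sub_halfSpace x x'
  have h2 : ∀ y, feature μ x y * feature μ x' y = (meanProjection d)⁻¹ *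
      (2 * ((halfSpace x y - ∫ z, halfSpace z y ∂μ) * (halfSpace x' y - ∫ z, halfSpace z y ∂μ))) := by
    intro y
    have h3 : √(2 / meanProjection d) * √(2 / meanProjection d) = 2 / meanProjection d :=
      Real.mul_self_sqrt (by positivity)
    simp only [feature]
    rw [mul_mul_mul_comm, h3]
    ring
  simp only [kcomp, h2]
  rw [integral_const_mul, integral_const_mul, h1]
  simp only [integral_const_mul]
  have hr : ∀ᵐ z ∂μ, retract z = z := hμ.mono fun z hz => retract_of_norm_le hz
  have e1 : ∫ z, ‖retract x - retract z‖ ∂μ = ∫ z, ‖retract x - z‖ ∂μ :=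
    integral_congr_ae (hr.mono fun z hz => by simp only [hz])
  have e2 : ∫ z, ‖retract z - retract x'‖ ∂μ = ∫ z, ‖z - retract x'‖ ∂μ :=
    integral_congr_ae (hr.mono fun z hz => by simp only [hz])
  have e3 : ∫ z, ∫ w, ‖retract z - retract w‖ ∂μ ∂μ = ∫ z, ∫ w, ‖z - w‖ ∂μ ∂μ :=
    integral_congr_ae (hr.mono fun z hz => by
      simp only [hz]
      exact integral_congr_ae (hr.mono fun w hw => by simp only [hw]))
  rw [e1, e2, e3, gramKernel, centeredDist]
  field_simp

theorem bddKernel_gramKernel [NeZero d] (hμ : ∀ᵐ x ∂μ, ‖x‖ ≤ 1) : BddKernel (gramKernel μ) := by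
  rw [gramKernel_eq_kcomp hμ]
  exact bddKernel_feature.kcomp bddKernel_feature.swap

end Features

/-! ### Weak continuity of the traces -/

section Continuity

theorem continuous_integral_of_continuous_uncurry {A X : Type*} [TopologicalSpace A]
    [TopologicalSpace X] [CompactSpace X] [MeasurableSpace X] [OpensMeasurableSpace X]
    {ν : A → ProbabilityMeasure X} (hν : Continuous ν) {g : A → X → ℝ}
    (hg : Continuous (Function.uncurry g)) : Continuous fun a => ∫ x, g a x ∂(ν a : Measure X) := by
  let G : C(A, C(X, ℝ)) := ContinuousMap.curry ⟨_, hg⟩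
  have hG : ∀ a x, G a x = g a x := fun _ _ => rfl
  rw [continuous_iff_continuousAt]
  intro a₀
  have h1 : Tendsto (fun a => ∫ x, G a₀ x ∂(ν a : Measure X)) (𝓝 a₀)
      (𝓝 (∫ x, G a₀ x ∂(ν a₀ : Measure X))) :=
    ProbabilityMeasure.tendsto_iff_forall_integral_tendsto.1 (hν.tendsto a₀)
      (BoundedContinuousFunction.mkOfCompact (G a₀))
  have h2 : Tendsto (fun a => ∫ x, G a x ∂(ν a : Measure X) - ∫ x, G a₀ x ∂(ν a : Measure X)) (𝓝 a₀)
      (𝓝 0) := by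
    have h3 : Tendsto (fun a => ‖G a - G a₀‖) (𝓝 a₀) (𝓝 0) :=
      tendsto_iff_norm_sub_tendsto_zero.1 (G.continuous.tendsto a₀)
    refine squeeze_zero_norm (fun a => ?_) h3
    have hint : ∀ b, Integrable (fun x => G b x) (ν a : Measure X) := fun b =>
      (BoundedContinuousFunction.mkOfCompact (G b)).integrable _
    rw [← integral_sub (hint a) (hint a₀)]
    refine (norm_integral_le_of_norm_le_const (C := ‖G a - G a₀‖)
      (Eventually.of_forall fun x => ?_)).trans ?_
    · exact (G a - G a₀).norm_coe_le_norm x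
    · simp
  have h4 := h2.add h1
  simp only [sub_add_cancel, zero_add] at h4
  exact h4

variable {d : ℕ}

/-- A measure on the closed unit ball as a measure on `ℝ^d`. -/
noncomputable def ballMeasure (ν : ProbabilityMeasure (Metric.closedBall (0 : E d) 1)) :
    Measure (E d) :=
  (ν : Measure (Metric.closedBall (0 : E d) 1)).map Subtype.val

theorem integral_ballMeasure (ν : ProbabilityMeasure (Metric.closedBall (0 : E d) 1))
    (f : E d → ℝ) : ∫ x, f x ∂(ballMeasure ν)
      = ∫ z : Metric.closedBall (0 : E d) 1, f z ∂(ν : Measure _) :=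
  (MeasurableEmbedding.subtype_coe Metric.isClosed_closedBall.measurableSet).integral_map f

theorem continuous_doubleCentering {X : Type*} [TopologicalSpace X] [CompactSpace X]
    [MeasurableSpace X] [OpensMeasurableSpace X] {D : X → X → ℝ}
    (hD : Continuous (Function.uncurry D)) :
    Continuous fun a : ProbabilityMeasure X × X × X =>
      -(D a.2.1 a.2.2 - (∫ z, D a.2.1 z ∂(a.1 : Measure X)) - (∫ z, D z a.2.2 ∂(a.1 : Measure X))
        + ∫ z, ∫ w, D z w ∂(a.1 : Measure X) ∂(a.1 : Measure X)) := by
  refine (((hD.comp continuous_snd).sub ?_).sub ?_ |>.add ?_).neg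
  · exact continuous_integral_of_continuous_uncurry continuous_fst
      (hD.comp (continuous_fst.snd.fst.prodMk continuous_snd))
  · exact continuous_integral_of_continuous_uncurry continuous_fst
      (hD.comp (continuous_snd.prodMk continuous_fst.snd.snd))
  · refine continuous_integral_of_continuous_uncurry continuous_fst ?_
    exact continuous_integral_of_continuous_uncurry continuous_fst.fst
      (hD.comp (continuous_fst.snd.prodMk continuous_snd))

theorem continuous_gramKernel_ballMeasure :
    Continuous fun a : ProbabilityMeasure (Metric.closedBall (0 : E d) 1) ×
        Metric.closedBall (0 : E d) 1 × Metric.closedBall (0 : E d) 1 =>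
      gramKernel (ballMeasure a.1) a.2.1 a.2.2 := by
  have h1 : ∀ z : Metric.closedBall (0 : E d) 1, retract (z : E d) = z := fun z =>
    retract_of_norm_le (mem_closedBall_zero_iff.1 z.2)
  simp only [gramKernel, centeredDist, integral_ballMeasure, h1]
  exact continuous_doubleCentering (D := fun x y : Metric.closedBall (0 : E d) 1 => ‖(x : E d) - y‖)
    ((continuous_subtype_val.comp continuous_fst).sub
      (continuous_subtype_val.comp continuous_snd)).norm

theorem continuous_iterKernel_ballMeasure (m : ℕ) :
    Continuous fun a : ProbabilityMeasure (Metric.closedBall (0 : E d) 1) ×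
        Metric.closedBall (0 : E d) 1 × Metric.closedBall (0 : E d) 1 =>
      iterKernel (ballMeasure a.1) (gramKernel (ballMeasure a.1)) m a.2.1 a.2.2 := by
  induction m with
  | zero => exact continuous_gramKernel_ballMeasure
  | succ m ih =>
    simp only [iterKernel, kcomp, integral_ballMeasure]
    exact continuous_integral_of_continuous_uncurry continuous_fst
      ((continuous_gramKernel_ballMeasure.comp
        (continuous_fst.fst.prodMk (continuous_fst.snd.fst.prodMk continuous_snd))).mul
      (ih.comp (continuous_fst.fst.prodMk (continuous_snd.prodMk continuous_fst.snd.snd))))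

theorem continuous_kernelTrace_ballMeasure (m : ℕ) :
    Continuous fun ν : ProbabilityMeasure (Metric.closedBall (0 : E d) 1) =>
      kernelTrace (ballMeasure ν) (gramKernel (ballMeasure ν)) m := by
  simp only [kernelTrace, integral_ballMeasure]
  refine continuous_integral_of_continuous_uncurry continuous_id ?_
  exact (continuous_iterKernel_ballMeasure m).comp
    (continuous_fst.prodMk (continuous_snd.prodMk continuous_snd))

end Continuity

/-! ### The uniform law on the ball -/

section BallUniform

set_option linter.unusedSectionVars false

variable {d : ℕ} [NeZero d]

instance : IsProbabilityMeasure (sphereUniform d) := by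
  have h1 : (volume : Measure (E d)).toSphere Set.univ ≠ 0 := by
    rw [Measure.toSphere_apply_univ, finrank_euclideanSpace_fin]
    exact mul_ne_zero (by exact_mod_cast NeZero.ne d)
      (Metric.measure_ball_pos _ _ one_pos).ne'
  refine ⟨?_⟩
  rw [sphereUniform, Measure.smul_apply, smul_eq_mul]
  exact ENNReal.inv_mul_cancel h1 (measure_ne_top _ _)

instance : IsProbabilityMeasure ((volume : Measure ℝ).restrict (Set.Ico 0 1)) :=
  ⟨by simp⟩

theorem measurable_smul_sphere :
    Measurable fun x : ℝ × Metric.sphere (0 : E d) 1 => x.1 • (x.2 : E d) :=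
  (continuous_fst.smul (continuous_subtype_val.comp continuous_snd)).measurable

instance : IsProbabilityMeasure (ballUniform d) :=
  Measure.isProbabilityMeasure_map measurable_smul_sphere.aemeasurable

theorem norm_le_one_ae_ballUniform : ∀ᵐ x ∂(ballUniform d), ‖x‖ ≤ 1 := by
  rw [ballUniform, ae_map_iff measurable_smul_sphere.aemeasurable
    (measurableSet_le measurable_norm measurable_const)]
  have h1 : ∀ᵐ ρ ∂((volume : Measure ℝ).restrict (Set.Ico 0 1)), ρ ∈ Set.Ico (0 : ℝ) 1 :=
    ae_restrict_mem measurableSet_Ico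
  filter_upwards [Measure.quasiMeasurePreserving_fst.ae h1] with x hx
  rw [norm_smul, norm_eq_of_mem_sphere, mul_one, Real.norm_of_nonneg hx.1]
  exact hx.2.le

instance : NullSingletonClass (ballUniform d) := by
  refine ⟨fun x => ?_⟩
  rw [ballUniform, Measure.map_apply measurable_smul_sphere (measurableSet_singleton x)]
  refine measure_mono_null (t := ({‖x‖, -‖x‖} : Set ℝ) ×ˢ Set.univ) ?_ ?_
  · rintro ⟨ρ, s⟩ h
    have h1 : ρ • (s : E d) = x := h
    have h2 : |ρ| = ‖x‖ := by
      rw [← h1, norm_smul, norm_eq_of_mem_sphere, mul_one, Real.norm_eq_abs]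
    refine ⟨?_, Set.mem_univ _⟩
    rcases abs_choice ρ with h3 | h3
    · left; rw [← h2, h3]
    · right; rw [Set.mem_singleton_iff, ← h2, h3, neg_neg]
  · rw [Measure.prod_prod, Set.Finite.measure_zero (by simp), zero_mul]

theorem infinite_support_ballUniform : (ballUniform d).support.Infinite := fun hfin => by
  have h1 : ballUniform d (ballUniform d).support = 0 := hfin.measure_zero _
  have h2 : ballUniform d (ballUniform d).supportᶜ = 0 := Measure.measure_compl_support
  have h3 : ballUniform d Set.univ = 0 := by
    rw [← Set.union_compl_self (ballUniform d).support]
    exact measure_union_null h1 h2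
  simp at h3

theorem norm_le_one_of_mem_support {x : E d} (hx : x ∈ (ballUniform d).support) : ‖x‖ ≤ 1 := by
  have h1 := Measure.support_subset_of_isClosed (μ := ballUniform d)
    (Metric.isClosed_closedBall (x := (0 : E d)) (ε := 1))
    (by filter_upwards [norm_le_one_ae_ballUniform (d := d)] with y hy; simpa using hy)
  simpa using h1 hx

theorem exists_close_mem_support {δ : ℝ} (hδ : 0 < δ) :
    ∃ u ∈ (ballUniform d).support, ∃ u' ∈ (ballUniform d).support, u ≠ u' ∧ dist u u' < δ := by
  obtain ⟨x, -, hx⟩ := infinite_support_ballUniform.exists_accPt_of_subset_isCompact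
    (isCompact_closedBall (0 : E d) 1)
    fun x hx => mem_closedBall_zero_iff.2 (norm_le_one_of_mem_support hx)
  rw [accPt_iff_nhds] at hx
  obtain ⟨u, ⟨hu, hus⟩, hux⟩ := hx _ (Metric.ball_mem_nhds x (half_pos hδ))
  obtain ⟨u', ⟨hu', hus'⟩, -⟩ := hx _ (Metric.ball_mem_nhds x (dist_pos.2 hux))
  refine ⟨u, hus, u', hus', ?_, ?_⟩
  · rintro rfl
    exact lt_irrefl _ (Metric.mem_ball.1 hu')
  · have h1 := Metric.mem_ball.1 hu
    have h2 := Metric.mem_ball.1 hu'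
    calc dist u u' ≤ dist u x + dist u' x := dist_triangle_right _ _ _
      _ < δ := by linarith

theorem integrable_norm_sub {μ : Measure (E d)} [IsProbabilityMeasure μ]
    (hμ : ∀ᵐ x ∂μ, ‖x‖ ≤ 1) (a : E d) : Integrable (fun y => ‖a - y‖) μ := by
  refine Integrable.of_bound (C := ‖a‖ + 1) (by fun_prop) ?_
  filter_upwards [hμ] with y hy
  rw [norm_norm]
  exact (norm_sub_le _ _).trans (by linarith)

theorem gramKernel_comm (μ : Measure (E d)) (x y : E d) : gramKernel μ x y = gramKernel μ y x := by
  simp only [gramKernel, centeredDist, norm_sub_rev]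
  ring

theorem abs_gramKernel_sub_le {μ : Measure (E d)} [IsProbabilityMeasure μ]
    (hμ : ∀ᵐ x ∂μ, ‖x‖ ≤ 1) (x x' z : E d) :
    |gramKernel μ x z - gramKernel μ x' z| ≤ 4 * dist x x' := by
  have h1 : |‖retract x - retract z‖ - ‖retract x' - retract z‖| ≤ ‖retract x - retract x'‖ := by
    refine (abs_norm_sub_norm_le _ _).trans_eq ?_
    congr 1
    abel
  have h2 : |(∫ y, ‖retract x - y‖ ∂μ) - ∫ y, ‖retract x' - y‖ ∂μ| ≤ ‖retract x - retract x'‖ := by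
    rw [← integral_sub (integrable_norm_sub hμ _) (integrable_norm_sub hμ _), ← Real.norm_eq_abs]
    refine (norm_integral_le_of_norm_le_const (C := ‖retract x - retract x'‖)
      (Eventually.of_forall fun y => ?_)).trans (by simp)
    refine (abs_norm_sub_norm_le _ _).trans_eq ?_
    congr 1
    abel
  have h3 := norm_retract_sub_le x x'
  rw [← dist_eq_norm x x'] at h3
  have e : gramKernel μ x z - gramKernel μ x' z
      = -(‖retract x - retract z‖ - ‖retract x' - retract z‖)
        + ((∫ y, ‖retract x - y‖ ∂μ) - ∫ y, ‖retract x' - y‖ ∂μ) := by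
    simp only [gramKernel, centeredDist]
    ring
  rw [e]
  refine (abs_add_le _ _).trans ?_
  rw [abs_neg]
  linarith

theorem exists_mem_support_gramKernel_ne_zero :
    ∃ v ∈ (ballUniform d).support, gramKernel (ballUniform d) v v ≠ 0 := by
  by_contra! hall
  set μ := ballUniform d
  have hμ : ∀ᵐ x ∂μ, ‖x‖ ≤ 1 := norm_le_one_ae_ballUniform
  have h1 : ∀ v ∈ μ.support, 2 * ∫ y, ‖v - y‖ ∂μ = ∫ y, ∫ y', ‖y - y'‖ ∂μ ∂μ := fun v hv => by
    have h2 := hall v hv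
    rw [gramKernel, retract_of_norm_le (norm_le_one_of_mem_support hv), centeredDist] at h2
    simp only [norm_sub_rev _ v, sub_self, norm_zero] at h2
    linarith
  have hs : ∀ᵐ v ∂μ, v ∈ μ.support := Measure.support_mem_ae
  have h3 : 2 * ∫ y, ∫ y', ‖y - y'‖ ∂μ ∂μ = ∫ y, ∫ y', ‖y - y'‖ ∂μ ∂μ := by
    rw [← integral_const_mul]
    have : ∫ v, 2 * ∫ y, ‖v - y‖ ∂μ ∂μ = ∫ _ : E d, ∫ y, ∫ y', ‖y - y'‖ ∂μ ∂μ ∂μ :=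
      integral_congr_ae (hs.mono h1)
    rw [this]
    simp
  obtain ⟨v, hv⟩ := infinite_support_ballUniform (d := d).nonempty
  have h4 : ∫ y, ‖v - y‖ ∂μ = 0 := by linarith [h1 v hv]
  rw [integral_eq_zero_iff_of_nonneg (fun y => norm_nonneg _) (integrable_norm_sub hμ v)] at h4
  have h5 : ∀ᵐ y ∂μ, y = v := by
    filter_upwards [h4] with y hy
    exact (sub_eq_zero.1 (norm_eq_zero.1 hy)).symm
  have h6 : μ {v}ᶜ = 0 := h5
  have h7 : μ Set.univ = 0 := by
    rw [← Set.union_compl_self {v}]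
    exact measure_union_null (measure_singleton v) h6
  simp [μ] at h7

end BallUniform

/-! ### The eigenvalues of the product kernel -/

section NullEigenvalues

set_option linter.unusedSectionVars false

theorem kernelEigenspace_congr {X : Type} [MeasurableSpace X] {μ : Measure X} {K K' : X → X → ℝ}
    {S : Set X} (hS : ∀ᵐ x ∂μ, x ∈ S) (h : ∀ x ∈ S, ∀ y ∈ S, K x y = K' x y) (c : ℝ) :
    kernelEigenspace μ K c = kernelEigenspace μ K' c := by
  ext φ
  change (∀ᵐ x ∂μ, Integrable (fun y => K x y * φ y) μ ∧ ∫ y, K x y * φ y ∂μ = c * φ x) ↔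
    ∀ᵐ x ∂μ, Integrable (fun y => K' x y * φ y) μ ∧ ∫ y, K' x y * φ y ∂μ = c * φ x
  refine eventually_congr (hS.mono fun x hx => ?_)
  have h1 : (fun y => K x y * φ y) =ᵐ[μ] fun y => K' x y * φ y :=
    hS.mono fun y hy => by simp only [h x hx y hy]
  rw [integrable_congr h1, integral_congr_ae h1]

variable {p q : ℕ}

/-- The product of the positive marginal kernels. -/
noncomputable def productKernel (p q : ℕ) (w w' : E p × E q) : ℝ :=
  gramKernel (ballUniform p) w.1 w'.1 * gramKernel (ballUniform q) w.2 w'.2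

variable [NeZero p] [NeZero q]

theorem isNullEigenvalueSequence_iff {ev : ℕ → ℝ} :
    IsNullEigenvalueSequence p q ev ↔
      IsNonzeroEigenvalueSequence ((ballUniform p).prod (ballUniform q)) (productKernel p q) ev := by
  unfold IsNullEigenvalueSequence IsNonzeroEigenvalueSequence
  have hS : ∀ᵐ w ∂((ballUniform p).prod (ballUniform q)),
      w ∈ {w : E p × E q | ‖w.1‖ ≤ 1 ∧ ‖w.2‖ ≤ 1} := by
    filter_upwards [Measure.quasiMeasurePreserving_fst.ae (norm_le_one_ae_ballUniform (d := p)),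
      Measure.quasiMeasurePreserving_snd.ae (norm_le_one_ae_ballUniform (d := q))] with w h1 h2
    exact ⟨h1, h2⟩
  have h : ∀ w ∈ {w : E p × E q | ‖w.1‖ ≤ 1 ∧ ‖w.2‖ ≤ 1},
      ∀ w' ∈ {w : E p × E q | ‖w.1‖ ≤ 1 ∧ ‖w.2‖ ≤ 1},
      centeredDist (ballUniform p) w.1 w'.1 * centeredDist (ballUniform q) w.2 w'.2
        = productKernel p q w w' := fun w hw w' hw' => by
    simp only [productKernel, gramKernel, retract_of_norm_le hw.1, retract_of_norm_le hw.2,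
      retract_of_norm_le hw'.1, retract_of_norm_le hw'.2, neg_mul_neg]
  rw [funext fun c => kernelEigenspace_congr hS h c]

theorem bddKernel_productKernel : BddKernel (productKernel p q) :=
  (bddKernel_gramKernel norm_le_one_ae_ballUniform).mul
    (bddKernel_gramKernel norm_le_one_ae_ballUniform)

/-- The features of the product kernel. -/
noncomputable def productFeature (p q : ℕ) [NeZero p] [NeZero q] (w : E p × E q)
    (y : (E p × ℝ) × (E q × ℝ)) : ℝ :=
  feature (ballUniform p) w.1 y.1 * feature (ballUniform q) w.2 y.2

theorem bddKernel_productFeature : BddKernel (productFeature p q) :=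
  bddKernel_feature.mul bddKernel_feature

theorem productKernel_eq_kcomp : productKernel p q
    = kcomp ((featureMeasure p).prod (featureMeasure q)) (productFeature p q)
      fun y w => productFeature p q w y := by
  ext w w'
  simp only [productKernel, gramKernel_eq_kcomp (norm_le_one_ae_ballUniform (d := p)),
    gramKernel_eq_kcomp (norm_le_one_ae_ballUniform (d := q)), kcomp, productFeature,
    ← integral_prod_mul]
  refine integral_congr_ae (Eventually.of_forall fun y => ?_)
  dsimp only
  ring

instance : MeasureTheory.IsSeparable ((ballUniform p).prod (ballUniform q)) :=
  have h (μ : Measure (E p × E q)) [SFinite μ] : MeasureTheory.IsSeparable μ := inferInstance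
  h _

/-- The eigenvalues are positive, with products of marginal traces as power sums. -/
theorem IsNullEigenvalueSequence.pos_and_hasSum {ev : ℕ → ℝ}
    (hev : IsNullEigenvalueSequence p q ev) :
    (∀ k, 0 < ev k) ∧ ∀ m, HasSum (fun k => ev k ^ (m + 1))
      (kernelTrace (ballUniform p) (gramKernel (ballUniform p)) m
        * kernelTrace (ballUniform q) (gramKernel (ballUniform q)) m) := by
  have h1 := (isNullEigenvalueSequence_iff.1 hev).pos_and_hasSum bddKernel_productFeature
    bddKernel_productKernel productKernel_eq_kcomp
  refine ⟨h1.1, fun m => ?_⟩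
  rw [← kernelTrace_prod]
  exact h1.2 m

theorem exists_abs_productKernel_sub_le : ∃ L, ∀ w w' z : E p × E q,
    |productKernel p q w z - productKernel p q w' z| ≤ L * dist w w' := by
  have hp := norm_le_one_ae_ballUniform (d := p)
  have hq := norm_le_one_ae_ballUniform (d := q)
  obtain ⟨C, hC⟩ := (bddKernel_gramKernel hp).2
  obtain ⟨D, hD⟩ := (bddKernel_gramKernel hq).2
  refine ⟨4 * D + 4 * C, fun w w' z => ?_⟩
  have h1 := (abs_gramKernel_sub_le hp w.1 w'.1 z.1).trans
    (mul_le_mul_of_nonneg_left (le_max_left _ (dist w.2 w'.2)) zero_le_four)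
  have h2 := (abs_gramKernel_sub_le hq w.2 w'.2 z.2).trans
    (mul_le_mul_of_nonneg_left (le_max_right (dist w.1 w'.1) _) zero_le_four)
  rw [← Prod.dist_eq] at h1 h2
  have e : productKernel p q w z - productKernel p q w' z
      = (gramKernel (ballUniform p) w.1 z.1 - gramKernel (ballUniform p) w'.1 z.1)
          * gramKernel (ballUniform q) w.2 z.2
        + gramKernel (ballUniform p) w'.1 z.1
          * (gramKernel (ballUniform q) w.2 z.2 - gramKernel (ballUniform q) w'.2 z.2) := by
    simp only [productKernel]
    ring
  rw [e, add_mul]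
  refine (abs_add_le _ _).trans ?_
  rw [abs_mul, abs_mul]
  have h3 := mul_le_mul h1 (hD w.2 z.2) (abs_nonneg _) (by positivity)
  have h4 := mul_le_mul (hC w'.1 z.1) h2 (abs_nonneg _) ((abs_nonneg _).trans (hC w'.1 z.1))
  linarith

theorem prodMk_mem_support {u : E p} {v : E q} (hu : u ∈ (ballUniform p).support)
    (hv : v ∈ (ballUniform q).support) :
    (u, v) ∈ ((ballUniform p).prod (ballUniform q)).support := by
  rw [Measure.mem_support_iff_forall] at hu hv ⊢
  intro U hU
  obtain ⟨A, hA, B, hB, hAB⟩ := mem_nhds_prod_iff.1 hU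
  refine lt_of_lt_of_le ?_ (measure_mono hAB)
  rw [Measure.prod_prod]
  exact ENNReal.mul_pos (hu A hA).ne' (hv B hB).ne'

theorem exists_isNullEigenvalueSequence (p q : ℕ) [NeZero p] [NeZero q] :
    ∃ ev, IsNullEigenvalueSequence p q ev := by
  have hK : BddKernel (productKernel p q) := bddKernel_productKernel
  have hKF := productKernel_eq_kcomp (p := p) (q := q)
  obtain ⟨ι, b, t, hb⟩ := exists_hilbertBasis_eigenvectors
    (intOp ((ballUniform p).prod (ballUniform q)) ((ballUniform p).prod (ballUniform q)) hK)
    (isCompactOperator_intOp hK) (intOp_self_adjoint hK (symm_of_eq_kcomp hKF))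
  have : Fact ((2 : ENNReal) ≠ ⊤) := ⟨ENNReal.ofNat_ne_top⟩
  have := countable_of_hilbertBasis b
  suffices hinf : {i | t i ≠ 0}.Infinite by
    obtain ⟨ev, hev⟩ := exists_eigenvalueSequence bddKernel_productFeature hK hKF hb hinf
    exact ⟨ev, isNullEigenvalueSequence_iff.2 hev⟩
  intro hfin
  obtain ⟨L, hL⟩ := exists_abs_productKernel_sub_le (p := p) (q := q)
  obtain ⟨C, hC⟩ := exists_le_mul_sq_dist_of_finite hK (symm_of_eq_kcomp hKF) hL hb hfin
  obtain ⟨v, hv, hv0⟩ := exists_mem_support_gramKernel_ne_zero (d := q)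
  have hvpos : 0 < gramKernel (ballUniform q) v v := by
    refine lt_of_le_of_ne ?_ hv0.symm
    rw [gramKernel_eq_kcomp norm_le_one_ae_ballUniform]
    exact integral_nonneg fun y => mul_self_nonneg _
  have hCp : 0 < |C| + 1 := by positivity
  obtain ⟨u, hu, u', hu', hne, hlt⟩ := exists_close_mem_support (d := p)
    (div_pos (mul_pos two_pos hvpos) hCp)
  have h1 := hC _ (prodMk_mem_support hu hv) _ (prodMk_mem_support hu' hv)
  have h2 : dist (u, v) (u', v) = dist u u' := by simp [Prod.dist_eq]
  have h3 : gramKernel (ballUniform p) u u - 2 * gramKernel (ballUniform p) u u'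
      + gramKernel (ballUniform p) u' u' = 2 * dist u u' := by
    have e : ∀ a, ∫ y, ‖y - a‖ ∂(ballUniform p) = ∫ y, ‖a - y‖ ∂(ballUniform p) := fun a => by
      simp only [norm_sub_rev]
    simp only [gramKernel, centeredDist, retract_of_norm_le (norm_le_one_of_mem_support hu),
      retract_of_norm_le (norm_le_one_of_mem_support hu'), sub_self, norm_zero, e, dist_eq_norm]
    ring
  have h4 : productKernel p q (u, v) (u, v) - 2 * productKernel p q (u, v) (u', v)
      + productKernel p q (u', v) (u', v) = 2 * dist u u' * gramKernel (ballUniform q) v v := by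
    rw [← h3]
    simp only [productKernel]
    ring
  rw [h4, h2] at h1
  have hd : 0 < dist u u' := dist_pos.2 hne
  rw [lt_div_iff₀ hCp] at hlt
  have h5 : C * dist u u' ^ 2 ≤ (|C| + 1) * dist u u' ^ 2 :=
    mul_le_mul_of_nonneg_right ((le_abs_self C).trans (by linarith)) (sq_nonneg _)
  nlinarith

end NullEigenvalues

/-! ### Empirical measures -/

section Empirical

variable {ι κ X Y : Type*} [Fintype ι] [Fintype κ] [MeasurableSpace X] [MeasurableSpace Y]

/-- The uniform discrete distribution on a finite family of points. -/
noncomputable def empirical (u : ι → X) : Measure X :=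
  (Fintype.card ι : ENNReal)⁻¹ • ∑ i, Measure.dirac (u i)

instance [Nonempty ι] (u : ι → X) : IsProbabilityMeasure (empirical u) := by
  refine ⟨?_⟩
  simp only [empirical, Measure.smul_apply, Measure.finsetSum_apply, measure_univ,
    Finset.sum_const, Finset.card_univ, nsmul_eq_mul, mul_one, smul_eq_mul]
  exact ENNReal.inv_mul_cancel (by simp) (by simp)

theorem integral_empirical [MeasurableSingletonClass X] (u : ι → X) (f : X → ℝ) :
    ∫ x, f x ∂(empirical u) = (Fintype.card ι : ℝ)⁻¹ * ∑ i, f (u i) := by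
  rw [empirical, integral_smul_measure, integral_finsetSum_measure fun i _ => by
    exact integrable_dirac (by simp)]
  simp

theorem map_empirical {f : X → Y} (hf : Measurable f) (u : ι → X) :
    (empirical u).map f = empirical (f ∘ u) := by
  ext s hs
  rw [Measure.map_apply hf hs]
  simp [empirical, Measure.dirac_apply', hs, hf hs, Set.indicator]
  rfl

theorem ae_empirical (u : ι → X) {p : X → Prop} (hp : MeasurableSet {x | p x})
    (h : ∀ i, p (u i)) : ∀ᵐ x ∂(empirical u), p x := by
  refine Measure.ae_smul_measure ?_ _
  rw [ae_iff, Measure.finsetSum_apply]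
  refine Finset.sum_eq_zero fun i _ => ?_
  rw [← ae_iff, ae_dirac_iff hp]
  exact h i

end Empirical

/-! ### Convergence of the grids -/

section Grid

theorem integral_comp_floor (n : ℕ) (hn : 0 < n) (g : ℕ → ℝ) :
    ∫ x in Set.Ico (0 : ℝ) 1, g ⌊n * x⌋₊ = (∑ j ∈ Finset.range n, g j) / n := by
  have hn' : (0 : ℝ) < n := by exact_mod_cast hn
  have h1 : ∀ j : ℕ, IntervalIntegrable (fun x : ℝ => g ⌊n * x⌋₊) volume (j / n) ((j + 1 : ℕ) / n)
      ∧ ∫ x in (j / n : ℝ)..((j + 1 : ℕ) / n), g ⌊n * x⌋₊ = g j / n := by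
    intro j
    have hle : (j / n : ℝ) ≤ ((j + 1 : ℕ) / n) := by
      gcongr
      exact Nat.le_succ j
    have h2 : Set.EqOn (fun x : ℝ => g ⌊n * x⌋₊) (fun _ => g j)
        (Set.Ioo (j / n : ℝ) ((j + 1 : ℕ) / n)) := by
      intro x hx
      have h3 : ⌊n * x⌋₊ = j := by
        rw [Nat.floor_eq_iff (mul_nonneg hn'.le ((by positivity : (0 : ℝ) ≤ j / n).trans hx.1.le))]
        have h4 := hx.1
        have h5 := hx.2
        rw [div_lt_iff₀ hn'] at h4
        rw [lt_div_iff₀ hn'] at h5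
        push_cast at h5
        constructor <;> linarith
      simp only [h3]
    constructor
    · rw [intervalIntegrable_iff_integrableOn_Ioo_of_le hle]
      exact (integrableOn_const (by simp)).congr_fun h2.symm measurableSet_Ioo
    · rw [intervalIntegral.integral_of_le hle, integral_Ioc_eq_integral_Ioo,
        setIntegral_congr_fun measurableSet_Ioo h2]
      simp only [integral_const, MeasurableSet.univ, measureReal_restrict_apply, Set.univ_inter,
        Real.volume_real_Ioo_of_le hle, smul_eq_mul]
      push_cast
      field_simp
      ring
  have h3 := intervalIntegral.sum_integral_adjacent_intervals (n := n) (a := fun j : ℕ => (j / n : ℝ))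
    (f := fun x : ℝ => g ⌊n * x⌋₊) (μ := volume) fun j _ => (h1 j).1
  simp only [fun j => (h1 j).2] at h3
  rw [← Finset.sum_div, Nat.cast_zero, zero_div, div_self hn'.ne',
    intervalIntegral.integral_of_le zero_le_one] at h3
  rw [h3, integral_Ico_eq_integral_Ioo, integral_Ioc_eq_integral_Ioo]

theorem tendsto_radial (f : ℝ →ᵇ ℝ) :
    Tendsto (fun a : ℕ => ∫ x, f x ∂(empirical fun j : Fin (a + 1) =>
      (((j : ℕ) + 1 : ℝ) / (((a + 1 : ℕ) : ℝ) + 1)))) atTop (𝓝 (∫ x in Set.Ico (0 : ℝ) 1, f x)) := by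
  have e : ∀ a : ℕ, ∫ x, f x ∂(empirical fun j : Fin (a + 1) =>
      (((j : ℕ) + 1 : ℝ) / (((a + 1 : ℕ) : ℝ) + 1)))
      = ∫ x in Set.Ico (0 : ℝ) 1, f ((⌊(a + 1 : ℕ) * x⌋₊ + 1 : ℝ) / (((a + 1 : ℕ) : ℝ) + 1)) := by
    intro a
    rw [integral_empirical, integral_comp_floor (a + 1) a.succ_pos
      fun j => f ((j + 1 : ℝ) / (((a + 1 : ℕ) : ℝ) + 1)), Fintype.card_fin,
      Finset.sum_range fun j : ℕ => f ((j + 1 : ℝ) / (((a + 1 : ℕ) : ℝ) + 1)), inv_mul_eq_div]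
  simp only [e]
  refine tendsto_integral_of_dominated_convergence (fun _ => ‖f‖) (fun a => ?_)
    (integrable_const _) (fun a => Eventually.of_forall fun x => f.norm_coe_le_norm _) ?_
  · refine (f.continuous.measurable.comp ?_).aestronglyMeasurable
    have : Measurable fun x : ℝ => ((⌊(a + 1 : ℕ) * x⌋₊ : ℕ) : ℝ) :=
      (measurable_from_nat (f := fun n : ℕ => (n : ℝ))).comp
        (Nat.measurable_floor.comp (measurable_id.const_mul _))
    exact (this.add_const 1).div_const _
  · refine (ae_restrict_mem measurableSet_Ico).mono fun x hx => ?_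
    refine (f.continuous.tendsto x).comp ?_
    rw [tendsto_iff_norm_sub_tendsto_zero]
    refine squeeze_zero (fun _ => norm_nonneg _) (g := fun a : ℕ => 1 / ((a : ℝ) + 1)) (fun a => ?_)
      tendsto_one_div_add_atTop_nhds_zero_nat
    have h1 := Nat.floor_le (mul_nonneg (Nat.cast_nonneg (α := ℝ) (a + 1)) hx.1)
    have h2 := Nat.lt_floor_add_one (((a + 1 : ℕ) : ℝ) * x)
    have ha : (0 : ℝ) < (a : ℝ) + 1 := by positivity
    have ha2 : (0 : ℝ) < ((a + 1 : ℕ) : ℝ) + 1 := by positivity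
    rw [div_sub' ha2.ne', norm_div, Real.norm_of_nonneg ha2.le, div_le_div_iff₀ ha2 ha, one_mul]
    have h3 : ‖(⌊((a + 1 : ℕ) : ℝ) * x⌋₊ : ℝ) + 1 - (((a + 1 : ℕ) : ℝ) + 1) * x‖ ≤ 1 := by
      rw [Real.norm_eq_abs, abs_le]
      constructor <;> nlinarith [hx.1, hx.2]
    push_cast at h3 ⊢
    nlinarith [norm_nonneg ((⌊((a : ℝ) + 1) * x⌋₊ : ℝ) + 1 - ((a : ℝ) + 1 + 1) * x)]

variable {d : ℕ}

/-- The retraction as a map to the closed unit ball. -/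
noncomputable def toBall (x : E d) : Metric.closedBall (0 : E d) 1 :=
  ⟨retract x, mem_closedBall_zero_iff.2 (norm_retract_le x)⟩

theorem continuous_toBall : Continuous (toBall (d := d)) :=
  continuous_retract.subtype_mk _

theorem map_map_toBall {μ : Measure (E d)} (hμ : ∀ᵐ x ∂μ, ‖x‖ ≤ 1) :
    (μ.map toBall).map Subtype.val = μ := by
  rw [Measure.map_map measurable_subtype_coe continuous_toBall.measurable]
  conv_rhs => rw [← Measure.map_id (μ := μ)]
  exact Measure.map_congr (hμ.mono fun x hx => retract_of_norm_le hx)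

/-- A probability measure pushed to the closed unit ball. -/
noncomputable def pushBall (μ : Measure (E d)) [IsProbabilityMeasure μ] :
    ProbabilityMeasure (Metric.closedBall (0 : E d) 1) :=
  ⟨μ.map toBall, Measure.isProbabilityMeasure_map continuous_toBall.measurable.aemeasurable⟩

theorem ballMeasure_pushBall {μ : Measure (E d)} [IsProbabilityMeasure μ]
    (hμ : ∀ᵐ x ∂μ, ‖x‖ ≤ 1) : ballMeasure (pushBall μ) = μ :=
  map_map_toBall hμ

variable {r : (S : ℕ) → Fin S → E d}

theorem norm_gridPoint_le (hr : IsDirectionArray d r) (MR MS : ℕ) (i : Fin MR × Fin MS) :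
    ‖gridPoint r MR MS i‖ ≤ 1 := by
  have h1 : ((i.1 : ℕ) + 1 : ℝ) ≤ (MR : ℝ) + 1 := by
    have := i.1.2.le
    have h2 : ((i.1 : ℕ) : ℝ) ≤ MR := by exact_mod_cast this
    linarith
  rw [gridPoint, norm_smul, hr.norm_eq_one, mul_one, Real.norm_of_nonneg (by positivity)]
  exact div_le_one_of_le₀ h1 (by positivity)

theorem norm_le_one_ae_empirical_gridPoint (hr : IsDirectionArray d r) (MR MS : ℕ) :
    ∀ᵐ x ∂(empirical (gridPoint r MR MS)), ‖x‖ ≤ 1 :=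
  ae_empirical _ (measurableSet_le measurable_norm measurable_const) (norm_gridPoint_le hr MR MS)

theorem tendsto_pushBall_grid [NeZero d] (hr : IsDirectionArray d r) :
    Tendsto (fun M : ℕ × ℕ => pushBall (empirical (gridPoint r (M.1 + 1) (M.2 + 1))))
      (atTop ×ˢ atTop) (𝓝 (pushBall (ballUniform d))) := by
  let U : ProbabilityMeasure ℝ := ⟨(volume : Measure ℝ).restrict (Set.Ico 0 1), inferInstance⟩
  let S : ProbabilityMeasure (E d) := ⟨(sphereUniform d).map Subtype.val,
    Measure.isProbabilityMeasure_map measurable_subtype_coe.aemeasurable⟩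
  let ρ : ℕ → ProbabilityMeasure ℝ := fun a => ⟨empirical fun j : Fin (a + 1) =>
      (((j : ℕ) + 1 : ℝ) / (((a + 1 : ℕ) : ℝ) + 1)), inferInstance⟩
  let σ : ℕ → ProbabilityMeasure (E d) := fun b => ⟨empirical (r (b + 1)), inferInstance⟩
  have hρ : Tendsto ρ atTop (𝓝 U) :=
    ProbabilityMeasure.tendsto_iff_forall_integral_tendsto.2 tendsto_radial
  have hσ : Tendsto σ atTop (𝓝 S) := by
    refine ProbabilityMeasure.tendsto_iff_forall_integral_tendsto.2 fun f => ?_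
    have h1 := (tendsto_add_atTop_iff_nat 1).2 (hr.tendsto_uniform f)
    have h2 : ∫ x, f x ∂(S : Measure (E d)) = ∫ x, f (x : E d) ∂(sphereUniform d) :=
      integral_map measurable_subtype_coe.aemeasurable f.continuous.aestronglyMeasurable
    rw [h2]
    refine h1.congr fun b => ?_
    change _ = ∫ x, f x ∂(empirical (r (b + 1)))
    rw [integral_empirical, Fintype.card_fin, inv_mul_eq_div]
  have hprod : Tendsto (fun M : ℕ × ℕ => (ρ M.1).prod (σ M.2)) (atTop ×ˢ atTop) (𝓝 (U.prod S)) :=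
    (ProbabilityMeasure.continuous_prod.tendsto (U, S)).comp
      ((hρ.comp tendsto_fst).prodMk_nhds (hσ.comp tendsto_snd))
  refine ProbabilityMeasure.tendsto_iff_forall_integral_tendsto.2 fun f => ?_
  let g : C(ℝ × E d, Metric.closedBall (0 : E d) 1) :=
    ⟨fun x => toBall (x.1 • x.2), continuous_toBall.comp (continuous_fst.smul continuous_snd)⟩
  have h1 := ProbabilityMeasure.tendsto_iff_forall_integral_tendsto.1 hprod (f.compContinuous g)
  have h2 : ∫ x, f x ∂(pushBall (ballUniform d) : Measure _)
      = ∫ x, f.compContinuous g x ∂((U.prod S : ProbabilityMeasure _) : Measure (ℝ × E d)) := by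
    change ∫ x, f x ∂((ballUniform d).map toBall)
      = ∫ x, f (toBall (x.1 • x.2)) ∂(((volume : Measure ℝ).restrict (Set.Ico 0 1)).prod
          ((sphereUniform d).map Subtype.val))
    have h3 : ((volume : Measure ℝ).restrict (Set.Ico 0 1)).prod ((sphereUniform d).map Subtype.val)
        = (((volume : Measure ℝ).restrict (Set.Ico 0 1)).prod (sphereUniform d)).map
          (Prod.map id Subtype.val) := by
      rw [← Measure.map_prod_map _ _ measurable_id measurable_subtype_coe, Measure.map_id]
    have hc : Continuous fun x : ℝ × E d => f (toBall (x.1 • x.2)) :=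
      f.continuous.comp (continuous_toBall.comp (continuous_fst.smul continuous_snd))
    rw [h3, integral_map (measurable_id.prodMap measurable_subtype_coe).aemeasurable
      hc.aestronglyMeasurable, integral_map continuous_toBall.measurable.aemeasurable
      f.continuous.aestronglyMeasurable, ballUniform,
      integral_map (f := fun x => f (toBall x)) measurable_smul_sphere.aemeasurable
      (f.continuous.comp continuous_toBall).aestronglyMeasurable]
    rfl
  rw [h2]
  refine h1.congr fun M => ?_
  change ∫ x, f (toBall (x.1 • x.2)) ∂((empirical fun j : Fin (M.1 + 1) =>
      (((j : ℕ) + 1 : ℝ) / (((M.1 + 1 : ℕ) : ℝ) + 1))).prod (empirical (r (M.2 + 1))))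
    = ∫ x, f x ∂((empirical (gridPoint r (M.1 + 1) (M.2 + 1))).map toBall)
  have hc : Continuous fun x : ℝ × E d => f (toBall (x.1 • x.2)) :=
    f.continuous.comp (continuous_toBall.comp (continuous_fst.smul continuous_snd))
  rw [integral_prod _ (Integrable.of_bound (C := ‖f‖) hc.aestronglyMeasurable
    (Eventually.of_forall fun x => f.norm_coe_le_norm _)),
    map_empirical continuous_toBall.measurable, integral_empirical, integral_empirical]
  simp only [integral_empirical, Fintype.card_prod, Fintype.card_fin, Fintype.sum_prod_type,
    ← Finset.mul_sum, Function.comp_apply, gridPoint]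
  push_cast
  rw [mul_inv, mul_assoc]

/-- The traces of the grids converge to those of the uniform law on the ball. -/
theorem tendsto_kernelTrace_grid [NeZero d] (hr : IsDirectionArray d r) (m : ℕ) :
    Tendsto (fun M : ℕ × ℕ => kernelTrace (empirical (gridPoint r (M.1 + 1) (M.2 + 1)))
      (gramKernel (empirical (gridPoint r (M.1 + 1) (M.2 + 1)))) m) (atTop ×ˢ atTop)
      (𝓝 (kernelTrace (ballUniform d) (gramKernel (ballUniform d)) m)) := by
  have h1 := ((continuous_kernelTrace_ballMeasure (d := d) m).tendsto _).comp
    (tendsto_pushBall_grid hr)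
  rw [ballMeasure_pushBall norm_le_one_ae_ballUniform] at h1
  refine h1.congr fun M => ?_
  simp only [Function.comp_apply,
    ballMeasure_pushBall (norm_le_one_ae_empirical_gridPoint hr (M.1 + 1) (M.2 + 1))]

end Grid

/-! ### The eigenvalues of the grid matrices -/

section Matrices

theorem sum_eigenvalues_pow {n : Type*} [Fintype n] [DecidableEq n] {A : Matrix n n ℝ}
    (hA : A.IsHermitian) (m : ℕ) : ∑ i, hA.eigenvalues i ^ m = (A ^ m).trace := by
  conv_rhs => rw [hA.spectral_theorem, ← map_pow, Unitary.conjStarAlgAut_apply,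
    Matrix.trace_mul_comm, ← mul_assoc]
  simp [Matrix.diagonal_pow, Matrix.trace_diagonal]

theorem double_centering_apply {n : Type*} [Fintype n] [DecidableEq n] (c : ℝ) (D : Matrix n n ℝ)
    (i j : n) :
    ((1 - c • (Matrix.of fun _ _ => 1 : Matrix n n ℝ)) * D
        * (1 - c • (Matrix.of fun _ _ => 1 : Matrix n n ℝ)) : Matrix n n ℝ) i j
      = D i j - c * ∑ k, D i k - c * ∑ k, D k j + c * ∑ k, c * ∑ l, D k l := by
  have h1 : ∀ (M : Matrix n n ℝ) k l, ((Matrix.of fun _ _ => 1 : Matrix n n ℝ) * M : Matrix n n ℝ) k l = ∑ a, M a l :=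
    fun M k l => by simp [Matrix.mul_apply]
  have h2 : ∀ (M : Matrix n n ℝ) k l, (M * (Matrix.of fun _ _ => 1 : Matrix n n ℝ) : Matrix n n ℝ) k l
      = ∑ a, M k a := fun M k l => by simp [Matrix.mul_apply]
  simp only [sub_mul, mul_sub, one_mul, mul_one, Matrix.sub_apply, Matrix.smul_apply, h1, h2,
    smul_mul_assoc, mul_smul_comm, smul_eq_mul]
  rw [Finset.sum_comm]
  simp only [Finset.mul_sum]
  ring

variable {d : ℕ} {r : (S : ℕ) → Fin S → E d}

theorem centeredMatrix_apply (hr : IsDirectionArray d r) (MR MS : ℕ) (i j : Fin MR × Fin MS) :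
    centeredMatrix r MR MS i j = -(((MR * MS : ℕ) : ℝ)⁻¹ *
      gramKernel (empirical (gridPoint r MR MS)) (gridPoint r MR MS i) (gridPoint r MR MS j)) := by
  simp only [gramKernel, retract_of_norm_le (norm_gridPoint_le hr MR MS _), centeredDist,
    integral_empirical, Fintype.card_prod, Fintype.card_fin]
  rw [centeredMatrix, centeringMatrix, Matrix.smul_apply, double_centering_apply]
  simp only [distMatrix, Matrix.of_apply, smul_eq_mul]
  ring

theorem centeredMatrix_pow_apply (hr : IsDirectionArray d r) (MR MS : ℕ) (m : ℕ)
    (i j : Fin MR × Fin MS) :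
    (centeredMatrix r MR MS ^ (m + 1)) i j = (-1) ^ (m + 1) * (((MR * MS : ℕ) : ℝ)⁻¹ *
      iterKernel (empirical (gridPoint r MR MS)) (gramKernel (empirical (gridPoint r MR MS))) m
        (gridPoint r MR MS i) (gridPoint r MR MS j)) := by
  induction m generalizing i with
  | zero =>
    rw [zero_add, pow_one, pow_one, centeredMatrix_apply hr, neg_one_mul]
    rfl
  | succ m ih =>
    rw [pow_succ', Matrix.mul_apply]
    simp only [ih, centeredMatrix_apply hr, iterKernel, kcomp, integral_empirical, Fintype.card_prod,
      Fintype.card_fin, Finset.mul_sum]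
    refine Finset.sum_congr rfl fun k _ => ?_
    ring

theorem isHermitian_centeredMatrix [NeZero d] (hr : IsDirectionArray d r) (MR MS : ℕ) :
    (centeredMatrix r MR MS).IsHermitian := by
  ext i j
  rw [Matrix.conjTranspose_apply, star_trivial, centeredMatrix_apply hr, centeredMatrix_apply hr,
    gramKernel_comm]

theorem sum_sum_gramKernel_nonneg [NeZero d] {μ : Measure (E d)} [IsProbabilityMeasure μ]
    (hμ : ∀ᵐ x ∂μ, ‖x‖ ≤ 1) {ι : Type*} [Fintype ι] (u : ι → E d) (a : ι → ℝ) :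
    0 ≤ ∑ i, ∑ j, a i * (gramKernel μ (u i) (u j) * a j) := by
  have h1 : ∑ i, ∑ j, a i * (gramKernel μ (u i) (u j) * a j)
      = ∫ y, (∑ i, a i * feature μ (u i) y) ^ 2 ∂(featureMeasure d) := by
    have h2 : ∀ i j, Integrable (fun y => a i * (feature μ (u i) y * feature μ (u j) y * a j))
        (featureMeasure d) := fun i j =>
      ((bddKernel_feature.integrable_mul bddKernel_feature.swap (u i) (u j)).mul_const _).const_mul _
    have h3 : ∀ y, (∑ i, a i * feature μ (u i) y) ^ 2
        = ∑ i, ∑ j, a i * (feature μ (u i) y * feature μ (u j) y * a j) := fun y => by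
      rw [sq, Finset.sum_mul_sum]
      refine Finset.sum_congr rfl fun i _ => Finset.sum_congr rfl fun j _ => ?_
      ring
    simp only [h3, gramKernel_eq_kcomp hμ, kcomp]
    rw [integral_finsetSum _ fun i _ => integrable_finsetSum _ fun j _ => h2 i j]
    refine Finset.sum_congr rfl fun i _ => ?_
    rw [integral_finsetSum _ fun j _ => h2 i j]
    refine Finset.sum_congr rfl fun j _ => ?_
    rw [integral_const_mul, integral_mul_const]
  rw [h1]
  exact integral_nonneg fun y => sq_nonneg _

theorem roots_centeredMatrix [NeZero d] (hr : IsDirectionArray d r) (MR MS : ℕ) :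
    (centeredMatrix r MR MS).charpoly.roots
      = Finset.univ.val.map (isHermitian_centeredMatrix hr MR MS).eigenvalues := by
  rw [(isHermitian_centeredMatrix hr MR MS).roots_charpoly_eq_eigenvalues]
  rfl

theorem eigenvalues_centeredMatrix_nonpos [NeZero d] (hr : IsDirectionArray d r) {MR MS : ℕ}
    (hR : 0 < MR) (hS : 0 < MS) (i : Fin MR × Fin MS) :
    (isHermitian_centeredMatrix hr MR MS).eigenvalues i ≤ 0 := by
  have : Nonempty (Fin MR × Fin MS) := ⟨i⟩
  rw [Matrix.IsHermitian.eigenvalues_eq]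
  set v := ⇑((isHermitian_centeredMatrix hr MR MS).eigenvectorBasis i)
  have h1 := sum_sum_gramKernel_nonneg (norm_le_one_ae_empirical_gridPoint hr MR MS)
    (gridPoint r MR MS) v
  have h2 : dotProduct (star v) ((centeredMatrix r MR MS).mulVec v)
      = -(((MR * MS : ℕ) : ℝ)⁻¹ * ∑ i, ∑ j, v i *
        (gramKernel (empirical (gridPoint r MR MS)) (gridPoint r MR MS i) (gridPoint r MR MS j)
          * v j)) := by
    simp only [dotProduct, Matrix.mulVec, Pi.star_apply, star_trivial, centeredMatrix_apply hr,
      Finset.mul_sum, ← Finset.sum_neg_distrib]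
    refine Finset.sum_congr rfl fun i _ => Finset.sum_congr rfl fun j _ => ?_
    ring
  rw [h2, RCLike.re_to_real, neg_nonpos]
  positivity

theorem zero_mem_roots_centeredMatrix {MR MS : ℕ} (hR : 0 < MR) (hS : 0 < MS) :
    (0 : ℝ) ∈ (centeredMatrix r MR MS).charpoly.roots := by
  have hN : ((MR * MS : ℕ) : ℝ) ≠ 0 := by exact_mod_cast (Nat.mul_pos hR hS).ne'
  have h1 : (centeringMatrix MR MS).mulVec (fun _ => (1 : ℝ)) = 0 := by
    ext i
    simp only [Matrix.mulVec, dotProduct, centeringMatrix, Matrix.sub_apply, Matrix.smul_apply,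
      Matrix.of_apply, smul_eq_mul, mul_one, Finset.sum_sub_distrib, Finset.sum_const,
      Finset.card_univ, Fintype.card_prod, Fintype.card_fin, nsmul_eq_mul, Matrix.one_apply,
      Finset.sum_ite_eq, Finset.mem_univ, if_true, mul_inv_cancel₀ hN, sub_self, Pi.zero_apply]
  have h2 : (centeredMatrix r MR MS).det = 0 := by
    refine Matrix.exists_mulVec_eq_zero_iff.1 ⟨fun _ => 1, ?_, ?_⟩
    · intro h
      exact one_ne_zero (congrFun h (⟨0, hR⟩, ⟨0, hS⟩))
    · rw [centeredMatrix, Matrix.smul_mulVec, ← Matrix.mulVec_mulVec, h1]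
      simp
  rw [Polynomial.mem_roots (Matrix.charpoly_monic _).ne_zero, Polynomial.IsRoot.def,
    Matrix.eval_charpoly]
  rw [map_zero, zero_sub, Matrix.det_neg, h2, mul_zero]

/-- The marginal eigenvalues of a grid in dimension `d ≥ 2`. -/
theorem gridEigenvalues_centered [NeZero d] (hd : d ≠ 1) (hr : IsDirectionArray d r) {MR MS : ℕ}
    (hR : 0 < MR) (hS : 0 < MS) :
    (∀ x ∈ gridEigenvalues r MR MS, x ≤ 0) ∧
      (gridEigenvalues r MR MS).card ≤ MR * MS - 1 ∧
      ∀ m : ℕ, ((gridEigenvalues r MR MS).map fun x => x ^ (m + 1)).sum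
        = (-1) ^ (m + 1) * kernelTrace (empirical (gridPoint r MR MS))
          (gramKernel (empirical (gridPoint r MR MS))) m := by
  simp only [gridEigenvalues, if_neg hd]
  refine ⟨fun x hx => ?_, ?_, fun m => ?_⟩
  · have h1 := Multiset.mem_of_mem_filter hx
    rw [roots_centeredMatrix hr] at h1
    obtain ⟨i, -, rfl⟩ := Multiset.mem_map.1 h1
    exact eigenvalues_centeredMatrix_nonpos hr hR hS i
  · have h1 : ((centeredMatrix r MR MS).charpoly.roots.filter fun x => x ≠ 0)
        < (centeredMatrix r MR MS).charpoly.roots := by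
      refine lt_of_le_of_ne (Multiset.filter_le _ _) fun h => ?_
      have h2 := zero_mem_roots_centeredMatrix (r := r) hR hS
      rw [← h] at h2
      exact (Multiset.mem_filter.1 h2).2 rfl
    have h2 := Multiset.card_lt_card h1
    have h3 : (centeredMatrix r MR MS).charpoly.roots.card = MR * MS := by
      rw [roots_centeredMatrix hr]
      simp
    omega
  · have h1 : (((centeredMatrix r MR MS).charpoly.roots.filter fun x => x ≠ 0).map
        fun x => x ^ (m + 1)).sum
        = ((centeredMatrix r MR MS).charpoly.roots.map fun x => x ^ (m + 1)).sum := by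
      conv_rhs => rw [← Multiset.filter_add_not (fun x : ℝ => x ≠ 0)
        (centeredMatrix r MR MS).charpoly.roots]
      rw [Multiset.map_add, Multiset.sum_add, left_eq_add]
      refine Multiset.sum_eq_zero fun y hy => ?_
      obtain ⟨x, hx, rfl⟩ := Multiset.mem_map.1 hy
      have h2 := (Multiset.mem_filter.1 hx).2
      rw [not_not] at h2
      rw [h2, zero_pow (Nat.succ_ne_zero m)]
    rw [h1, roots_centeredMatrix hr, Multiset.map_map]
    change ∑ i, (isHermitian_centeredMatrix hr MR MS).eigenvalues i ^ (m + 1) = _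
    rw [sum_eigenvalues_pow, Matrix.trace]
    simp only [Matrix.diag_apply, centeredMatrix_pow_apply hr, kernelTrace, integral_empirical,
      Fintype.card_prod, Fintype.card_fin, Finset.mul_sum]

end Matrices

/-! ### Kernels with an explicit orthonormal expansion -/

section Expansion

set_option linter.unusedSectionVars false

variable {X : Type} [MeasurableSpace X] {μ : Measure X} [IsProbabilityMeasure μ] {e : ℕ → X → ℝ}
  {κ : ℕ → ℝ} {C : ℝ}

/-- An orthonormal sequence of bounded functions. -/
structure BddOrthonormal (μ : Measure X) (e : ℕ → X → ℝ) (C : ℝ) : Prop where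
  measurable : ∀ j, Measurable (e j)
  bound : ∀ j x, |e j x| ≤ C
  integral_mul : ∀ i j, ∫ x, e i x * e j x ∂μ = if i = j then 1 else 0

theorem BddOrthonormal.nonneg (he : BddOrthonormal μ e C) (x : X) : 0 ≤ C :=
  (abs_nonneg _).trans (he.bound 0 x)

theorem BddOrthonormal.summable (he : BddOrthonormal μ e C) (hκ : ∀ j, 0 ≤ κ j)
    (hs : Summable κ) (x y : X) : Summable fun j => κ j * (e j x * e j y) := by
  refine Summable.of_norm_bounded (g := fun j => κ j * (C * C)) (hs.mul_right _) fun j => ?_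
  rw [norm_mul, norm_mul, Real.norm_of_nonneg (hκ j)]
  exact mul_le_mul_of_nonneg_left (mul_le_mul (he.bound j x) (he.bound j y) (norm_nonneg _)
    (he.nonneg x)) (hκ j)

theorem BddOrthonormal.hasSum_integral (he : BddOrthonormal μ e C) {c : ℕ → ℝ}
    (hc : Summable fun j => |c j|) {g : X → ℝ} (hg : Measurable g) {B : ℝ} (hB : ∀ x, |g x| ≤ B) :
    HasSum (fun j => c j * ∫ z, e j z * g z ∂μ) (∫ z, (∑' j, c j * e j z) * g z ∂μ) := by
  obtain ⟨x₀⟩ : Nonempty X := μ.nonempty_of_neZero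
  have hC := he.nonneg x₀
  have hb : ∀ j z, ‖c j * (e j z * g z)‖ ≤ |c j| * (C * B) := fun j z => by
    rw [norm_mul, norm_mul]
    exact mul_le_mul_of_nonneg_left (mul_le_mul (he.bound j z) (hB z) (norm_nonneg _) hC)
      (abs_nonneg _)
  have hint : ∀ j, Integrable (fun z => c j * (e j z * g z)) μ := fun j =>
    Integrable.of_bound (((he.measurable j).mul hg).const_mul _).aestronglyMeasurable _
      (Eventually.of_forall (hb j))
  have h1 := hasSum_integral_of_summable_integral_norm hint (by
    refine Summable.of_nonneg_of_le (fun j => integral_nonneg fun z => norm_nonneg _) (fun j => ?_)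
      (hc.mul_right (C * B))
    refine (integral_mono (hint j).norm (integrable_const _) (hb j)).trans ?_
    simp)
  simp only [integral_const_mul] at h1
  have h2 : ∫ z, (∑' j, c j * e j z) * g z ∂μ = ∫ z, ∑' j, c j * (e j z * g z) ∂μ := by
    refine integral_congr_ae (Eventually.of_forall fun z => ?_)
    dsimp only
    rw [← tsum_mul_right]
    exact tsum_congr fun j => by ring
  rwa [h2]

theorem BddOrthonormal.iterKernel_eq (he : BddOrthonormal μ e C) (hκ : ∀ j, 0 ≤ κ j)
    (hs : Summable κ) (hpow : ∀ m : ℕ, Summable fun j => κ j ^ (m + 1)) (m : ℕ) (x y : X) :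
    iterKernel μ (fun x y => ∑' j, κ j * (e j x * e j y)) m x y
      = ∑' j, κ j ^ (m + 1) * (e j x * e j y) := by
  induction m generalizing x y with
  | zero => simp [iterKernel]
  | succ m ih =>
    have hx : Summable fun j => |κ j * e j x| := by
      refine Summable.of_nonneg_of_le (fun j => abs_nonneg _) (fun j => ?_) (hs.mul_right C)
      rw [abs_mul, abs_of_nonneg (hκ j)]
      exact mul_le_mul_of_nonneg_left (he.bound j x) (hκ j)
    have hy : Summable fun j => |κ j ^ (m + 1) * e j y| := by
      refine Summable.of_nonneg_of_le (fun j => abs_nonneg _) (fun j => ?_) ((hpow m).mul_right C)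
      rw [abs_mul, abs_of_nonneg (pow_nonneg (hκ j) _)]
      exact mul_le_mul_of_nonneg_left (he.bound j y) (pow_nonneg (hκ j) _)
    have hmeas : Measurable fun z => ∑' j, κ j * e j x * e j z := by
      refine measurable_of_tendsto_metrizable (f := fun n z => ∑ j ∈ Finset.range n,
        κ j * e j x * e j z) (fun n => Finset.measurable_fun_sum _ fun j _ =>
          (he.measurable j).const_mul _) (tendsto_pi_nhds.2 fun z => ?_)
      have h4 := he.summable hκ hs x z
      simp only [← mul_assoc] at h4
      exact h4.hasSum.tendsto_sum_nat
    have hbound : ∀ z, |∑' j, κ j * e j x * e j z| ≤ (∑' j, |κ j * e j x|) * C := by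
      intro z
      rw [← tsum_mul_right, ← Real.norm_eq_abs]
      refine tsum_of_norm_bounded (hx.mul_right C).hasSum fun j => ?_
      rw [norm_mul]
      exact mul_le_mul_of_nonneg_left (he.bound j z) (abs_nonneg _)
    have h1 := (he.hasSum_integral (c := fun j => κ j ^ (m + 1) * e j y) hy hmeas hbound).tsum_eq
    have h2 : ∀ j, ∫ z, e j z * (∑' i, κ i * e i x * e i z) ∂μ = κ j * e j x := fun j => by
      have h3 := (he.hasSum_integral (c := fun j => κ j * e j x) hx (he.measurable j)
        (he.bound j)).tsum_eq
      simp only [he.integral_mul, mul_ite, mul_one, mul_zero, tsum_ite_eq] at h3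
      simp only [mul_comm (e j _)]
      exact h3.symm
    simp only [iterKernel, kcomp, ih]
    simp only [h2] at h1
    calc _ = ∫ z, (∑' j, κ j ^ (m + 1) * e j y * e j z) * ∑' j, κ j * e j x * e j z ∂μ := by
          refine integral_congr_ae (Eventually.of_forall fun z => ?_)
          dsimp only
          rw [mul_comm]
          congr 1 <;> refine tsum_congr fun j => by ring
      _ = _ := by
          rw [← h1]
          exact tsum_congr fun j => by ring

theorem BddOrthonormal.kernelTrace_eq (he : BddOrthonormal μ e C) (hκ : ∀ j, 0 ≤ κ j)
    (hs : Summable κ) (hpow : ∀ m : ℕ, Summable fun j => κ j ^ (m + 1)) {K : X → X → ℝ}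
    {S : Set X} (hS : ∀ᵐ x ∂μ, x ∈ S)
    (hK : ∀ x ∈ S, ∀ y ∈ S, HasSum (fun j => κ j * (e j x * e j y)) (K x y)) (m : ℕ) :
    kernelTrace μ K m = ∑' j, κ j ^ (m + 1) := by
  rw [kernelTrace_congr hS (fun x hx y hy => (hK x hx y hy).tsum_eq.symm) m, kernelTrace]
  simp only [he.iterKernel_eq hκ hs hpow]
  obtain ⟨x₀⟩ : Nonempty X := μ.nonempty_of_neZero
  have hb : ∀ j z, ‖κ j ^ (m + 1) * (e j z * e j z)‖ ≤ κ j ^ (m + 1) * (C * C) := fun j z => by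
    rw [norm_mul, norm_mul, Real.norm_of_nonneg (pow_nonneg (hκ j) _)]
    exact mul_le_mul_of_nonneg_left (mul_le_mul (he.bound j z) (he.bound j z) (norm_nonneg _)
      (he.nonneg x₀)) (pow_nonneg (hκ j) _)
  have hint : ∀ j, Integrable (fun z => κ j ^ (m + 1) * (e j z * e j z)) μ := fun j =>
    Integrable.of_bound (((he.measurable j).mul (he.measurable j)).const_mul _).aestronglyMeasurable
      _ (Eventually.of_forall (hb j))
  have h1 := hasSum_integral_of_summable_integral_norm hint (by
    refine Summable.of_nonneg_of_le (fun j => integral_nonneg fun z => norm_nonneg _) (fun j => ?_)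
      ((hpow m).mul_right (C * C))
    refine (integral_mono (hint j).norm (integrable_const _) (hb j)).trans ?_
    simp)
  simp only [integral_const_mul, he.integral_mul, if_true, mul_one] at h1
  exact h1.tsum_eq.symm

end Expansion

/-! ### The uniform law in dimension one -/

section Line

theorem norm_line (x : E 1) : ‖x‖ = |x 0| := by
  rw [EuclideanSpace.norm_eq]
  simp [Real.sqrt_sq_eq_abs]

/-- The line as a one-dimensional Euclidean space. -/
noncomputable abbrev ofLine (t : ℝ) : E 1 := EuclideanSpace.single 0 t

theorem smul_ofLine (ρ t : ℝ) : ρ • ofLine t = ofLine (ρ * t) := by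
  ext i
  fin_cases i
  simp [ofLine]

theorem ofLine_apply (x : E 1) : ofLine (x 0) = x := by
  ext i
  fin_cases i
  simp [ofLine]

theorem continuous_ofLine : Continuous ofLine := by
  have : ofLine = fun t : ℝ => t • ofLine 1 := by
    funext t
    rw [smul_ofLine, mul_one]
  rw [this]
  fun_prop

theorem integral_sphereUniform_one (g : E 1 → ℝ) :
    ∫ s, g (s : E 1) ∂(sphereUniform 1) = (g (ofLine 1) + g (ofLine (-1))) / 2 := by
  have hp : ofLine 1 ∈ Metric.sphere (0 : E 1) 1 := by simp
  have hn : ofLine (-1) ∈ Metric.sphere (0 : E 1) 1 := by simp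
  set a : Metric.sphere (0 : E 1) 1 := ⟨_, hp⟩ with ha
  set b : Metric.sphere (0 : E 1) 1 := ⟨_, hn⟩ with hb
  have huniv : (Set.univ : Set (Metric.sphere (0 : E 1) 1)) = {a} ∪ {b} := by
    refine (Set.eq_univ_of_forall fun s => ?_).symm
    have h1 : |(s : E 1) 0| = 1 := by rw [← norm_line]; exact norm_eq_of_mem_sphere s
    rcases eq_or_eq_neg_of_abs_eq h1 with h2 | h2
    · left
      rw [Set.mem_singleton_iff, Subtype.ext_iff, ha, ← ofLine_apply (s : E 1), h2]
    · right
      rw [Set.mem_singleton_iff, Subtype.ext_iff, hb, ← ofLine_apply (s : E 1), h2]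
  have hab : a ≠ b := by
    intro h
    have h1 := congrArg (fun s : Metric.sphere (0 : E 1) 1 => (s : E 1) 0) h
    simp [ha, hb] at h1
    norm_num at h1
  have hdis : Disjoint ({a} : Set (Metric.sphere (0 : E 1) 1)) {b} := by simpa using hab
  have hmeas : sphereUniform 1 {a} = sphereUniform 1 {b} := by
    simp only [sphereUniform, Measure.smul_apply]
    rw [Measure.toSphere_apply' _ (measurableSet_singleton a),
      Measure.toSphere_apply' _ (measurableSet_singleton b), ← Measure.measure_neg (volume : Measure (E 1))]
    congr 3
    simp only [Set.image_singleton]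
    ext z
    simp only [Set.mem_neg, Set.mem_smul, Set.mem_singleton_iff, exists_eq_left, ha, hb, smul_ofLine]
    refine exists_congr fun ρ => and_congr_right fun _ => ?_
    rw [← neg_eq_iff_eq_neg (a := ofLine _)]
    have : -ofLine (ρ * 1) = ofLine (ρ * -1) := by
      rw [← neg_one_smul ℝ, smul_ofLine]; ring_nf
    rw [this]
  have hr : (sphereUniform 1).real {a} = (sphereUniform 1).real {b} := by
    simp only [Measure.real, hmeas]
  have h1 : (sphereUniform 1).real {a} + (sphereUniform 1).real {b} = 1 := by
    rw [← measureReal_union hdis (measurableSet_singleton b), ← huniv, probReal_univ]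
  have hi : ∀ c : Metric.sphere (0 : E 1) 1,
      IntegrableOn (fun s : Metric.sphere (0 : E 1) 1 => g (s : E 1)) {c} (sphereUniform 1) :=
    fun c => by
      rw [IntegrableOn, Measure.restrict_singleton]
      exact (integrable_dirac (by simp)).smul_measure (by simp)
  rw [← setIntegral_univ, huniv, setIntegral_union hdis (measurableSet_singleton b) (hi a) (hi b),
    integral_singleton, integral_singleton, smul_eq_mul, smul_eq_mul]
  have h2 : (sphereUniform 1).real {b} = 1 / 2 := by linarith
  rw [hr, h2]
  ring

theorem integral_ballUniform_one {f : E 1 → ℝ} (hf : Continuous f) :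
    ∫ x, f x ∂(ballUniform 1) = (∫ t in (-1 : ℝ)..1, f (ofLine t)) / 2 := by
  have hg : Continuous fun t => f (ofLine t) := hf.comp continuous_ofLine
  obtain ⟨C, hC⟩ := (isCompact_closedBall (0 : E 1) 1).exists_bound_of_continuousOn hf.continuousOn
  have hint : Integrable (fun z : ℝ × Metric.sphere (0 : E 1) 1 => f (z.1 • (z.2 : E 1)))
      ((volume.restrict (Set.Ico 0 1)).prod (sphereUniform 1)) := by
    refine Integrable.of_bound (C := C)
      (hf.measurable.comp measurable_smul_sphere).aestronglyMeasurable ?_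
    have h1 := norm_le_one_ae_ballUniform (d := 1)
    rw [ballUniform, ae_map_iff measurable_smul_sphere.aemeasurable
      (measurableSet_le measurable_norm measurable_const)] at h1
    filter_upwards [h1] with z hz
    exact hC _ (by simpa using hz)
  rw [ballUniform, integral_map measurable_smul_sphere.aemeasurable
    hf.measurable.aestronglyMeasurable, integral_prod _ hint]
  have h2 : ∀ ρ : ℝ, ∫ s : Metric.sphere (0 : E 1) 1, f (ρ • (s : E 1)) ∂(sphereUniform 1)
      = (f (ofLine ρ) + f (ofLine (-ρ))) / 2 := fun ρ => by
    rw [integral_sphereUniform_one fun x => f (ρ • x)]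
    simp only [smul_ofLine, mul_one, mul_neg]
  have h3 : Continuous fun t => f (ofLine (-t)) := hg.comp continuous_neg
  simp only [h2]
  rw [integral_Ico_eq_integral_Ioc, ← intervalIntegral.integral_of_le zero_le_one,
    intervalIntegral.integral_div, intervalIntegral.integral_add (hg.intervalIntegrable _ _)
      (h3.intervalIntegrable _ _),
    intervalIntegral.integral_comp_neg fun t => f (ofLine t), neg_zero, add_comm,
    intervalIntegral.integral_add_adjacent_intervals (hg.intervalIntegrable _ _)
      (hg.intervalIntegrable _ _)]

/-- The cosine basis of the centered square-integrable functions on `[-1, 1]`. -/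
noncomputable def cosBasis (j : ℕ) (x : E 1) : ℝ :=
  √2 * Real.cos (((j : ℝ) + 1) * Real.pi * (x 0 + 1) / 2)

theorem continuous_cosBasis (j : ℕ) : Continuous (cosBasis j) := by
  unfold cosBasis
  fun_prop

theorem integral_cos_int_mul (n : ℤ) :
    ∫ t in (-1 : ℝ)..1, Real.cos (n * Real.pi * (t + 1) / 2) = if n = 0 then 2 else 0 := by
  split_ifs with h
  · subst h; norm_num
  · have hn : (n : ℝ) * Real.pi / 2 ≠ 0 := by positivity
    have h1 : ∀ t : ℝ, n * Real.pi * (t + 1) / 2 = n * Real.pi / 2 * t + n * Real.pi / 2 :=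
      fun t => by ring
    simp only [h1]
    rw [intervalIntegral.integral_comp_mul_add _ hn, integral_cos]
    have h2 : n * Real.pi / 2 * 1 + n * Real.pi / 2 = n * Real.pi := by ring
    have h3 : n * Real.pi / 2 * -1 + n * Real.pi / 2 = 0 := by ring
    rw [h2, h3, Real.sin_int_mul_pi]
    simp

theorem bddOrthonormal_cosBasis : BddOrthonormal (ballUniform 1) cosBasis √2 where
  measurable j := (continuous_cosBasis j).measurable
  bound j x := by
    rw [cosBasis, abs_mul, abs_of_nonneg (Real.sqrt_nonneg 2)]
    exact mul_le_of_le_one_right (Real.sqrt_nonneg 2) (Real.abs_cos_le_one _)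
  integral_mul i j := by
    rw [integral_ballUniform_one (f := fun x => cosBasis i x * cosBasis j x)
      ((continuous_cosBasis i).mul (continuous_cosBasis j))]
    have h1 : ∀ t : ℝ, cosBasis i (ofLine t) * cosBasis j (ofLine t)
        = Real.cos (((i : ℤ) - j : ℤ) * Real.pi * (t + 1) / 2)
          + Real.cos (((i : ℤ) + j + 2 : ℤ) * Real.pi * (t + 1) / 2) := fun t => by
      have h2 : ((i : ℤ) - j : ℤ) * Real.pi * (t + 1) / 2
          = ((i : ℝ) + 1) * Real.pi * (t + 1) / 2 - ((j : ℝ) + 1) * Real.pi * (t + 1) / 2 := by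
        push_cast; ring
      have h3 : ((i : ℤ) + j + 2 : ℤ) * Real.pi * (t + 1) / 2
          = ((i : ℝ) + 1) * Real.pi * (t + 1) / 2 + ((j : ℝ) + 1) * Real.pi * (t + 1) / 2 := by
        push_cast; ring
      have h4 : √2 * √2 = 2 := Real.mul_self_sqrt zero_le_two
      rw [h2, h3, Real.cos_sub, Real.cos_add]
      simp only [cosBasis, ofLine, PiLp.single_apply, if_true]
      linear_combination (Real.cos (((i : ℝ) + 1) * Real.pi * (t + 1) / 2) *
        Real.cos (((j : ℝ) + 1) * Real.pi * (t + 1) / 2)) * h4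
    simp only [h1]
    rw [intervalIntegral.integral_add (Continuous.intervalIntegrable (by fun_prop) _ _)
      (Continuous.intervalIntegrable (by fun_prop) _ _), integral_cos_int_mul, integral_cos_int_mul]
    have h5 : ((i : ℤ) + j + 2 : ℤ) ≠ 0 := by omega
    rw [if_neg h5]
    by_cases h : i = j
    · simp [h]
    · rw [if_neg (by omega), if_neg h]; simp

theorem integral_abs_sub_line {x : ℝ} (hx : |x| ≤ 1) :
    ∫ t in (-1 : ℝ)..1, |x - t| = x ^ 2 + 1 := by
  have hc : ∀ a b : ℝ, IntervalIntegrable (fun t => |x - t|) volume a b := fun a b =>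
    Continuous.intervalIntegrable (by fun_prop) _ _
  obtain ⟨h1, h2⟩ := abs_le.1 hx
  rw [← intervalIntegral.integral_add_adjacent_intervals (hc (-1) x) (hc x 1)]
  have h3 : ∫ t in (-1 : ℝ)..x, |x - t| = ∫ t in (-1 : ℝ)..x, (x - t) :=
    intervalIntegral.integral_congr fun t ht => by
      rw [Set.uIcc_of_le h1] at ht
      exact abs_of_nonneg (by linarith [ht.2])
  have h4 : ∫ t in x..(1 : ℝ), |x - t| = ∫ t in x..(1 : ℝ), (t - x) :=
    intervalIntegral.integral_congr fun t ht => by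
      rw [Set.uIcc_of_le h2] at ht
      have h5 : |x - t| = -(x - t) := abs_of_nonpos (by linarith [ht.1])
      exact h5.trans (neg_sub x t)
  rw [h3, h4, intervalIntegral.integral_sub (by simp) (by simp),
    intervalIntegral.integral_sub (by simp) (by simp)]
  simp only [integral_id, intervalIntegral.integral_const, smul_eq_mul]
  ring

theorem gramKernel_ballUniform_one {x y : E 1} (hx : ‖x‖ ≤ 1) (hy : ‖y‖ ≤ 1) :
    gramKernel (ballUniform 1) x y = -|x 0 - y 0| + (x 0 ^ 2 + y 0 ^ 2) / 2 + 1 / 3 := by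
  have h1 : ∀ z : E 1, ‖z‖ ≤ 1 → ∫ w, ‖z - w‖ ∂(ballUniform 1) = (z 0 ^ 2 + 1) / 2 := fun z hz => by
    rw [integral_ballUniform_one (by fun_prop)]
    simp only [norm_line, PiLp.sub_apply, ofLine, PiLp.single_apply, if_true]
    rw [integral_abs_sub_line (by rwa [← norm_line])]
  have h2 : ∫ z, ∫ w, ‖z - w‖ ∂(ballUniform 1) ∂(ballUniform 1) = 2 / 3 := by
    have h3 : ∫ z, ∫ w, ‖z - w‖ ∂(ballUniform 1) ∂(ballUniform 1)
        = ∫ z : E 1, (z 0 ^ 2 + 1) / 2 ∂(ballUniform 1) := by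
      refine integral_congr_ae ?_
      filter_upwards [norm_le_one_ae_ballUniform (d := 1)] with z hz
      exact h1 z hz
    rw [h3, integral_ballUniform_one (by fun_prop)]
    simp only [ofLine, PiLp.single_apply, if_true]
    rw [intervalIntegral.integral_div, intervalIntegral.integral_add
      (Continuous.intervalIntegrable (by fun_prop) _ _)
      (Continuous.intervalIntegrable (by fun_prop) _ _)]
    simp
    norm_num
  rw [gramKernel, retract_of_norm_le hx, retract_of_norm_le hy, centeredDist]
  simp only [norm_sub_rev _ y]
  rw [h1 x hx, h1 y hy, norm_sub_rev y x, h2, norm_line, PiLp.sub_apply]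
  ring

/-- The absolute values of the marginal eigenvalues in dimension one. -/
noncomputable def lineEigenvalue (j : ℕ) : ℝ := 4 / (Real.pi ^ 2 * ((j : ℝ) + 1) ^ 2)

theorem hasSum_cos_div_sq {t : ℝ} (ht : t ∈ Set.Icc (0 : ℝ) 1) :
    HasSum (fun j => lineEigenvalue j * Real.cos (2 * Real.pi * ((j : ℝ) + 1) * t))
      (4 * (t ^ 2 - t + 6⁻¹)) := by
  have h1 := hasSum_one_div_nat_pow_mul_cos one_ne_zero ht
  have h2 := bernoulliFun_two t
  rw [bernoulliFun] at h2
  rw [mul_one, h2, ← hasSum_nat_add_iff' 1] at h1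
  have h3 := h1.mul_left (4 / Real.pi ^ 2)
  have e1 : 4 / Real.pi ^ 2 * ((-1 : ℝ) ^ (1 + 1) * (2 * Real.pi) ^ 2 / 2 / (Nat.factorial 2) *
      (t ^ 2 - t + 6⁻¹) - ∑ i ∈ Finset.range 1, 1 / (i : ℝ) ^ 2 * Real.cos (2 * Real.pi * i * t))
      = 4 * (t ^ 2 - t + 6⁻¹) := by
    have := Real.pi_ne_zero
    simp
    field_simp
  rw [e1] at h3
  have e2 : (fun j => lineEigenvalue j * Real.cos (2 * Real.pi * ((j : ℝ) + 1) * t)) =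
      fun j : ℕ => 4 / Real.pi ^ 2 * (1 / ((j + 1 : ℕ) : ℝ) ^ 2 *
        Real.cos (2 * Real.pi * ((j + 1 : ℕ) : ℝ) * t)) := by
    funext j
    push_cast
    rw [lineEigenvalue]
    field_simp
  rwa [e2]

theorem hasSum_gramKernel_ballUniform_one {x y : E 1} (hx : ‖x‖ ≤ 1) (hy : ‖y‖ ≤ 1) :
    HasSum (fun j => lineEigenvalue j * (cosBasis j x * cosBasis j y))
      (gramKernel (ballUniform 1) x y) := by
  rw [gramKernel_ballUniform_one hx hy]
  rw [norm_line] at hx hy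
  obtain ⟨hx1, hx2⟩ := abs_le.1 hx
  obtain ⟨hy1, hy2⟩ := abs_le.1 hy
  have h1 := hasSum_cos_div_sq (t := |x 0 - y 0| / 4) ⟨by positivity, by
    have : |x 0 - y 0| ≤ 2 := abs_le.2 ⟨by linarith, by linarith⟩
    linarith⟩
  have h2 := hasSum_cos_div_sq (t := (x 0 + y 0 + 2) / 4) ⟨by linarith, by linarith⟩
  have h3 := h1.add h2
  have e1 : 4 * ((|x 0 - y 0| / 4) ^ 2 - |x 0 - y 0| / 4 + 6⁻¹) +
      4 * (((x 0 + y 0 + 2) / 4) ^ 2 - (x 0 + y 0 + 2) / 4 + 6⁻¹)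
      = -|x 0 - y 0| + (x 0 ^ 2 + y 0 ^ 2) / 2 + 1 / 3 := by
    rw [div_pow, sq_abs]
    ring
  rw [e1] at h3
  have e2 : (fun j => lineEigenvalue j * (cosBasis j x * cosBasis j y)) = fun j : ℕ =>
      lineEigenvalue j * Real.cos (2 * Real.pi * ((j : ℝ) + 1) * (|x 0 - y 0| / 4)) +
      lineEigenvalue j * Real.cos (2 * Real.pi * ((j : ℝ) + 1) * ((x 0 + y 0 + 2) / 4)) := by
    funext j
    have h4 : Real.cos (2 * Real.pi * ((j : ℝ) + 1) * (|x 0 - y 0| / 4))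
        = Real.cos (2 * Real.pi * ((j : ℝ) + 1) * ((x 0 - y 0) / 4)) := by
      rcases abs_choice (x 0 - y 0) with h | h
      · rw [h]
      · rw [h, neg_div, mul_neg, Real.cos_neg]
    have h5 : 2 * Real.pi * ((j : ℝ) + 1) * ((x 0 - y 0) / 4)
        = ((j : ℝ) + 1) * Real.pi * (x 0 + 1) / 2 - ((j : ℝ) + 1) * Real.pi * (y 0 + 1) / 2 := by
      ring
    have h6 : 2 * Real.pi * ((j : ℝ) + 1) * ((x 0 + y 0 + 2) / 4)
        = ((j : ℝ) + 1) * Real.pi * (x 0 + 1) / 2 + ((j : ℝ) + 1) * Real.pi * (y 0 + 1) / 2 := by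
      ring
    have h7 : √2 * √2 = 2 := Real.mul_self_sqrt zero_le_two
    rw [h4, h5, h6, Real.cos_sub, Real.cos_add, cosBasis, cosBasis]
    linear_combination (lineEigenvalue j * Real.cos (((j : ℝ) + 1) * Real.pi * (x 0 + 1) / 2) *
      Real.cos (((j : ℝ) + 1) * Real.pi * (y 0 + 1) / 2)) * h7
  rwa [e2]

theorem lineEigenvalue_nonneg (j : ℕ) : 0 ≤ lineEigenvalue j := by
  unfold lineEigenvalue
  positivity

theorem summable_lineEigenvalue_pow (m : ℕ) : Summable fun j => lineEigenvalue j ^ (m + 1) := by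
  have h1 : Summable lineEigenvalue := by
    have := (hasSum_cos_div_sq (t := 0) (by simp)).summable
    simpa using this
  have h2 : ∀ j, lineEigenvalue j ≤ 1 := fun j => by
    rw [lineEigenvalue, div_le_one (by positivity)]
    nlinarith [Real.pi_gt_three, sq_nonneg (j : ℝ), (Nat.cast_nonneg j : (0 : ℝ) ≤ j),
      mul_nonneg (sq_nonneg Real.pi) (Nat.cast_nonneg j : (0 : ℝ) ≤ j),
      mul_nonneg (sq_nonneg Real.pi) (sq_nonneg (j : ℝ))]
  exact Summable.of_nonneg_of_le (fun j => pow_nonneg (lineEigenvalue_nonneg j) _)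
    (fun j => pow_le_of_le_one (lineEigenvalue_nonneg j) (h2 j) m.succ_ne_zero) h1

theorem kernelTrace_ballUniform_one (m : ℕ) :
    kernelTrace (ballUniform 1) (gramKernel (ballUniform 1)) m
      = ∑' j, lineEigenvalue j ^ (m + 1) := by
  refine bddOrthonormal_cosBasis.kernelTrace_eq lineEigenvalue_nonneg
    (by simpa using summable_lineEigenvalue_pow 0) summable_lineEigenvalue_pow
    (S := {x | ‖x‖ ≤ 1}) norm_le_one_ae_ballUniform (fun x hx y hy => ?_) m
  exact hasSum_gramKernel_ballUniform_one hx hy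

end Line

/-! ### The weights of the approximating quadratic forms -/

section Weights

theorem gridEigenvalues_nonpos {d : ℕ} [NeZero d] {r : (S : ℕ) → Fin S → E d}
    (hr : 2 ≤ d → IsDirectionArray d r) {MR MS : ℕ} (hR : 0 < MR) (hS : 0 < MS) :
    (∀ x ∈ gridEigenvalues r MR MS, x ≤ 0) ∧ (gridEigenvalues r MR MS).card ≤ MR * MS - 1 := by
  have hd0 := NeZero.ne d
  by_cases hd : d = 1
  · rw [gridEigenvalues, if_pos hd]
    refine ⟨fun x hx => ?_, by simp⟩
    obtain ⟨j, -, rfl⟩ := Multiset.mem_map.1 hx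
    exact div_nonpos_of_nonpos_of_nonneg (by norm_num) (by positivity)
  · obtain ⟨h1, h2, -⟩ := gridEigenvalues_centered hd (hr (by omega)) hR hS
    exact ⟨h1, h2⟩

theorem tendsto_sum_gridEigenvalues_pow {d : ℕ} [NeZero d] {r : (S : ℕ) → Fin S → E d}
    (hr : 2 ≤ d → IsDirectionArray d r) (m : ℕ) :
    Tendsto (fun M : ℕ × ℕ => (-1) ^ (m + 1) *
        ((gridEigenvalues r (M.1 + 1) (M.2 + 1)).map fun x => x ^ (m + 1)).sum) (atTop ×ˢ atTop)
      (𝓝 (kernelTrace (ballUniform d) (gramKernel (ballUniform d)) m)) := by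
  have hd0 := NeZero.ne d
  have hsq : ((-1 : ℝ) ^ (m + 1)) * (-1) ^ (m + 1) = 1 := by
    rw [← mul_pow]; simp
  by_cases hd : d = 1
  · subst hd
    rw [kernelTrace_ballUniform_one]
    have h1 := (summable_lineEigenvalue_pow m).hasSum.tendsto_sum_nat
    have h2 : Tendsto (fun M : ℕ × ℕ => (M.1 + 1) * (M.2 + 1) - 1) (atTop ×ˢ atTop) atTop := by
      refine tendsto_atTop_mono (fun M => ?_) tendsto_fst
      have : M.1 + 1 ≤ (M.1 + 1) * (M.2 + 1) := Nat.le_mul_of_pos_right _ M.2.succ_pos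
      omega
    refine (h1.comp h2).congr fun M => ?_
    rw [gridEigenvalues, if_pos rfl, Multiset.map_map, ← Multiset.sum_map_mul_left,
      Function.comp_apply, Finset.sum, Finset.range_val]
    simp only [Multiset.bind_def, Multiset.pure_def, Multiset.bind_singleton, Multiset.map_map]
    congr 1
    refine Multiset.map_congr rfl fun j _ => ?_
    have h3 : -4 / (Real.pi ^ 2 * ((j : ℝ) + 1) ^ 2) = -1 * lineEigenvalue j := by
      rw [lineEigenvalue]; ring
    simp only [Function.comp_apply]
    rw [h3, mul_pow, ← mul_assoc, hsq, one_mul]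
  · refine (tendsto_kernelTrace_grid (hr (by omega)) m).congr fun M => ?_
    rw [(gridEigenvalues_centered hd (hr (by omega)) M.1.succ_pos M.2.succ_pos).2.2 m, ← mul_assoc,
      hsq, one_mul]

theorem sum_range_getD (L : List ℝ) (f : ℝ → ℝ) :
    ∑ k ∈ Finset.range L.length, f (L.getD k 0) = (L.map f).sum := by
  induction L with
  | nil => simp
  | cons a L ih =>
    rw [List.length_cons, Finset.sum_range_succ', List.map_cons, List.sum_cons, ← ih, add_comm]
    simp

theorem antitone_getD {L : List ℝ} (hL : L.Pairwise (· ≥ ·)) (h0 : ∀ x ∈ L, 0 ≤ x) :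
    Antitone fun k => L.getD k 0 := by
  intro i j hij
  dsimp only
  rcases lt_or_ge j L.length with h | h
  · rw [List.getD_eq_getElem _ _ h, List.getD_eq_getElem _ _ (hij.trans_lt h)]
    rcases hij.eq_or_lt with rfl | h'
    · exact le_rfl
    · exact List.pairwise_iff_getElem.1 hL i j _ h h'
  · rw [List.getD_eq_default _ _ h]
    rcases lt_or_ge i L.length with h' | h'
    · rw [List.getD_eq_getElem _ _ h']
      exact h0 _ (List.getElem_mem h')
    · rw [List.getD_eq_default _ _ h']

theorem sum_map_product_mul_pow (s t : Multiset ℝ) (m : ℕ) :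
    ((s ×ˢ t).map fun x => (x.1 * x.2) ^ m).sum
      = (s.map fun x => x ^ m).sum * (t.map fun x => x ^ m).sum := by
  induction s using Multiset.induction_on with
  | empty => simp
  | cons a s ih =>
    rw [Multiset.cons_product, Multiset.map_add, Multiset.sum_add, ih, Multiset.map_map,
      Multiset.map_cons, Multiset.sum_cons, add_mul, ← Multiset.sum_map_mul_left (a := a ^ m)]
    simp only [Function.comp_def, mul_pow]

set_option linter.unusedSectionVars false

variable {p q : ℕ} [NeZero p] [NeZero q] {r : (S : ℕ) → Fin S → E p} {s : (S : ℕ) → Fin S → E q}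

theorem sortedProducts_nonneg (hr : 2 ≤ p → IsDirectionArray p r)
    (hs : 2 ≤ q → IsDirectionArray q s) {MR MS : ℕ} (hR : 0 < MR) (hS : 0 < MS) :
    ∀ x ∈ sortedProducts r s MR MS, 0 ≤ x := by
  intro x hx
  rw [sortedProducts, Multiset.mem_sort, Multiset.mem_map] at hx
  obtain ⟨y, hy, rfl⟩ := hx
  rw [Multiset.mem_product] at hy
  exact mul_nonneg_of_nonpos_of_nonpos ((gridEigenvalues_nonpos hr hR hS).1 _ hy.1)
    ((gridEigenvalues_nonpos hs hR hS).1 _ hy.2)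

theorem antitone_gridWeight (hr : 2 ≤ p → IsDirectionArray p r)
    (hs : 2 ≤ q → IsDirectionArray q s) {MR MS : ℕ} (hR : 0 < MR) (hS : 0 < MS) :
    Antitone (gridWeight r s MR MS) :=
  antitone_getD (Multiset.pairwise_sort _ _) (sortedProducts_nonneg hr hs hR hS)

theorem gridWeight_nonneg (hr : 2 ≤ p → IsDirectionArray p r)
    (hs : 2 ≤ q → IsDirectionArray q s) {MR MS : ℕ} (hR : 0 < MR) (hS : 0 < MS) (k : ℕ) :
    0 ≤ gridWeight r s MR MS k := by
  rw [gridWeight]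
  rcases lt_or_ge k (sortedProducts r s MR MS).length with h | h
  · rw [List.getD_eq_getElem _ _ h]
    exact sortedProducts_nonneg hr hs hR hS _ (List.getElem_mem h)
  · rw [List.getD_eq_default _ _ h]

theorem gridWeight_eq_zero {MR MS k : ℕ} (hk : (sortedProducts r s MR MS).length ≤ k) :
    gridWeight r s MR MS k = 0 :=
  List.getD_eq_default _ _ hk

theorem length_sortedProducts_le (hr : 2 ≤ p → IsDirectionArray p r)
    (hs : 2 ≤ q → IsDirectionArray q s) {MR MS : ℕ} (hR : 0 < MR) (hS : 0 < MS) :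
    (sortedProducts r s MR MS).length ≤ (MR * MS - 1) ^ 2 := by
  rw [sortedProducts, Multiset.length_sort, Multiset.card_map, Multiset.card_product, sq]
  exact Nat.mul_le_mul (gridEigenvalues_nonpos hr hR hS).2 (gridEigenvalues_nonpos hs hR hS).2

theorem summable_gridWeight (MR MS : ℕ) : Summable (gridWeight r s MR MS) :=
  summable_of_ne_finset_zero (s := Finset.range (sortedProducts r s MR MS).length) fun k hk =>
    gridWeight_eq_zero (by simpa using hk)

theorem tsum_gridWeight_pow (MR MS m : ℕ) :
    ∑' k, gridWeight r s MR MS k ^ (m + 1)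
      = ((gridEigenvalues r MR MS).map fun x => x ^ (m + 1)).sum *
        ((gridEigenvalues s MR MS).map fun x => x ^ (m + 1)).sum := by
  rw [tsum_eq_sum (s := Finset.range (sortedProducts r s MR MS).length) fun k hk => by
    rw [gridWeight_eq_zero (by simpa using hk), zero_pow m.succ_ne_zero]]
  rw [← sum_map_product_mul_pow]
  refine (sum_range_getD (sortedProducts r s MR MS) fun x => x ^ (m + 1)).trans ?_
  rw [← Multiset.sum_coe, ← Multiset.map_coe, sortedProducts, Multiset.sort_eq, Multiset.map_map]
  rfl

theorem tendsto_tsum_abs_gridWeight_sub (hr : 2 ≤ p → IsDirectionArray p r)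
    (hs : 2 ≤ q → IsDirectionArray q s) {ev : ℕ → ℝ} (hev : IsNullEigenvalueSequence p q ev)
    {σ : ℕ ≃ ℕ} (hσ : Antitone (ev ∘ σ)) :
    Tendsto (fun M : ℕ × ℕ => ∑' k, |gridWeight r s (M.1 + 1) (M.2 + 1) k - ev (σ k)|)
      (atTop ×ˢ atTop) (𝓝 0) := by
  obtain ⟨hpos, hsum⟩ := hev.pos_and_hasSum
  have hsum' : ∀ m, HasSum (fun k => (ev ∘ σ) k ^ (m + 1))
      (kernelTrace (ballUniform p) (gramKernel (ballUniform p)) m *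
        kernelTrace (ballUniform q) (gramKernel (ballUniform q)) m) := fun m =>
    (Equiv.hasSum_iff σ).2 (hsum m)
  refine tendsto_tsum_abs_sub_of_tendsto_powerSum (a := ev ∘ σ)
    (fun M => antitone_gridWeight hr hs M.1.succ_pos M.2.succ_pos)
    (fun M => gridWeight_nonneg hr hs M.1.succ_pos M.2.succ_pos)
    (fun M => summable_gridWeight _ _) hσ (fun k => (hpos _).le)
    (by simpa [Function.comp_def] using (hsum' 0).summable) fun m => ?_
  rw [(hsum' m).tsum_eq]
  refine ((tendsto_sum_gridEigenvalues_pow hr m).mul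
    (tendsto_sum_gridEigenvalues_pow hs m)).congr fun M => ?_
  rw [tsum_gridWeight_pow, mul_mul_mul_comm, ← mul_pow]
  simp

end Weights

/-! ### Convergence of quantiles -/

section Quantile

variable {Ω : Type*} [MeasurableSpace Ω] {P : Measure Ω} {Z : Ω → ℝ} {u x : ℝ}

theorem quantile_comp {X : Type*} [MeasurableSpace X] {ν : Measure X} {f : Ω → X}
    (hf : HasLaw f ν P) {g : X → ℝ} (hg : Measurable g) :
    quantile P (fun ω => g (f ω)) u = quantile ν g u := by
  have h1 : ∀ x, P.real {ω | g (f ω) ≤ x} = ν.real {z | g z ≤ x} := fun x =>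
    hf.measureReal_eq (p := fun z => g z ≤ x) (measurableSet_le hg measurable_const)
  simp only [quantile, h1]

variable [IsProbabilityMeasure P]

theorem measureReal_le_eq_cdf (hZ : Measurable Z) (x : ℝ) :
    P.real {ω | Z ω ≤ x} = cdf (P.map Z) x := by
  have := Measure.isProbabilityMeasure_map (μ := P) hZ.aemeasurable
  rw [cdf_eq_real, map_measureReal_apply hZ measurableSet_Iic]
  rfl

theorem bddBelow_quantile (hZ : Measurable Z) (hu : 0 < u) :
    BddBelow {x : ℝ | u ≤ P.real {ω | Z ω ≤ x}} := by
  obtain ⟨b, hb⟩ := ((tendsto_cdf_atBot (P.map Z)).eventually (gt_mem_nhds hu)).exists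
  refine ⟨b, fun x hx => ?_⟩
  rw [Set.mem_ofPred_eq, measureReal_le_eq_cdf hZ] at hx
  by_contra! h
  exact absurd ((monotone_cdf (P.map Z) h.le).trans_lt hb) (not_lt.2 hx)

theorem nonempty_quantile (hZ : Measurable Z) (hu : u < 1) :
    {x : ℝ | u ≤ P.real {ω | Z ω ≤ x}}.Nonempty := by
  obtain ⟨b, hb⟩ := ((tendsto_cdf_atTop (P.map Z)).eventually (lt_mem_nhds hu)).exists
  refine ⟨b, ?_⟩
  rw [Set.mem_ofPred_eq, measureReal_le_eq_cdf hZ]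
  exact hb.le

theorem quantile_le (hZ : Measurable Z) (hu : 0 < u) (hx : u ≤ P.real {ω | Z ω ≤ x}) :
    quantile P Z u ≤ x :=
  csInf_le (bddBelow_quantile hZ hu) hx

theorem le_quantile (hZ : Measurable Z) (hu : u < 1) (hx : P.real {ω | Z ω ≤ x} < u) :
    x ≤ quantile P Z u := by
  refine le_csInf (nonempty_quantile hZ hu) fun y hy => ?_
  by_contra! h
  exact absurd (lt_of_le_of_lt (measureReal_mono fun ω hω => le_trans hω h.le) hx) (not_lt.2 hy)

theorem measureReal_le_lt_of_lt_quantile (hZ : Measurable Z) (hu : 0 < u)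
    (hx : x < quantile P Z u) : P.real {ω | Z ω ≤ x} < u := by
  by_contra! h
  exact absurd (quantile_le hZ hu h) (not_le.2 hx)

theorem le_measureReal_of_quantile_lt (hZ : Measurable Z) (hu : u < 1)
    (hx : quantile P Z u < x) : u ≤ P.real {ω | Z ω ≤ x} := by
  obtain ⟨y, hy, hyx⟩ := exists_lt_of_csInf_lt (nonempty_quantile hZ hu) hx
  exact le_trans hy (measureReal_mono fun ω hω => le_trans hω hyx.le)

theorem tendsto_quantile {ι : Type*} {l : Filter ι} {Zs : ι → Ω → ℝ} (hZs : ∀ n, Measurable (Zs n))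
    (hZ : Measurable Z)
    (h : ∀ δ > 0, Tendsto (fun n => P.real {ω | δ ≤ |Zs n ω - Z ω|}) l (𝓝 0))
    (hu0 : 0 < u) (hu1 : u < 1) (hinc : ∀ x, quantile P Z u < x → u < P.real {ω | Z ω ≤ x}) :
    Tendsto (fun n => quantile P (Zs n) u) l (𝓝 (quantile P Z u)) := by
  set Q := quantile P Z u with hQ
  have key : ∀ {Y Y' : Ω → ℝ} {x δ : ℝ}, P.real {ω | Y ω ≤ x}
      ≤ P.real {ω | Y' ω ≤ x + δ} + P.real {ω | δ ≤ |Y' ω - Y ω|} := fun {Y Y' x δ} => by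
    refine (measureReal_mono fun ω hω => ?_).trans (measureReal_union_le _ _)
    by_cases h1 : Y' ω ≤ x + δ
    · exact Or.inl h1
    · right
      have h2 : Y ω ≤ x := hω
      have h3 := le_abs_self (Y' ω - Y ω)
      change δ ≤ |Y' ω - Y ω|
      linarith
  rw [Metric.tendsto_nhds]
  intro ε hε
  have h1 : P.real {ω | Z ω ≤ Q - ε / 4} < u :=
    measureReal_le_lt_of_lt_quantile hZ hu0 (by linarith)
  have h2 : u < P.real {ω | Z ω ≤ Q + ε / 4} := hinc _ (by linarith)
  have h3 := (h (ε / 4) (by linarith)).eventually (gt_mem_nhds (sub_pos.2 h1))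
  have h4 := (h (ε / 4) (by linarith)).eventually (gt_mem_nhds (sub_pos.2 h2))
  filter_upwards [h3, h4] with n h3 h4
  have h5 : Q - ε / 2 ≤ quantile P (Zs n) u := by
    refine le_quantile (hZs n) hu1 ?_
    have h6 := key (Y := Zs n) (Y' := Z) (x := Q - ε / 2) (δ := ε / 4)
    simp only [abs_sub_comm (Z _)] at h6
    have h7 : Q - ε / 2 + ε / 4 = Q - ε / 4 := by ring
    rw [h7] at h6
    linarith
  have h8 : quantile P (Zs n) u ≤ Q + ε / 2 := by
    refine quantile_le (hZs n) hu0 ?_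
    have h6 := key (Y := Z) (Y' := Zs n) (x := Q + ε / 4) (δ := ε / 4)
    have h7 : Q + ε / 4 + ε / 4 = Q + ε / 2 := by ring
    rw [h7] at h6
    linarith
  rw [Real.dist_eq, abs_lt]
  constructor <;> linarith

end Quantile

/-! ### Quadratic forms of independent Gaussian variables -/

section QuadraticForm

/-- The law of a sequence of independent standard Gaussian variables. -/
noncomputable abbrev gaussianSeq : Measure (ℕ → ℝ) := Measure.infinitePi fun _ => gaussianReal 0 1

/-- The centered diagonal quadratic form with coefficients `c`. -/
noncomputable def quadForm (c z : ℕ → ℝ) : ℝ := ∑' k, c k * (z k ^ 2 - 1)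

theorem measurable_quadForm (c : ℕ → ℝ) : Measurable (quadForm c) :=
  Measurable.tsum (by fun_prop)

theorem lintegral_enorm_sq_sub_one_le :
    ∫⁻ x, ‖x ^ 2 - 1‖ₑ ∂(gaussianReal 0 1) ≤ 2 := by
  have h1 : MemLp id 2 (gaussianReal 0 1) := by exact_mod_cast memLp_id_gaussianReal 2
  have h2 : Integrable (fun x : ℝ => x ^ 2) (gaussianReal 0 1) := h1.integrable_sq
  have h3 : ∫ x, x ^ 2 ∂(gaussianReal 0 1) = 1 := by
    have h4 := variance_id_gaussianReal (μ := 0) (v := 1)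
    rw [variance_of_integral_eq_zero aemeasurable_id (by simp [integral_id_gaussianReal])] at h4
    simpa using h4
  have h5 : Integrable (fun x : ℝ => x ^ 2 - 1) (gaussianReal 0 1) := h2.sub (integrable_const _)
  rw [← ofReal_integral_norm_eq_lintegral_enorm h5]
  have h6 : ∫ x, ‖x ^ 2 - 1‖ ∂(gaussianReal 0 1) ≤ 2 := by
    calc _ ≤ ∫ x, (x ^ 2 + 1) ∂(gaussianReal 0 1) := by
          refine integral_mono h5.norm (h2.add (integrable_const _)) fun x => ?_
          refine (norm_sub_le _ _).trans ?_
          rw [norm_one, Real.norm_of_nonneg (sq_nonneg x)]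
      _ = 2 := by
          rw [integral_add h2 (integrable_const _), h3]
          norm_num
  exact (ENNReal.ofReal_le_ofReal h6).trans (by simp)

theorem lintegral_tsum_enorm_le (c : ℕ → ℝ) :
    ∫⁻ z, ∑' k, ‖c k * (z k ^ 2 - 1)‖ₑ ∂gaussianSeq ≤ 2 * ∑' k, ‖c k‖ₑ := by
  rw [lintegral_tsum fun k => Measurable.aemeasurable (by fun_prop), ← ENNReal.tsum_mul_left]
  refine ENNReal.tsum_le_tsum fun k => ?_
  simp only [enorm_mul]
  rw [lintegral_const_mul _ (by fun_prop), mul_comm]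
  gcongr
  have h1 := (measurePreserving_eval_infinitePi (fun _ : ℕ => gaussianReal 0 1) k).lintegral_comp
    (f := fun x : ℝ => ‖x ^ 2 - 1‖ₑ) (by fun_prop)
  exact h1.trans_le lintegral_enorm_sq_sub_one_le

theorem ae_summable_quadForm {c : ℕ → ℝ} (hc : Summable fun k => |c k|) :
    ∀ᵐ z ∂gaussianSeq, Summable fun k => c k * (z k ^ 2 - 1) := by
  have h1 : ∑' k, ‖c k‖ₑ ≠ ⊤ := by
    have := hc.tsum_ofReal_ne_top
    simpa only [Real.enorm_eq_ofReal_abs] using this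
  have h2 : ∀ᵐ z ∂gaussianSeq, ∑' k, ‖c k * (z k ^ 2 - 1)‖ₑ < ⊤ :=
    ae_lt_top (Measurable.tsum (by fun_prop))
      (ne_top_of_le_ne_top (ENNReal.mul_ne_top (by simp) h1) (lintegral_tsum_enorm_le c))
  filter_upwards [h2] with z hz
  exact Summable.of_enorm hz.ne

theorem measureReal_le_abs_quadForm {c : ℕ → ℝ} (hc : Summable fun k => |c k|) {δ : ℝ}
    (hδ : 0 < δ) : gaussianSeq.real {z | δ ≤ |quadForm c z|} ≤ 2 * (∑' k, |c k|) / δ := by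
  have h1 : gaussianSeq {z | ENNReal.ofReal δ ≤ ‖quadForm c z‖ₑ}
      ≤ (2 * ∑' k, ‖c k‖ₑ) / ENNReal.ofReal δ := by
    refine (meas_ge_le_lintegral_div (measurable_quadForm c).enorm.aemeasurable
      (by simpa using hδ) (by simp)).trans ?_
    gcongr
    exact (lintegral_mono fun z => enorm_tsum_le_tsum_enorm).trans (lintegral_tsum_enorm_le c)
  have h2 : {z | ENNReal.ofReal δ ≤ ‖quadForm c z‖ₑ} = {z | δ ≤ |quadForm c z|} := by
    ext z
    simp only [Set.mem_ofPred_eq, Real.enorm_eq_ofReal_abs]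
    exact ENNReal.ofReal_le_ofReal_iff (abs_nonneg _)
  have h3 : ∑' k, ‖c k‖ₑ = ENNReal.ofReal (∑' k, |c k|) := by
    rw [ENNReal.ofReal_tsum_of_nonneg (fun k => abs_nonneg _) hc]
    simp only [Real.enorm_eq_ofReal_abs]
  rw [h2, h3] at h1
  have h4 : (2 * ENNReal.ofReal (∑' k, |c k|)) / ENNReal.ofReal δ
      = ENNReal.ofReal (2 * (∑' k, |c k|) / δ) := by
    rw [ENNReal.ofReal_div_of_pos hδ, ENNReal.ofReal_mul zero_le_two]
    simp
  rw [h4] at h1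
  exact ENNReal.toReal_le_of_le_ofReal
    (div_nonneg (mul_nonneg zero_le_two (tsum_nonneg fun k => abs_nonneg _)) hδ.le) h1

theorem quadForm_sub_ae {w a : ℕ → ℝ} (hw : Summable fun k => |w k|)
    (ha : Summable fun k => |a k|) :
    ∀ᵐ z ∂gaussianSeq, quadForm w z - quadForm a z = quadForm (fun k => w k - a k) z := by
  filter_upwards [ae_summable_quadForm hw, ae_summable_quadForm ha] with z h1 h2
  rw [quadForm, quadForm, quadForm, ← h1.tsum_sub h2]
  exact tsum_congr fun k => by ring

theorem map_shift_gaussianSeq :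
    gaussianSeq.map (fun z => (fun k => z (k + 1), z 0)) = gaussianSeq.prod (gaussianReal 0 1) := by
  have hi : iIndepFun (fun (k : ℕ) (z : ℕ → ℝ) => z k) gaussianSeq :=
    iIndepFun_infinitePi (X := fun _ x => x) fun _ => measurable_id
  have h1 : IndepFun (fun (z : ℕ → ℝ) k => z (k + 1)) (fun z => z 0) gaussianSeq := by
    have h2 := indep_iSup_of_disjoint (fun k : ℕ => (measurable_pi_apply k).comap_le) hi.iIndep
      (S := {0}ᶜ) (T := {0}) (by simp)
    refine indep_of_indep_of_le_left (indep_of_indep_of_le_right h2 ?_) ?_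
    · simp
    · rw [MeasurableSpace.pi, MeasurableSpace.comap_iSup]
      refine iSup_le fun k => ?_
      rw [MeasurableSpace.comap_comp]
      exact le_iSup₂_of_le (k + 1) (by simp) le_rfl
  rw [h1.map_prod_eq_prod_map_map (Measurable.aemeasurable (by fun_prop))
    (Measurable.aemeasurable (by fun_prop))]
  congr 1
  · exact Measure.map_infinitePi_infinitePi_of_inj (P := fun _ : ℕ => gaussianReal 0 1)
      (add_left_injective 1)
  · exact Measure.infinitePi_map_eval _ 0

theorem measureReal_quadForm_lt {a : ℕ → ℝ} (ha : Summable fun k => |a k|) (ha0 : 0 < a 0)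
    {y x : ℝ} (hyx : y < x) (hy : 0 < gaussianSeq.real {z | quadForm a z ≤ y}) :
    gaussianSeq.real {z | quadForm a z ≤ y} < gaussianSeq.real {z | quadForm a z ≤ x} := by
  refine lt_of_le_of_ne (measureReal_mono fun z hz => le_trans hz hyx.le) fun heq => ?_
  have hmeas : Measurable fun z : ℕ → ℝ => (fun k => z (k + 1), z 0) := by fun_prop
  have hsplit : ∀ᵐ z ∂gaussianSeq, quadForm a z
      = a 0 * (z 0 ^ 2 - 1) + quadForm (fun k => a (k + 1)) fun k => z (k + 1) := by
    filter_upwards [ae_summable_quadForm ha] with z hz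
    exact hz.tsum_eq_zero_add
  have h1 : ∀ᵐ z ∂gaussianSeq, ¬(y < quadForm a z ∧ quadForm a z ≤ x) := by
    have h2 : {z | y < quadForm a z ∧ quadForm a z ≤ x}
        = {z | quadForm a z ≤ x} \ {z | quadForm a z ≤ y} := by
      ext z
      simp [and_comm]
    have h3 : gaussianSeq.real {z | y < quadForm a z ∧ quadForm a z ≤ x} = 0 := by
      have hsub : {z | quadForm a z ≤ y} ⊆ {z | quadForm a z ≤ x} := fun z hz => le_trans hz hyx.le
      rw [h2, measureReal_sdiff hsub
        (measurableSet_le (measurable_quadForm a) measurable_const), heq, sub_self]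
    rw [measureReal_eq_zero_iff] at h3
    rw [ae_iff]
    simpa only [not_not] using h3
  have h4 : ∀ᵐ v ∂(gaussianSeq.prod (gaussianReal 0 1)),
      ¬(y < a 0 * (v.2 ^ 2 - 1) + quadForm (fun k => a (k + 1)) v.1 ∧
        a 0 * (v.2 ^ 2 - 1) + quadForm (fun k => a (k + 1)) v.1 ≤ x) := by
    have hm : Measurable fun v : (ℕ → ℝ) × ℝ =>
        a 0 * (v.2 ^ 2 - 1) + quadForm (fun k => a (k + 1)) v.1 :=
      ((measurable_snd.pow_const 2).sub_const 1).const_mul _ |>.add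
        ((measurable_quadForm _).comp measurable_fst)
    rw [← map_shift_gaussianSeq]
    refine (ae_map_iff hmeas.aemeasurable ((measurableSet_lt measurable_const hm).inter
      (measurableSet_le hm measurable_const)).compl).2 ?_
    filter_upwards [h1, hsplit] with z hz hz'
    rw [hz'] at hz
    exact hz
  have h5 : ∀ᵐ w ∂gaussianSeq, y + a 0 < quadForm (fun k => a (k + 1)) w := by
    filter_upwards [Measure.ae_ae_of_ae_prod h4] with w hw
    by_contra! hle
    set b := quadForm (fun k => a (k + 1)) w
    have hcont : Continuous fun t : ℝ => a 0 * (t ^ 2 - 1) + b := by fun_prop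
    have hopen : IsOpen {t : ℝ | y < a 0 * (t ^ 2 - 1) + b ∧ a 0 * (t ^ 2 - 1) + b < x} :=
      (isOpen_lt continuous_const hcont).inter (isOpen_lt hcont continuous_const)
    have hne : {t : ℝ | y < a 0 * (t ^ 2 - 1) + b ∧ a 0 * (t ^ 2 - 1) + b < x}.Nonempty := by
      refine ⟨√(((y + x) / 2 - b + a 0) / a 0), ?_⟩
      rw [Set.mem_ofPred_eq, Real.sq_sqrt (div_nonneg (by linarith) ha0.le)]
      have h6 : a 0 * (((y + x) / 2 - b + a 0) / a 0 - 1) + b = (y + x) / 2 := by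
        field_simp
        ring
      rw [h6]
      constructor <;> linarith
    have h7 : gaussianReal 0 1 {t : ℝ | y < a 0 * (t ^ 2 - 1) + b ∧ a 0 * (t ^ 2 - 1) + b < x}
        = 0 := by
      rw [ae_iff] at hw
      refine measure_mono_null (fun t ht => ?_) hw
      exact not_not.2 ⟨ht.1, ht.2.le⟩
    exact (hopen.measure_pos volume hne).ne'
      (gaussianReal_absolutelyContinuous' 0 one_ne_zero h7)
  have h6 : ∀ᵐ z ∂gaussianSeq, y + a 0 < quadForm (fun k => a (k + 1)) fun k => z (k + 1) := by
    have hmp : MeasurePreserving (fun (z : ℕ → ℝ) k => z (k + 1)) gaussianSeq gaussianSeq :=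
      ⟨by fun_prop, Measure.map_infinitePi_infinitePi_of_inj (P := fun _ : ℕ => gaussianReal 0 1)
        (add_left_injective 1)⟩
    exact hmp.quasiMeasurePreserving.ae h5
  have h8 : ∀ᵐ z ∂gaussianSeq, ¬quadForm a z ≤ y := by
    filter_upwards [h6, hsplit] with z hz hz'
    rw [hz']
    have := mul_nonneg ha0.le (sq_nonneg (z 0))
    push Not
    linarith
  have h9 : gaussianSeq.real {z | quadForm a z ≤ y} = 0 := by
    rw [ae_iff] at h8
    simp only [not_not] at h8
    rw [measureReal_def, h8, ENNReal.toReal_zero]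
  exact hy.ne' h9

theorem tendsto_quantile_quadForm {ι : Type*} {l : Filter ι} {w : ι → ℕ → ℝ} {a : ℕ → ℝ}
    (hw : ∀ n, Summable fun k => |w n k|) (ha : Summable fun k => |a k|) (ha0 : 0 < a 0)
    (h : Tendsto (fun n => ∑' k, |w n k - a k|) l (𝓝 0)) {u : ℝ} (hu0 : 0 < u) (hu1 : u < 1) :
    Tendsto (fun n => quantile gaussianSeq (quadForm (w n)) u) l
      (𝓝 (quantile gaussianSeq (quadForm a) u)) := by
  refine tendsto_quantile (fun n => measurable_quadForm _) (measurable_quadForm _) (fun δ hδ => ?_)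
    hu0 hu1 fun x hx => ?_
  · have h1 : Tendsto (fun n => 2 * (∑' k, |w n k - a k|) / δ) l (𝓝 0) := by
      have := (h.const_mul 2).div_const δ
      simpa using this
    refine squeeze_zero (fun n => measureReal_nonneg) (fun n => ?_) h1
    have hs : Summable fun k => |w n k - a k| :=
      (Summable.abs ((summable_abs_iff.1 (hw n)).sub (summable_abs_iff.1 ha)))
    refine le_trans (le_of_eq ?_) (measureReal_le_abs_quadForm hs hδ)
    refine measureReal_congr ?_
    filter_upwards [quadForm_sub_ae (hw n) ha] with z hz
    exact propext (by
      change δ ≤ |quadForm (w n) z - quadForm a z| ↔ δ ≤ |quadForm (fun k => w n k - a k) z|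
      rw [hz])
  · have h1 := le_measureReal_of_quantile_lt (measurable_quadForm a) hu1
      (show quantile gaussianSeq (quadForm a) u < (quantile gaussianSeq (quadForm a) u + x) / 2 by
        linarith)
    exact h1.trans_lt (measureReal_quadForm_lt ha ha0 (by linarith) (hu0.trans_le h1))

end QuadraticForm

section Main

theorem gridForm_eq_quadForm {Ω : Type*} {ξ : ℕ → Ω → ℝ} {p q : ℕ} [NeZero p] [NeZero q] {r : (S : ℕ) → Fin S → E p}
    {s : (S : ℕ) → Fin S → E q} (hr : 2 ≤ p → IsDirectionArray p r)
    (hs : 2 ≤ q → IsDirectionArray q s) {MR MS : ℕ} (hR : 0 < MR) (hS : 0 < MS) :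
    gridForm r s ξ MR MS = fun ω => quadForm (gridWeight r s MR MS) fun k => ξ k ω := by
  funext ω
  rw [gridForm, quadForm, tsum_eq_sum fun k hk => ?_]
  rw [gridWeight_eq_zero ((length_sortedProducts_le hr hs hR hS).trans (by simpa using hk)),
    zero_mul]

variable {Ω : Type*} [MeasurableSpace Ω] {P : Measure Ω} {ξ : ℕ → Ω → ℝ}

theorem hasLaw_gaussianSeq (hξ : ∀ k, HasLaw (ξ k) (gaussianReal 0 1) P) (hindep : iIndepFun ξ P) :
    HasLaw (fun ω k => ξ k ω) gaussianSeq P :=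
  hindep.hasLaw_infinitePi hξ (aemeasurable_pi_iff.2 fun k => (hξ k).aemeasurable)

theorem quantile_limitForm (hξ : ∀ k, HasLaw (ξ k) (gaussianReal 0 1) P) (hindep : iIndepFun ξ P)
    (ev : ℕ → ℝ) (σ : ℕ ≃ ℕ) (u : ℝ) :
    quantile P (limitForm ev ξ) u = quantile gaussianSeq (quadForm (ev ∘ σ)) u := by
  have h1 : limitForm ev ξ = fun ω => quadForm (ev ∘ σ) fun k => ξ (σ k) ω := by
    funext ω
    exact (σ.tsum_eq fun k => ev k * (ξ k ω ^ 2 - 1)).symm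
  rw [h1, quantile_comp (hasLaw_gaussianSeq (fun k => hξ (σ k)) (hindep.precomp σ.injective))
    (measurable_quadForm _)]

end Main

theorem tendsto_of_tendsto_add_one {F : ℕ × ℕ → ℝ} {c : ℝ}
    (h : Tendsto (fun M : ℕ × ℕ => F (M.1 + 1, M.2 + 1)) (atTop ×ˢ atTop) (𝓝 c)) :
    Tendsto F (atTop ×ˢ atTop) (𝓝 c) := by
  have h1 : (atTop ×ˢ atTop : Filter (ℕ × ℕ))
      = map (Prod.map (· + 1) (· + 1)) (atTop ×ˢ atTop) := by
    rw [← prod_map_map_eq', map_add_atTop_eq_nat]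
  rw [h1, tendsto_map'_iff]
  exact h

end CenterOutward

theorem mainTheorem5 {p q : ℕ} (hp : 1 ≤ p) (hq : 1 ≤ q)
    (r : (S : ℕ) → Fin S → CenterOutward.E p) (s : (S : ℕ) → Fin S → CenterOutward.E q)
    (hr : 2 ≤ p → CenterOutward.IsDirectionArray p r)
    (hs : 2 ≤ q → CenterOutward.IsDirectionArray q s)
    {Ω : Type*} [MeasurableSpace Ω] (P : Measure Ω) [IsProbabilityMeasure P]
    (ξ : ℕ → Ω → ℝ) (hξ : ∀ k, HasLaw (ξ k) (gaussianReal 0 1) P) (hindep : iIndepFun ξ P) :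
    (∃ ev : ℕ → ℝ, CenterOutward.IsNullEigenvalueSequence p q ev) ∧
      ∀ ev : ℕ → ℝ, CenterOutward.IsNullEigenvalueSequence p q ev →
        (∀ᵐ ω ∂P, Summable fun k => ev k * (ξ k ω ^ 2 - 1)) ∧
          ∀ α : ℝ, 0 < α → α < 1 →
            Tendsto
              (fun M : ℕ × ℕ =>
                CenterOutward.quantile P (CenterOutward.gridForm r s ξ M.1 M.2) (1 - α))
              (atTop ×ˢ atTop)
              (𝓝 (CenterOutward.quantile P (CenterOutward.limitForm ev ξ) (1 - α))) := by
  have : NeZero p := ⟨by omega⟩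
  have : NeZero q := ⟨by omega⟩
  refine ⟨CenterOutward.exists_isNullEigenvalueSequence p q, fun ev hev => ?_⟩
  obtain ⟨hpos, hsum⟩ := hev.pos_and_hasSum
  have hsummable : Summable ev := by simpa using (hsum 0).summable
  have hlaw := CenterOutward.hasLaw_gaussianSeq hξ hindep
  constructor
  · have h1 := CenterOutward.ae_summable_quadForm hsummable.abs
    rw [← hlaw.map_eq] at h1
    exact ae_of_ae_map hlaw.aemeasurable h1
  · intro α hα0 hα1
    obtain ⟨σ, hσ⟩ := CenterOutward.exists_equiv_antitone hpos hsummable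
    rw [CenterOutward.quantile_limitForm hξ hindep ev σ]
    refine CenterOutward.tendsto_of_tendsto_add_one ?_
    refine (CenterOutward.tendsto_quantile_quadForm
      (w := fun M : ℕ × ℕ => CenterOutward.gridWeight r s (M.1 + 1) (M.2 + 1))
      (fun M => (CenterOutward.summable_gridWeight _ _).abs)
      (Summable.abs (σ.summable_iff.2 hsummable)) (hpos _)
      (CenterOutward.tendsto_tsum_abs_gridWeight_sub hr hs hev hσ)
      (by linarith) (by linarith)).congr fun M => ?_
    rw [CenterOutward.gridForm_eq_quadForm hr hs M.1.succ_pos M.2.succ_pos,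
      CenterOutward.quantile_comp hlaw (CenterOutward.measurable_quadForm _)]
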